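/- **Setting.** A processor has speeds $0=s_0<s_1<\dots<s_k$ with powers $0=P_0<P_1<\dots<P_k$ that are well-separated: for some $c>1$ the slopes $\Delta_i=\frac{P_i-P_{i-1}}{s_i-s_{i-1}}$ satisfy $\Delta_{i+1}=c\,\Delta_i$. Its battery is initially empty and is recharged at rate $R\ge 0$. Jobs $j=1,\dots,n$ have release times $r_j\ge 0$, deadlines $d_j>r_j$ and works $p_j>0$; $j$ is active at the times of $[r_j,d_j)$. A schedule $S$ assigns to each time a speed index and a job (or idles, at speed $s_0$); $E_S(t)$ is the battery level at time $t$. Given a finite set of positive depletion points, $[0,\infty)$ is cut at these points into depletion intervals $I_1,I_2,\dots$. Let $w_{j,\ell}$ be the work of $j$ that is processed in $I_\ell$, and $s_{j,\ell}$ the average speed of $j$ in $I_\ell$, that is, $w_{j,\ell}$ divided by the length of the time in $I_\ell$ that is assigned to $j$. **States.** A state of the algorithm consists of a rate $R$, a schedule $S$, a finite set of labelled depletion points $\tau>0$ with $E_S(\tau)=0$, and speed levels $\mathcal L(j,\ell)\in\mathbb N$. In each depletion interval $S$ is a YDS schedule of the work assigned to it (critical intervals of maximum intensity, in earliest-deadline-first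 order); $S$ consists of finitely many pieces, cut at least at all releases, deadlines and depletion points, in each of which it idles or runs one job $j$ at average speed $s_{j,\ell}$, first at a discrete speed and then at the next higher one. **Properties.** (a) $S$ is feasible: jobs run only while active, every job $j$ receives at least work $p_j$, and $E_S(t)\ge 0$ for all $t\ge 0$. (b) The work in each depletion interval is scheduled energy-optimally: no schedule that runs jobs only while active and processes the same work of every job in this interval uses less energy in it. (c) The Speed Level Relation holds with the levels $\mathcal L$: 1. if $j$ is processed in $I_\ell$ at speed $s_{j,\ell}\in(s_{i-1},s_i)$, then $\mathcal L(j,\ell)=i$; 2. if $j$ is processed in $I_\ell$ at speed $s_{j,\ell}=s_i$, then $\mathcal L(j,\ell)\in\{i,i+1\}$; 3. if $j,j'$ are both active at some times of $I_{\ell_1}$ and at some times of $I_{\ell_2}$, $\ell_1<\ell_2$, then $\mathcal L(j,\ell_2)-\mathcal L(j,\ell_1)=\mathcal L(j',\ell_2)-\mathcal L(j',\ell_1)\ge 0$; 4. if $j$ is run at a time $t\in I_\ell$, then $\mathcal L(j,\ell)\ge\mathcal L(j',\ell)$ for all $j'$ active at time $t$. **The algorithm.** *Initially* $S$ is a YDS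 schedule of the instance, $R\ge 0$ is such that the battery level never falls below zero, no depletion points are labelled, and $\mathcal L(j,1)$ is the $i$ with $s_{j,1}\in(s_{i-1},s_i]$. An *active $\varepsilon$-transfer* is a finite nonempty sequence of moves, each taking work of one job from one depletion interval to the next one of the sequence, such that every sufficiently small amount of work can be moved along it (the same amount in all moves at the same time) with a resulting YDS schedule in which no job speed in the intermediate depletion intervals changes and (c) holds with the current levels. *Moving work:* for every depletion interval except the rightmost one an active $\varepsilon$-transfer out of it is chosen, such that the chosen transfers form a tree directed towards the rightmost depletion interval. While $R$ decreases at rate $1$ (and stays non-negative), work is moved along each chosen transfer at a constant non-negative rate, with rates such that initially the rate of change of the battery level at every labelled depletion point is $0$; levels and depletion points are kept, and the schedule is always a YDS schedule of the current workloads. This goes on at most until the first of the following events: (i) the battery level at an unlabelled deadline is zero and is about to become negative; (ii) some $w_{j,\ell}$ becomes zero; (iii) some $s_{j,\ell}$ of a processed job reaches, or is about to leave, a discrete speed. *Handling a non-cut event:* either the depletion points are kept, or an unlabelled deadline at which the battery level is zero is labelled as a depletion point, whereby both parts of the depletion interval that it splits inherit its levels; $R$ and all other levels are kept; the schedule may be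 recomputed as a YDS schedule of the workloads that the current schedule processes in the new depletion intervals. **Theorem.** The initial state is a state in the above sense and satisfies (a)–(c). If a state satisfies (a)–(c), then so does every state that is passed while moving work from it, including the one at which this stops; and so does the state after handling a non-cut event. All of these are again states in the above sense; in particular the battery is empty at all labelled depletion points. -/

import Mathlib

open MeasureTheory Set Filter Topology

noncomputable section

namespace SolarCell

/-- An instance: `n` jobs with release times, deadlines and works, and a processor with speeds
`0 = s 0 < s 1 < ... < s k` (index `0` is idling) and powers `0 = P 0 < P 1 < ... < P k`
that are well-separated. -/
structure Instance (n k : ℕ) where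
  r : Fin n → ℝ
  d : Fin n → ℝ
  p : Fin n → ℝ
  s : Fin (k + 1) → ℝ
  P : Fin (k + 1) → ℝ
  r_nonneg : ∀ j, 0 ≤ r j
  r_lt_d : ∀ j, r j < d j
  p_pos : ∀ j, 0 < p j
  s_zero : s 0 = 0
  P_zero : P 0 = 0
  s_mono : StrictMono s
  P_mono : StrictMono P
  wellSeparated : ∃ c : ℝ, 1 < c ∧ ∀ i i' : Fin k, (i' : ℕ) = i + 1 →
    (P i'.succ - P i'.castSucc) / (s i'.succ - s i'.castSucc) =
      c * ((P i.succ - P i.castSucc) / (s i.succ - s i.castSucc))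

/-- A schedule: a speed index and a job (or none, when idling) for every time. -/
structure Schedule (n k : ℕ) where
  speed : ℝ → Fin (k + 1)
  job : ℝ → Option (Fin n)
  measurable_speed : ∀ i, MeasurableSet {t | speed t = i}
  measurable_job : ∀ j, MeasurableSet {t | job t = some j}
  idle : ∀ t, job t = none → speed t = 0

variable {n k : ℕ}

/-- The work of job `j` that `S` processes during the time set `A`. -/
def work (I : Instance n k) (S : Schedule n k) (j : Fin n) (A : Set ℝ) : ℝ :=
  ∫ t in A ∩ {t | S.job t = some j}, I.s (S.speed t)

/-- The energy that `S` consumes during the time set `A`. -/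
def energy (I : Instance n k) (S : Schedule n k) (A : Set ℝ) : ℝ :=
  ∫ t in A, I.P (S.speed t)

/-- The energy remaining in the battery at time `t` with recharge rate `R`. -/
def battery (I : Instance n k) (S : Schedule n k) (R t : ℝ) : ℝ :=
  R * t - energy I S (Ico 0 t)

/-- The average speed of job `j` during `A`. -/
def avgSpeed (I : Instance n k) (S : Schedule n k) (j : Fin n) (A : Set ℝ) : ℝ :=
  work I S j A / volume.real (A ∩ {t | S.job t = some j})

/-- Jobs are only run between their release times and deadlines. -/
def RespectsWindows (I : Instance n k) (S : Schedule n k) : Prop :=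
  ∀ t j, S.job t = some j → t ∈ Ico (I.r j) (I.d j)

/-- Feasibility: jobs run only while active, all jobs are finished, and the battery level never
falls below zero. -/
def Feasible (I : Instance n k) (S : Schedule n k) (R : ℝ) : Prop :=
  RespectsWindows I S ∧ (∀ j, I.p j ≤ work I S j univ) ∧
    0 ≤ R ∧ ∀ t, 0 ≤ t → 0 ≤ battery I S R t

/-- The work that `S` processes during `A` is scheduled energy optimally. -/
def EnergyOptimalOn (I : Instance n k) (S : Schedule n k) (A : Set ℝ) : Prop :=
  ∀ S' : Schedule n k, RespectsWindows I S' → (∀ j, work I S' j A = work I S j A) →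
    energy I S A ≤ energy I S' A

/-! Depletion intervals. For a finite set `D` of (labelled) depletion points the depletion
intervals are indexed by their left end points, which are `0` and the members of `D`. -/

/-- The left end points of the depletion intervals. -/
def starts (D : Finset ℝ) : Finset ℝ := insert 0 D

/-- The depletion interval that starts at `a`: it ends at the next depletion point, if any. -/
def interval (D : Finset ℝ) (a : ℝ) : Set ℝ := {t | a ≤ t ∧ ∀ e ∈ D, a < e → t < e}

/-- The left end point of the rightmost depletion interval. -/
def lastStart (D : Finset ℝ) : ℝ := (starts D).max' ⟨0, Finset.mem_insert_self 0 D⟩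

/-- Job `j` is active at some time of `A`. -/
def ActiveIn (I : Instance n k) (j : Fin n) (A : Set ℝ) : Prop :=
  (A ∩ Ico (I.r j) (I.d j)).Nonempty

/-- The Speed Level Relation with speed levels `lev j a` (of job `j` in the depletion interval
that starts at `a`). The first two clauses speak about jobs that are processed in the interval;
`i : Fin k` in the first clause stands for the pair of consecutive speeds `s_i < s_{i+1}`. -/
structure SLR (I : Instance n k) (D : Finset ℝ) (S : Schedule n k) (lev : Fin n → ℝ → ℕ) :
    Prop where
  between : ∀ a ∈ starts D, ∀ j, 0 < work I S j (interval D a) → ∀ i : Fin k,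
    avgSpeed I S j (interval D a) ∈ Ioo (I.s i.castSucc) (I.s i.succ) → lev j a = i + 1
  discrete : ∀ a ∈ starts D, ∀ j, 0 < work I S j (interval D a) → ∀ i : Fin (k + 1),
    avgSpeed I S j (interval D a) = I.s i → lev j a = i ∨ lev j a = i + 1
  jump : ∀ a ∈ starts D, ∀ b ∈ starts D, a < b → ∀ j j',
    ActiveIn I j (interval D a) → ActiveIn I j (interval D b) →
    ActiveIn I j' (interval D a) → ActiveIn I j' (interval D b) →
    lev j a ≤ lev j b ∧ (lev j b : ℤ) - lev j a = (lev j' b : ℤ) - lev j' a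
  maximal : ∀ a ∈ starts D, ∀ t ∈ interval D a, ∀ j j', S.job t = some j →
    t ∈ Ico (I.r j') (I.d j') → lev j' a ≤ lev j a

/-! YDS schedules. -/

/-- `S` runs job `j` on `[x, y)` at average speed `v`: first at a discrete speed, then at the next
higher one. -/
def RunsAt (I : Instance n k) (S : Schedule n k) (j : Fin n) (v x y : ℝ) : Prop :=
  ∃ i : Fin k, ∃ z ∈ Icc x y,
    (∀ t ∈ Ico x y, S.job t = some j) ∧
    (∀ t ∈ Ico x z, S.speed t = i.castSucc) ∧
    (∀ t ∈ Ico z y, S.speed t = i.succ) ∧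
    I.s i.castSucc * (z - x) + I.s i.succ * (y - z) = v * (y - x)

open Classical in
/-- The jobs in `U` that have to be run within `[x, y)` if, of the time set `A`, only the
time in `T` is still available. -/
def confined (I : Instance n k) (A T : Set ℝ) (U : Finset (Fin n)) (x y : ℝ) : Finset (Fin n) :=
  U.filter fun j => A ∩ Ico (I.r j) (I.d j) ∩ T ⊆ Ico x y

/-- The critical interval procedure of Yao, Demers and Shenker for the work that `S` processes
during `A`, where `T` is the time that is still available and `U` the set of jobs that still have
to be scheduled: an interval `[x, y)` of maximum intensity `g` is chosen, the jobs confined to it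
are run at speed `g` in its available time in earliest-deadline-first order, and the procedure
continues with the remaining jobs in the remaining time. -/
inductive CriticalIntervals (I : Instance n k) (S : Schedule n k) (A : Set ℝ) :
    Set ℝ → Finset (Fin n) → Prop
  | done (T : Set ℝ) (h : ∀ t ∈ T, S.job t = none) : CriticalIntervals I S A T ∅
  | step (T : Set ℝ) (U : Finset (Fin n)) (x y g : ℝ)
      (hne : (confined I A T U x y).Nonempty)
      (hg : ∑ j ∈ confined I A T U x y, work I S j A = g * volume.real (T ∩ Ico x y))
      (hmax : ∀ x' y', ∑ j ∈ confined I A T U x' y', work I S j A ≤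
        g * volume.real (T ∩ Ico x' y'))
      (hspeed : ∀ j ∈ confined I A T U x y, avgSpeed I S j A = g)
      (hedf : ∀ t ∈ T ∩ Ico x y, ∃ j ∈ confined I A T U x y, S.job t = some j ∧
        ∀ j' ∈ confined I A T U x y, t ∈ Ico (I.r j') (I.d j') →
          0 < work I S j' (A ∩ Ici t) → I.d j ≤ I.d j')
      (hrest : CriticalIntervals I S A (T \ Ico x y) (U \ confined I A T U x y)) :
      CriticalIntervals I S A T U

open Classical in
/-- `S` obeys YDS in each depletion interval: it follows the critical interval procedure, and the
time axis is cut into finitely many pieces (at least at all release times, deadlines and depletion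
points) on each of which `S` idles or runs one job at that job's average speed in the depletion
interval. -/
def ObeysYDS (I : Instance n k) (S : Schedule n k) (D : Finset ℝ) : Prop :=
  RespectsWindows I S ∧
  (∀ a ∈ starts D, CriticalIntervals I S (interval D a) (interval D a)
    (Finset.univ.filter fun j => 0 < work I S j (interval D a))) ∧
  ∃ F : Finset ℝ, starts D ⊆ F ∧ (∀ j, I.r j ∈ F ∧ I.d j ∈ F) ∧
    ∀ x ∈ F, ∀ y ∈ F, x < y → (∀ z ∈ F, z ≤ x ∨ y ≤ z) →
      ∀ a ∈ starts D, x ∈ interval D a →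
        (∀ t ∈ Ico x y, S.job t = none) ∨
        ∃ j, RunsAt I S j (avgSpeed I S j (interval D a)) x y

/-! The states of the algorithm and the properties that it maintains. -/

/-- A state of the algorithm: the recharge rate, the schedule, the labelled depletion points and
the speed levels. -/
structure State (n k : ℕ) where
  rate : ℝ
  sched : Schedule n k
  depl : Finset ℝ
  lev : Fin n → ℝ → ℕ

/-- The labelled depletion points are positive times at which the battery is empty, and the
schedule obeys YDS between them. -/
def IsState (I : Instance n k) (σ : State n k) : Prop :=
  (∀ e ∈ σ.depl, 0 < e ∧ battery I σ.sched σ.rate e = 0) ∧ ObeysYDS I σ.sched σ.depl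

/-- The three optimality properties: feasibility, energy optimality in each depletion interval,
and the Speed Level Relation. -/
def OptimalityABC (I : Instance n k) (σ : State n k) : Prop :=
  Feasible I σ.sched σ.rate ∧
  (∀ a ∈ starts σ.depl, EnergyOptimalOn I σ.sched (interval σ.depl a)) ∧
  SLR I σ.depl σ.sched σ.lev

/-- The initial state: a YDS schedule of the instance, a recharge rate with which the battery level
never falls below zero, no labelled depletion points yet, and for each job the (smallest) speed
level that corresponds to its speed. -/
def IsInitial (I : Instance n k) (σ : State n k) : Prop :=
  σ.depl = ∅ ∧ ObeysYDS I σ.sched ∅ ∧ (∀ j, work I σ.sched j univ = I.p j) ∧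
  0 ≤ σ.rate ∧ (∀ t, 0 ≤ t → 0 ≤ battery I σ.sched σ.rate t) ∧
  ∀ j, ∃ i : Fin k, avgSpeed I σ.sched j (interval ∅ 0) ∈ Ioc (I.s i.castSucc) (I.s i.succ) ∧
    σ.lev j 0 = i + 1

/-- A sequence of `len` moves; move number `a` takes work of `job a` from the depletion interval
`loc a` to the depletion interval `loc (a + 1)`. -/
structure Transfer (n : ℕ) where
  len : ℕ
  loc : ℕ → ℝ
  job : ℕ → Fin n

/-- The net change of the work of job `j` in the depletion interval `b` per unit of work moved
along `T`. -/
def Transfer.change (T : Transfer n) (j : Fin n) (b : ℝ) : ℝ :=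
  ∑ a ∈ Finset.range T.len,
    ((if T.job a = j ∧ T.loc (a + 1) = b then 1 else 0) -
      (if T.job a = j ∧ T.loc a = b then 1 else 0))

/-- `T` is an active transfer in the state `σ`: sufficiently small amounts of work can be
moved along `T` such that the schedule still obeys YDS, no job speed changes in the intermediate
depletion intervals, and the Speed Level Relation still holds with the current speed levels.
(Work is only moved, so all jobs stay finished. The battery is not part of this condition, since the
recharge rate and the other transfers influence it. The order of the jobs is not restricted
any further, so transfers that violate weak EDF are covered, too.) -/
def Transfer.Active (I : Instance n k) (σ : State n k) (T : Transfer n) : Prop :=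
  0 < T.len ∧ (∀ a ≤ T.len, T.loc a ∈ starts σ.depl) ∧
  ∃ ε₀ > 0, ∀ ε ∈ Ioc (0 : ℝ) ε₀, ∃ S' : Schedule n k,
    ObeysYDS I S' σ.depl ∧
    (∀ j, ∀ b ∈ starts σ.depl, work I S' j (interval σ.depl b) =
      work I σ.sched j (interval σ.depl b) + ε * T.change j b) ∧
    (∀ a, 0 < a → a < T.len → ∀ j, 0 < work I σ.sched j (interval σ.depl (T.loc a)) →
      0 < work I S' j (interval σ.depl (T.loc a)) →
      avgSpeed I S' j (interval σ.depl (T.loc a)) =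
        avgSpeed I σ.sched j (interval σ.depl (T.loc a))) ∧
    SLR I σ.depl S' σ.lev

/-! Events while work is moved: `S x` is the schedule when the recharge rate has been decreased
from `R` by `x`. -/

/-- The remaining energy at an unlabelled deadline is zero and is about to become negative. -/
def DepletionPointAppears (I : Instance n k) (R : ℝ) (D : Finset ℝ) (S : ℝ → Schedule n k)
    (x : ℝ) : Prop :=
  ∃ j, I.d j ∉ D ∧ battery I (S x) (R - x) (I.d j) = 0 ∧
    ∃ᶠ y in 𝓝[>] x, battery I (S y) (R - y) (I.d j) < 0

/-- The work of some job in some depletion interval has become zero. -/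
def EdgeRemoved (I : Instance n k) (D : Finset ℝ) (S : ℝ → Schedule n k) (x : ℝ) : Prop :=
  ∃ j, ∃ b ∈ starts D, work I (S x) j (interval D b) = 0 ∧
    ∃ y ∈ Ico 0 x, 0 < work I (S y) j (interval D b)

/-- The speed of some job in some depletion interval reaches or leaves a discrete speed. -/
def EdgeInactive (I : Instance n k) (D : Finset ℝ) (S : ℝ → Schedule n k) (x : ℝ) : Prop :=
  ∃ j, ∃ b ∈ starts D, 0 < work I (S x) j (interval D b) ∧ ∃ i : Fin (k + 1),
    avgSpeed I (S x) j (interval D b) = I.s i ∧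
    ¬ ∀ᶠ y in 𝓝 x, avgSpeed I (S y) j (interval D b) = I.s i

/-- One round of moving work from the state `σ`: for each depletion interval but the rightmost
one an active transfer `path a` out of it is chosen, such that the chosen transfers form a tree
rooted at the rightmost depletion interval; while the recharge rate decreases at rate one, work
is moved along `path a` at rate `amount a`, with rates such that the energy at all depletion points
does not change, the schedule being a YDS schedule of the current workloads throughout. The round
ends at the next event at the latest. The choice among the active transfers is arbitrary; in
particular every choice by priorities is covered. -/
structure Move (I : Instance n k) (σ : State n k) where
  path : ℝ → Transfer n
  amount : ℝ → ℝ
  decrease : ℝ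
  S : ℝ → Schedule n k
  active : ∀ a ∈ starts σ.depl, a ≠ lastStart σ.depl →
    (path a).Active I σ ∧ (path a).loc 0 = a
  rooted : ∀ a ∈ starts σ.depl, ∃ m : ℕ,
    (fun b => (path b).loc (path b).len)^[m] a = lastStart σ.depl
  amount_nonneg : ∀ a, 0 ≤ amount a
  decrease_nonneg : 0 ≤ decrease
  decrease_le : decrease ≤ σ.rate
  S_zero : S 0 = σ.sched
  yds : ∀ x ∈ Icc 0 decrease, ObeysYDS I (S x) σ.depl
  work_eq : ∀ x ∈ Icc 0 decrease, ∀ j, ∀ b ∈ starts σ.depl,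
    work I (S x) j (interval σ.depl b) = work I σ.sched j (interval σ.depl b) +
      x * ∑ a ∈ (starts σ.depl).erase (lastStart σ.depl), amount a * (path a).change j b
  energy_rate : ∀ e ∈ σ.depl,
    HasDerivWithinAt (fun x => battery I (S x) (σ.rate - x) e) 0 (Icc 0 decrease) 0
  no_depletionPoint : ∀ x ∈ Ico 0 decrease, ¬ DepletionPointAppears I σ.rate σ.depl S x
  no_removal : ∀ x ∈ Ioo 0 decrease, ¬ EdgeRemoved I σ.depl S x
  no_inactive : ∀ x ∈ Ioo 0 decrease, ¬ EdgeInactive I σ.depl S x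

/-- The state when the recharge rate has been decreased by `x` in the round `m`. -/
def Move.state {I : Instance n k} {σ : State n k} (m : Move I σ) (x : ℝ) : State n k :=
  ⟨σ.rate - x, m.S x, σ.depl, σ.lev⟩

/-- `σ'` has the recharge rate of `σ`, its schedule is a YDS schedule of the workloads that `σ`
processes in the depletion intervals of `σ'`, and the speed levels in these depletion intervals are
those in the depletion intervals of `σ` that contain them. -/
def Updated (I : Instance n k) (σ σ' : State n k) : Prop :=
  σ'.rate = σ.rate ∧ ObeysYDS I σ'.sched σ'.depl ∧
  (∀ j, ∀ b ∈ starts σ'.depl, work I σ'.sched j (interval σ'.depl b) =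
    work I σ.sched j (interval σ'.depl b)) ∧
  ∀ a ∈ starts σ.depl, ∀ b ∈ starts σ'.depl, b ∈ interval σ.depl a → ∀ j,
    σ'.lev j b = σ.lev j a

/-- Handling a non-cut event. At an edge removal or edge inactive event only new transfers are
chosen (the schedule may be recomputed). At a depletion point appearance a deadline at
which the battery is empty is labelled as a depletion point. -/
inductive HandlesNonCutEvent (I : Instance n k) (σ σ' : State n k) : Prop
  | edge (hD : σ'.depl = σ.depl) (h : Updated I σ σ')
  | depletionPoint (j : Fin n) (hj : I.d j ∉ σ.depl)
      (hE : battery I σ.sched σ.rate (I.d j) = 0)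
      (hD : σ'.depl = insert (I.d j) σ.depl) (h : Updated I σ σ')

end SolarCell

end

/-!
A YDS schedule runs, in every depletion interval `A` and at every time, a job of maximum average
speed among the active jobs that have work in `A` (`CriticalIntervals.max_speed`, `Greedy`). The
power function is a non-negative combination of hinge functions `max (· - s i) 0`
(`Instance.exists_hinge_weights`), so the total energy is governed by the excess of the speed
profile over each `s i`. Both facts together give energy optimality by convex duality
(`Greedy.sum_hinge_le`), and they bound the integral of `(g - g') ^ 2`, for the speed profiles `g`
and `g'` of two YDS schedules, by the sum of `(g_j - g'_j) * (w_j - w'_j)` over the speeds and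
workloads of all jobs `j` (`Greedy.sq_sub_mul_le`). Hence the workloads determine the speed profile,
which depends continuously on them.

The Speed Level Relation inside one interval is equivalent to conditions on the workloads that are
linear once the set of processed jobs is fixed (`LevelCert`, `Greedy.levelCert`,
`Greedy.levels_of_cert`): jobs of level at most `i` fit at speed `s i` into the time which higher
levels leave free, and jobs of level above `i` fill their time at speed at least `s i`. Therefore
the relation depends neither on the YDS schedule chosen nor on the order of jobs, which settles the
recomputation of schedules and the labelling of deadlines (`optimality_of_updated`).

When work is moved, the conditions hold for each active transfer alone and for a short time, and
linearity extends them to all transfers together (`levelCert_of_directions`). They persist on a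
closed set of progress values; within the round, the speeds are continuous and do not pass a
discrete speed, so this set is also open to the right (`levelCert_of_same_bracket`). With fixed
levels the energy in each depletion interval is affine in the progress. Its derivative is such that
the battery level at the depletion points is initially constant, so it remains zero
(`Move.battery_depl`). At the other deadlines the battery level is continuous and cannot become
negative before an event (`Move.battery_deadline_nonneg`). Between deadlines and depletion points the
speed of a YDS schedule does not decrease, so the battery level is nowhere below its values there
(`ObeysYDS.battery_nonneg`).
-/

namespace SolarCell

variable {n k : ℕ} {I : Instance n k} {S S' : Schedule n k} {A : Set ℝ} {D D' F : Finset ℝ}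

/-! ### The power function as a combination of hinge functions -/

/-- A function on `0, ..., k` that starts at `0` and has non-negative, non-decreasing slopes with
respect to `s` is a non-negative combination of the hinge functions `max (· - s i) 0`. -/
theorem exists_hinge_weights_nat (s P : ℕ → ℝ) (k : ℕ) (hs : ∀ i < k, s i < s (i + 1))
    (hP : P 0 = 0) (h0 : 0 < k → P 0 ≤ P 1)
    (hslope : ∀ i, i + 1 < k → (P (i + 1) - P i) / (s (i + 1) - s i) ≤
      (P (i + 2) - P (i + 1)) / (s (i + 2) - s (i + 1))) :
    ∃ w : ℕ → ℝ, (∀ i < k, 0 ≤ w i) ∧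
      ∀ m ≤ k, P m = ∑ i ∈ Finset.range m, w i * (s m - s i) := by
  set L : ℕ → ℝ := fun i => (P (i + 1) - P i) / (s (i + 1) - s i) with hL
  refine ⟨fun i => if i = 0 then L 0 else L i - L (i - 1), ?_, ?_⟩
  · intro i hi
    rcases i with _ | i
    · simp only [if_true]
      exact div_nonneg (by linarith [h0 hi]) (by linarith [hs 0 hi])
    · simp only [Nat.add_eq_zero_iff, one_ne_zero, and_false, if_false, Nat.add_sub_cancel]
      linarith [hslope i hi]
  · have hsum : ∀ m, ∑ i ∈ Finset.range (m + 1),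
        (if i = 0 then L 0 else L i - L (i - 1)) = L m := by
      intro m
      induction m with
      | zero => simp
      | succ m ih => rw [Finset.sum_range_succ, ih]; simp
    intro m
    induction m with
    | zero => intro _; simp [hP]
    | succ m ih =>
      intro hm
      have h1 := ih (by omega)
      have h2 : s (m + 1) - s m ≠ 0 := by linarith [hs m (by omega)]
      have h3 : L m * (s (m + 1) - s m) = P (m + 1) - P m := div_mul_cancel₀ _ h2
      have h4 : ∑ i ∈ Finset.range (m + 1), (if i = 0 then L 0 else L i - L (i - 1)) *
          (s (m + 1) - s i) = ∑ i ∈ Finset.range (m + 1),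
          (if i = 0 then L 0 else L i - L (i - 1)) * (s m - s i) +
          (∑ i ∈ Finset.range (m + 1), (if i = 0 then L 0 else L i - L (i - 1))) *
            (s (m + 1) - s m) := by
        rw [Finset.sum_mul, ← Finset.sum_add_distrib]
        exact Finset.sum_congr rfl fun i _ => by ring
      rw [h4, hsum, Finset.sum_range_succ, ← h1, h3]
      ring

theorem Instance.s_nonneg (I : Instance n k) (i : Fin (k + 1)) : 0 ≤ I.s i := by
  rw [← I.s_zero]; exact I.s_mono.monotone (Fin.zero_le i)

theorem Instance.P_nonneg (I : Instance n k) (i : Fin (k + 1)) : 0 ≤ I.P i := by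
  rw [← I.P_zero]; exact I.P_mono.monotone (Fin.zero_le i)

theorem Instance.s_le_last (I : Instance n k) (i : Fin (k + 1)) : I.s i ≤ I.s (Fin.last k) :=
  I.s_mono.monotone (Fin.le_last i)

/-- Well-separation makes the power convex in the speed: it is a non-negative combination of
hinge functions whose kinks are discrete speeds. -/
theorem Instance.exists_hinge_weights (I : Instance n k) :
    ∃ δ : Fin (k + 1) → ℝ, (∀ i, 0 ≤ δ i) ∧
      ∀ m, I.P m = ∑ i, δ i * max (I.s m - I.s i) 0 := by
  obtain ⟨c, hc, hsep⟩ := I.wellSeparated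
  have hslope : ∀ i : Fin k,
      0 ≤ (I.P i.succ - I.P i.castSucc) / (I.s i.succ - I.s i.castSucc) := fun i =>
    div_nonneg (sub_nonneg.2 (I.P_mono.monotone (Fin.castSucc_lt_succ).le))
      (sub_nonneg.2 (I.s_mono.monotone (Fin.castSucc_lt_succ).le))
  let e : ℕ → Fin (k + 1) := fun i => ⟨min i k, by omega⟩
  have he : ∀ i (hi : i < k), e i = (⟨i, hi⟩ : Fin k).castSucc := fun i hi => by
    ext; simp [e]; omega
  have he' : ∀ i (hi : i < k), e (i + 1) = (⟨i, hi⟩ : Fin k).succ := fun i hi => by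
    ext; simp [e]; omega
  have he0 : e 0 = 0 := by ext; simp [e]
  obtain ⟨w, hw, hP⟩ := exists_hinge_weights_nat (fun i => I.s (e i)) (fun i => I.P (e i)) k
    (fun i hi => by
      simp only [he i hi, he' i hi]; exact I.s_mono Fin.castSucc_lt_succ)
    (by simp only [he0, I.P_zero])
    (fun hk => by simp only [he0, I.P_zero]; exact I.P_nonneg _)
    (fun i hi => by
      have h1 := hsep ⟨i, by omega⟩ ⟨i + 1, hi⟩ rfl
      rw [← he _ hi, ← he' _ hi, ← he _ (by omega : i < k), ← he' _ (by omega : i < k)] at h1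
      have h2 := hslope ⟨i, by omega⟩
      rw [← he _ (by omega : i < k), ← he' _ (by omega : i < k)] at h2
      change _ ≤ (I.P (e (i + 1 + 1)) - I.P (e (i + 1))) / (I.s (e (i + 1 + 1)) - I.s (e (i + 1)))
      rw [h1]
      nlinarith)
  refine ⟨fun i => if (i : ℕ) < k then w i else 0, fun i => ?_, fun m => ?_⟩
  · dsimp only; split_ifs with h
    exacts [hw _ h, le_rfl]
  · have hem : ∀ i : Fin (k + 1), e i = i := fun i => by ext; simp [e]; omega
    have h := hP m (by omega)
    simp only [hem] at h
    have h1 : ∑ i : Fin (k + 1), (if (i : ℕ) < k then w i else 0) * max (I.s m - I.s i) 0 =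
        ∑ i ∈ Finset.range (k + 1), (if i < k then w i else 0) * max (I.s m - I.s (e i)) 0 := by
      rw [Finset.sum_range]; simp only [hem]
    rw [h1, h, ← Finset.sum_subset (Finset.range_mono (by omega : (m : ℕ) ≤ k + 1))]
    · refine Finset.sum_congr rfl fun i hi => ?_
      have hi' : i < m := Finset.mem_range.1 hi
      have : I.s (e i) ≤ I.s m := I.s_mono.monotone (Fin.le_def.2 (by simp [e]; omega))
      rw [if_pos (by omega), max_eq_left (by linarith)]
    · intro i hi hi'
      have hi1 : i < k + 1 := Finset.mem_range.1 hi
      have hi2 : ¬ i < m := fun h => hi' (Finset.mem_range.2 h)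
      have : I.s m ≤ I.s (e i) := I.s_mono.monotone (Fin.le_def.2 (by simp [e]; omega))
      rw [max_eq_right (by linarith), mul_zero]

/-! ### Work, time and average speed -/

/-- The length of the time in `A` that `S` assigns to job `j`. -/
noncomputable def dur (S : Schedule n k) (j : Fin n) (A : Set ℝ) : ℝ :=
  volume.real (A ∩ {t | S.job t = some j})

/-- The function of time that takes the value `c j` while job `j` is run and `0` while `S`
idles. -/
def jobFun (S : Schedule n k) (c : Fin n → ℝ) (t : ℝ) : ℝ := (S.job t).elim 0 c

theorem jobFun_some {c : Fin n → ℝ} {t : ℝ} {j : Fin n} (h : S.job t = some j) :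
    jobFun S c t = c j := by simp [jobFun, h]

theorem jobFun_none {c : Fin n → ℝ} {t : ℝ} (h : S.job t = none) : jobFun S c t = 0 := by
  simp [jobFun, h]

theorem jobFun_nonneg {c : Fin n → ℝ} (hc : ∀ j, 0 ≤ c j) (t : ℝ) : 0 ≤ jobFun S c t := by
  rcases h : S.job t with _ | j
  · rw [jobFun_none h]
  · rw [jobFun_some h]; exact hc j

theorem jobFun_eq_sum (c : Fin n → ℝ) :
    jobFun S c = fun t => ∑ j, {t | S.job t = some j}.indicator (fun _ => c j) t := by
  ext t
  rcases h : S.job t with _ | j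
  · simp [jobFun, h, indicator]
  · simp [jobFun, h, indicator]

theorem RespectsWindows.volume_job_lt_top (h : RespectsWindows I S) (j : Fin n) :
    volume {t | S.job t = some j} < ⊤ :=
  (measure_mono fun t ht => h t j ht).trans_lt measure_Ico_lt_top

theorem RespectsWindows.volume_inter_ne_top (h : RespectsWindows I S) (j : Fin n) (A : Set ℝ) :
    volume (A ∩ {t | S.job t = some j}) ≠ ⊤ :=
  ((measure_mono inter_subset_right).trans_lt (h.volume_job_lt_top j)).ne

theorem RespectsWindows.integrable_jobFun (h : RespectsWindows I S) (c : Fin n → ℝ) :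
    Integrable (jobFun S c) := by
  rw [jobFun_eq_sum]
  exact integrable_finsetSum _ fun j _ => (integrable_indicator_iff (S.measurable_job j)).2
    (integrableOn_const (h.volume_job_lt_top j).ne)

theorem RespectsWindows.setIntegral_jobFun (h : RespectsWindows I S) (c : Fin n → ℝ) (A : Set ℝ) :
    ∫ t in A, jobFun S c t = ∑ j, c j * dur S j A := by
  rw [jobFun_eq_sum, integral_finsetSum]
  · refine Finset.sum_congr rfl fun j _ => ?_
    rw [setIntegral_indicator (S.measurable_job j), setIntegral_const, smul_eq_mul, mul_comm, dur]
  · exact fun j _ => ((integrable_indicator_iff (S.measurable_job j)).2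
      (integrableOn_const (h.volume_job_lt_top j).ne)).integrableOn

theorem Schedule.measurable_comp_speed (S : Schedule n k) (f : Fin (k + 1) → ℝ) :
    Measurable fun t => f (S.speed t) :=
  (measurable_of_countable f).comp (measurable_to_countable' fun i => S.measurable_speed i)

theorem RespectsWindows.integrable_speed (h : RespectsWindows I S) (f : Fin (k + 1) → ℝ)
    (hf : f 0 = 0) : Integrable fun t => f (S.speed t) := by
  have hsub : Function.support (fun t => f (S.speed t)) ⊆ ⋃ j, Ico (I.r j) (I.d j) := by
    intro t ht
    rcases hj : S.job t with _ | j
    · exact absurd (by simp only [S.idle t hj, hf]) ht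
    · exact mem_iUnion.2 ⟨j, h t j hj⟩
  rw [← integrableOn_iff_integrable_of_support_subset hsub]
  refine Measure.integrableOn_of_bounded (M := ∑ i, |f i|) ?_
    (S.measurable_comp_speed f).aestronglyMeasurable (ae_of_all _ fun t => ?_)
  · refine ((measure_iUnion_le _).trans_lt ?_).ne
    rw [tsum_fintype]
    exact ENNReal.sum_lt_top.2 fun j _ => measure_Ico_lt_top
  · exact Finset.single_le_sum (f := fun i => |f i|) (fun i _ => abs_nonneg _)
      (Finset.mem_univ (S.speed t))

theorem work_nonneg (j : Fin n) (A : Set ℝ) : 0 ≤ work I S j A :=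
  integral_nonneg fun _ => I.s_nonneg _

theorem work_eq_zero {j : Fin n} (hj : ¬ 0 < work I S j A) : work I S j A = 0 :=
  le_antisymm (not_lt.1 hj) (work_nonneg j A)

theorem dur_nonneg (j : Fin n) (A : Set ℝ) : 0 ≤ dur S j A := measureReal_nonneg

theorem avgSpeed_nonneg (j : Fin n) (A : Set ℝ) : 0 ≤ avgSpeed I S j A :=
  div_nonneg (work_nonneg j A) measureReal_nonneg

theorem RespectsWindows.work_le (h : RespectsWindows I S) (j : Fin n) (A : Set ℝ) :
    work I S j A ≤ I.s (Fin.last k) * dur S j A := by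
  have h1 : work I S j A ≤ ∫ _ in A ∩ {t | S.job t = some j}, I.s (Fin.last k) :=
    integral_mono (h.integrable_speed I.s I.s_zero).integrableOn
      (integrableOn_const (h.volume_inter_ne_top j A)) fun t => I.s_le_last _
  rwa [setIntegral_const, smul_eq_mul, mul_comm] at h1

theorem RespectsWindows.dur_pos (h : RespectsWindows I S) {j : Fin n}
    (hw : 0 < work I S j A) : 0 < dur S j A := by
  refine (dur_nonneg j A).lt_of_ne fun h0 => ?_
  have := h.work_le j A
  rw [← h0, mul_zero] at this
  linarith

theorem RespectsWindows.work_eq (h : RespectsWindows I S) (j : Fin n) (A : Set ℝ) :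
    work I S j A = avgSpeed I S j A * dur S j A := by
  by_cases h0 : dur S j A = 0
  · have h1 := h.work_le j A
    rw [h0, mul_zero] at h1 ⊢
    exact le_antisymm h1 (work_nonneg j A)
  · exact (div_mul_cancel₀ _ h0).symm

theorem avgSpeed_eq_zero {j : Fin n} (h : ¬ 0 < work I S j A) : avgSpeed I S j A = 0 := by
  rw [avgSpeed, le_antisymm (not_lt.1 h) (work_nonneg j A), zero_div]

theorem RespectsWindows.avgSpeed_pos (h : RespectsWindows I S) {j : Fin n}
    (hw : 0 < work I S j A) : 0 < avgSpeed I S j A :=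
  div_pos hw (h.dur_pos hw)

theorem RespectsWindows.avgSpeed_le (h : RespectsWindows I S) (j : Fin n) (A : Set ℝ) :
    avgSpeed I S j A ≤ I.s (Fin.last k) :=
  div_le_of_le_mul₀ measureReal_nonneg (I.s_nonneg _) (h.work_le j A)

theorem measurableSet_inter_job (hA : MeasurableSet A) (j : Fin n) :
    MeasurableSet (A ∩ {t | S.job t = some j}) := hA.inter (S.measurable_job j)

theorem disjoint_jobs (A : Set ℝ) (X : Set (Fin n)) :
    X.PairwiseDisjoint fun j => A ∩ {t | S.job t = some j} := by
  intro i _ j _ hij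
  refine disjoint_left.2 fun t h1 h2 => hij ?_
  have h3 : S.job t = some i := h1.2
  exact Option.some_injective _ (h3.symm.trans h2.2)

theorem RespectsWindows.sum_dur (h : RespectsWindows I S) (hA : MeasurableSet A)
    (X : Finset (Fin n)) :
    ∑ j ∈ X, dur S j A = volume.real (⋃ j ∈ X, A ∩ {t | S.job t = some j}) :=
  (measureReal_biUnion_finset (disjoint_jobs A _)
    (fun j _ => measurableSet_inter_job hA j)
    (fun j _ => h.volume_inter_ne_top j A)).symm

theorem RespectsWindows.volume_biUnion_ne_top (h : RespectsWindows I S) (A : Set ℝ)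
    (X : Finset (Fin n)) : volume (⋃ j ∈ X, A ∩ {t | S.job t = some j}) ≠ ⊤ :=
  ((measure_biUnion_finset_le X _).trans_lt
    (ENNReal.sum_lt_top.2 fun j _ => (h.volume_inter_ne_top j A).lt_top)).ne

/-! ### The critical interval procedure -/

theorem mem_confined {T : Set ℝ} {U : Finset (Fin n)} {x y : ℝ} {j : Fin n} :
    j ∈ confined I A T U x y ↔ j ∈ U ∧ A ∩ Ico (I.r j) (I.d j) ∩ T ⊆ Ico x y := by
  simp [confined]

theorem intensity_pos {T : Set ℝ} {U : Finset (Fin n)} {x y g : ℝ}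
    (hU : ∀ j ∈ U, 0 < work I S j A) (hne : (confined I A T U x y).Nonempty)
    (hg : ∑ j ∈ confined I A T U x y, work I S j A = g * volume.real (T ∩ Ico x y)) :
    0 < g ∧ 0 < volume.real (T ∩ Ico x y) := by
  have h1 : 0 < g * volume.real (T ∩ Ico x y) := by
    rw [← hg]
    exact Finset.sum_pos (fun j hj => hU j (mem_confined.1 hj).1) hne
  have h2 : 0 < volume.real (T ∩ Ico x y) := by
    refine measureReal_nonneg.lt_of_ne fun h => ?_
    rw [← h, mul_zero] at h1
    exact h1.false
  exact ⟨pos_of_mul_pos_left h1 h2.le, h2⟩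

open Classical in
/-- Once a critical interval has been removed, no interval has a larger intensity in what
remains. -/
theorem intensity_le_of_removed {T : Set ℝ} {U : Finset (Fin n)} {x y g : ℝ} (hT : T ⊆ A)
    (hU : ∀ j ∈ U, 0 < work I S j A) (hne : (confined I A T U x y).Nonempty)
    (hg : ∑ j ∈ confined I A T U x y, work I S j A = g * volume.real (T ∩ Ico x y))
    (hmax : ∀ x' y', ∑ j ∈ confined I A T U x' y', work I S j A ≤
      g * volume.real (T ∩ Ico x' y')) (x' y' : ℝ) :
    ∑ j ∈ confined I A (T \ Ico x y) (U \ confined I A T U x y) x' y', work I S j A ≤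
      g * volume.real ((T \ Ico x y) ∩ Ico x' y') := by
  obtain ⟨hg0, hv⟩ := intensity_pos hU hne hg
  have hmem : ∀ j ∈ confined I A (T \ Ico x y) (U \ confined I A T U x y) x' y',
      j ∈ U ∧ j ∉ confined I A T U x y ∧
        (∀ t ∈ A, t ∈ Ico (I.r j) (I.d j) → t ∈ T → t ∉ Ico x y → t ∈ Ico x' y') ∧
        ∃ t ∈ T, t ∈ Ico (I.r j) (I.d j) ∧ t ∉ Ico x y ∧ t ∈ Ico x' y' := by
    intro j hj
    obtain ⟨h1, h2⟩ := mem_confined.1 hj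
    obtain ⟨h3, h4⟩ := Finset.mem_sdiff.1 h1
    have h5 : ∀ t ∈ A, t ∈ Ico (I.r j) (I.d j) → t ∈ T → t ∉ Ico x y → t ∈ Ico x' y' :=
      fun t ha hw ht hx => h2 ⟨⟨ha, hw⟩, ht, hx⟩
    refine ⟨h3, h4, h5, ?_⟩
    by_contra! h6
    refine h4 (mem_confined.2 ⟨h3, fun t ht => ?_⟩)
    by_contra hx
    exact h6 t ht.2 ht.1.2 hx (h5 t ht.1.1 ht.1.2 ht.2 hx)
  have hfin : ∀ B : Set ℝ, ∀ u v : ℝ, volume (B ∩ Ico u v) ≠ ⊤ := fun B u v =>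
    ((measure_mono inter_subset_right).trans_lt measure_Ico_lt_top).ne
  by_cases hgap : ∀ u ∈ T ∩ Ico (min x x') (max y y'), u ∈ Ico x y ∪ Ico x' y'
  · -- The hull of both intervals contains no further available time.
    have hdisj : Disjoint (confined I A T U x y)
        (confined I A (T \ Ico x y) (U \ confined I A T U x y) x' y') :=
      Finset.disjoint_left.2 fun j h1 h2 => (hmem j h2).2.1 h1
    have hsub : confined I A T U x y ∪
        confined I A (T \ Ico x y) (U \ confined I A T U x y) x' y' ⊆
        confined I A T U (min x x') (max y y') := by
      intro j hj
      rcases Finset.mem_union.1 hj with hj | hj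
      · obtain ⟨h1, h2⟩ := mem_confined.1 hj
        exact mem_confined.2 ⟨h1, h2.trans (Ico_subset_Ico (min_le_left _ _) (le_max_left _ _))⟩
      · obtain ⟨h1, -, h2, -⟩ := hmem j hj
        refine mem_confined.2 ⟨h1, fun t ht => ?_⟩
        by_cases hx : t ∈ Ico x y
        · exact Ico_subset_Ico (min_le_left _ _) (le_max_left _ _) hx
        · exact Ico_subset_Ico (min_le_right _ _) (le_max_right _ _) (h2 t ht.1.1 ht.1.2 ht.2 hx)
    have h1 := (Finset.sum_le_sum_of_subset_of_nonneg hsub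
      fun j _ _ => work_nonneg (I := I) (S := S) j A).trans (hmax _ _)
    rw [Finset.sum_union hdisj, hg] at h1
    have h2 : volume.real (T ∩ Ico (min x x') (max y y')) ≤
        volume.real (T ∩ Ico x y) + volume.real ((T \ Ico x y) ∩ Ico x' y') := by
      refine (measureReal_mono ?_ ?_).trans (measureReal_union_le _ _)
      · intro u hu
        by_cases hx : u ∈ Ico x y
        · exact Or.inl ⟨hu.1, hx⟩
        · exact Or.inr ⟨⟨hu.1, hx⟩, (hgap u hu).resolve_left hx⟩
      · exact (measure_union_lt_top (hfin _ _ _).lt_top (hfin _ _ _).lt_top).ne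
    nlinarith
  · -- Some available time separates the two intervals, and jobs cannot bridge it.
    push Not at hgap
    obtain ⟨u, ⟨huT, hu1, hu2⟩, hu3⟩ := hgap
    have hux : u ∉ Ico x y := fun h => hu3 (Or.inl h)
    have hux' : u ∉ Ico x' y' := fun h => hu3 (Or.inr h)
    rw [min_le_iff] at hu1
    rw [lt_max_iff] at hu2
    have hsep : ∀ t ∈ Ico x y, ∀ t' ∈ Ico x' y', (t' ≤ u ∧ u ≤ t) ∨ (t ≤ u ∧ u ≤ t') := by
      intro t ht t' ht'
      simp only [mem_Ico, not_and, not_lt] at ht ht' hux hux'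
      by_cases h : u < x
      · exact Or.inl ⟨ht'.2.le.trans (hux' (hu1.resolve_left (not_le.2 h))), by linarith⟩
      · have h1 := hux (not_lt.1 h)
        have h2 := hu2.resolve_left (not_lt.2 h1)
        have h3 : u < x' := by
          by_contra h3
          exact absurd h2 (not_lt.2 (hux' (not_lt.1 h3)))
        exact Or.inr ⟨by linarith, by linarith⟩
    have hsub : confined I A (T \ Ico x y) (U \ confined I A T U x y) x' y' ⊆
        confined I A T U x' y' := by
      intro j hj
      obtain ⟨h1, -, h2, t', ht'T, ht'w, -, ht'x⟩ := hmem j hj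
      refine mem_confined.2 ⟨h1, fun t ht => ?_⟩
      by_cases hx : t ∈ Ico x y
      · refine absurd (h2 u (hT huT) ?_ huT hux) hux'
        rcases hsep t hx t' ht'x with h | h
        · exact ordConnected_Ico.out ht'w ht.1.2 h
        · exact ordConnected_Ico.out ht.1.2 ht'w h
      · exact h2 t ht.1.1 ht.1.2 ht.2 hx
    refine (Finset.sum_le_sum_of_subset_of_nonneg hsub
      fun j _ _ => work_nonneg (I := I) (S := S) j A).trans ((hmax _ _).trans ?_)
    refine mul_le_mul_of_nonneg_left (measureReal_mono ?_ (hfin _ _ _)) hg0.le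
    intro t ht
    refine ⟨⟨ht.1, fun hx => ?_⟩, ht.2⟩
    rcases hsep t hx t ht.2 with h | h
    · exact hux (by rwa [le_antisymm h.2 h.1])
    · exact hux (by rwa [le_antisymm h.2 h.1])

theorem CriticalIntervals.avgSpeed_le {T : Set ℝ} {U : Finset (Fin n)}
    (h : CriticalIntervals I S A T U) : T ⊆ A → (∀ j ∈ U, 0 < work I S j A) → ∀ g,
    (∀ x y, ∑ j ∈ confined I A T U x y, work I S j A ≤ g * volume.real (T ∩ Ico x y)) →
    ∀ j ∈ U, avgSpeed I S j A ≤ g := by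
  induction h with
  | done => simp
  | step T U x y g₁ hne hg hmax hspeed hedf hrest ih =>
    intro hT hU g hmax' j hj
    have hv := (intensity_pos hU hne hg).2
    have hle : g₁ ≤ g := le_of_mul_le_mul_right (hg ▸ hmax' x y) hv
    by_cases hjc : j ∈ confined I A T U x y
    · exact (hspeed j hjc).trans_le hle
    · exact (ih (sdiff_subset.trans hT) (fun j hj => hU j (Finset.mem_sdiff.1 hj).1) g₁
        (intensity_le_of_removed hT hU hne hg hmax) j (Finset.mem_sdiff.2 ⟨hj, hjc⟩)).trans hle

/-- At every time the critical interval procedure runs a job of maximum speed among the active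
jobs. -/
theorem CriticalIntervals.max_speed {T : Set ℝ} {U : Finset (Fin n)}
    (h : CriticalIntervals I S A T U) : T ⊆ A → (∀ j ∈ U, 0 < work I S j A) → ∀ t ∈ T,
    (∀ j, S.job t = some j → j ∈ U) ∧ ∀ j ∈ U, t ∈ Ico (I.r j) (I.d j) →
      ∃ j', S.job t = some j' ∧ avgSpeed I S j A ≤ avgSpeed I S j' A := by
  have h0 := @CriticalIntervals.avgSpeed_le n k I S A
  induction h with
  | done T h =>
    intro _ _ t ht
    simp [h t ht]
  | step T U x y g hne hg hmax hspeed hedf hrest ih =>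
    intro hT hU t ht
    by_cases hx : t ∈ Ico x y
    · obtain ⟨j, hj, hjt, -⟩ := hedf t ⟨ht, hx⟩
      refine ⟨fun j' hj' => ?_, fun j' hj' _ => ⟨j, hjt, ?_⟩⟩
      · rw [hjt] at hj'
        rw [← Option.some_injective _ hj']
        exact (mem_confined.1 hj).1
      · rw [hspeed j hj]
        exact h0 (CriticalIntervals.step T U x y g hne hg hmax hspeed hedf hrest) hT hU g hmax j' hj'
    · obtain ⟨h1, h2⟩ := ih (sdiff_subset.trans hT) (fun j hj => hU j (Finset.mem_sdiff.1 hj).1)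
        t ⟨ht, hx⟩
      refine ⟨fun j hj => (Finset.mem_sdiff.1 (h1 j hj)).1, fun j hj hw => ?_⟩
      refine h2 j (Finset.mem_sdiff.2 ⟨hj, fun hc => hx ?_⟩) hw
      exact (mem_confined.1 hc).2 ⟨⟨hT ht, hw⟩, ht⟩

/-! ### Greedy schedules and speed levels -/

/-- The properties of a YDS schedule on a time set `A` that the argument uses: `S` always runs a
job of maximum average speed among the active jobs that are processed in `A` at all, and the
job in execution is locally constant to the right. -/
structure Greedy (I : Instance n k) (S : Schedule n k) (A : Set ℝ) : Prop where
  measurable : MeasurableSet A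
  windows : RespectsWindows I S
  work_pos : ∀ t ∈ A, ∀ j, S.job t = some j → 0 < work I S j A
  max_speed : ∀ t ∈ A, ∀ j, t ∈ Ico (I.r j) (I.d j) → 0 < work I S j A →
    ∃ j', S.job t = some j' ∧ avgSpeed I S j A ≤ avgSpeed I S j' A
  right_const : ∀ t ∈ A, ∀ᶠ u in 𝓝[>] t, u ∈ A ∧ S.job u = S.job t

/-- The times of `A` at which some job with the property `p` is active. -/
def region (I : Instance n k) (A : Set ℝ) (p : Fin n → Prop) : Set ℝ :=
  {t | t ∈ A ∧ ∃ j, p j ∧ t ∈ Ico (I.r j) (I.d j)}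

/-- The Speed Level Relation within one time set `A`, where `lev j` is the level of job `j`. -/
structure Levels (I : Instance n k) (S : Schedule n k) (A : Set ℝ) (lev : Fin n → ℕ) :
    Prop where
  lower : ∀ j, 0 < work I S j A → ∀ i : Fin (k + 1), (i : ℕ) < lev j → I.s i ≤ avgSpeed I S j A
  upper : ∀ j, 0 < work I S j A → ∀ i : Fin (k + 1), lev j ≤ i → avgSpeed I S j A ≤ I.s i
  le : ∀ j, 0 < work I S j A → lev j ≤ k + 1
  maximal : ∀ t ∈ A, ∀ j j', S.job t = some j → t ∈ Ico (I.r j') (I.d j') → lev j' ≤ lev j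

/-- Conditions on the workloads `w` alone under which every YDS schedule of `w` in `A` satisfies
the Speed Level Relation with the levels `lev`. The set `V` contains the jobs that are (or were,
just before) processed in `A`. For fixed `V` the conditions `upper` and `lower` are linear in `w`:
the jobs of level at most `i` fit at speed `s i` into the time that jobs of higher level leave
them, and the jobs of level above `i` fill their time at speed at least `s i`. -/
structure LevelCert (I : Instance n k) (A : Set ℝ) (lev : Fin n → ℕ) (V : Set (Fin n))
    (w : Fin n → ℝ) : Prop where
  supp : ∀ j, 0 < w j → j ∈ V
  cover : ∀ t ∈ A, ∀ j ∈ V, t ∈ Ico (I.r j) (I.d j) → ∀ j', t ∈ Ico (I.r j') (I.d j') →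
    ∃ i ∈ V, t ∈ Ico (I.r i) (I.d i) ∧ lev j' ≤ lev i
  le : ∀ j ∈ V, lev j ≤ k + 1
  upper : ∀ i : Fin (k + 1), ∀ X : Finset (Fin n), (∀ j ∈ X, lev j ≤ i) →
    ∑ j ∈ X, w j ≤ I.s i * volume.real (region I A (· ∈ X) \ region I A fun j => i < lev j)
  lower : ∀ i : Fin (k + 1), ∀ Z : Finset (Fin n),
    I.s i * volume.real (region I A (fun j => j ∈ V ∧ i < lev j) \ region I A (· ∈ Z)) ≤
      ∑ j with j ∉ Z ∧ i < lev j, w j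

theorem eventually_window_iff (I : Instance n k) (t : ℝ) :
    ∀ᶠ u in 𝓝[>] t, ∀ j, u ∈ Ico (I.r j) (I.d j) ↔ t ∈ Ico (I.r j) (I.d j) := by
  refine eventually_all.2 fun j => ?_
  have hgt : ∀ᶠ u in 𝓝[>] t, t < u := self_mem_nhdsWithin
  rcases lt_or_ge t (I.r j) with h | h
  · filter_upwards [hgt, mem_nhdsWithin_of_mem_nhds (Iio_mem_nhds h)] with u _ h2
    simp only [mem_Ico, mem_Iio] at *
    exact ⟨fun h3 => absurd h2 (not_lt.2 h3.1), fun h3 => absurd h (not_lt.2 h3.1)⟩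
  rcases lt_or_ge t (I.d j) with h' | h'
  · filter_upwards [hgt, mem_nhdsWithin_of_mem_nhds (Iio_mem_nhds h')] with u h1 h2
    simp only [mem_Ico, mem_Iio] at *
    exact ⟨fun _ => ⟨h, h'⟩, fun _ => ⟨h.trans h1.le, h2⟩⟩
  · filter_upwards [hgt] with u h1
    simp only [mem_Ico]
    exact ⟨fun h3 => absurd h3.2 (not_lt.2 (h'.trans h1.le)), fun h3 => absurd h3.2 (not_lt.2 h')⟩

theorem measureReal_pos_of_mem_nhdsGT {B : Set ℝ} {t : ℝ} (h : B ∈ 𝓝[>] t) (hB : volume B ≠ ⊤) :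
    0 < volume.real B := by
  obtain ⟨u, hu, hsub⟩ := (mem_nhdsGT_iff_exists_Ioo_subset).1 h
  have h1 : 0 < volume.real (Ioo t u) := by
    rw [Real.volume_real_Ioo_of_le (le_of_lt hu)]; exact sub_pos.2 hu
  exact h1.trans_le (measureReal_mono hsub hB)

theorem mem_region {p : Fin n → Prop} {t : ℝ} :
    t ∈ region I A p ↔ t ∈ A ∧ ∃ j, p j ∧ t ∈ Ico (I.r j) (I.d j) := Iff.rfl

theorem region_mono {p q : Fin n → Prop} (h : ∀ j, p j → q j) : region I A p ⊆ region I A q :=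
  fun _ ⟨h1, j, h2, h3⟩ => ⟨h1, j, h j h2, h3⟩

theorem measurableSet_region (hA : MeasurableSet A) (p : Fin n → Prop) :
    MeasurableSet (region I A p) := by
  have : region I A p = A ∩ ⋃ j, ⋃ _ : p j, Ico (I.r j) (I.d j) := by
    ext t
    simp only [mem_region, mem_inter_iff, mem_iUnion, exists_prop]
  rw [this]
  exact hA.inter (MeasurableSet.iUnion fun j => MeasurableSet.iUnion fun _ => measurableSet_Ico)

theorem volume_region_lt_top (I : Instance n k) (A : Set ℝ) (p : Fin n → Prop) :
    volume (region I A p) < ⊤ := by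
  have : region I A p ⊆ ⋃ j, Ico (I.r j) (I.d j) := fun t ⟨_, j, _, h⟩ => mem_iUnion.2 ⟨j, h⟩
  refine (measure_mono this).trans_lt ((measure_iUnion_le _).trans_lt ?_)
  rw [tsum_fintype]
  exact ENNReal.sum_lt_top.2 fun j _ => measure_Ico_lt_top

theorem volume_region_sdiff_ne_top (I : Instance n k) (A B : Set ℝ) (p : Fin n → Prop) :
    volume (region I A p \ B) ≠ ⊤ :=
  ((measure_mono sdiff_subset).trans_lt (volume_region_lt_top I A p)).ne

open Classical in
/-- The jobs of positive work that run faster than `s i`. -/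
noncomputable def fasterThan (I : Instance n k) (S : Schedule n k) (A : Set ℝ)
    (i : Fin (k + 1)) : Finset (Fin n) :=
  {j | 0 < work I S j A ∧ I.s i < avgSpeed I S j A}

theorem mem_fasterThan {i : Fin (k + 1)} {j : Fin n} :
    j ∈ fasterThan I S A i ↔ 0 < work I S j A ∧ I.s i < avgSpeed I S j A := by
  simp [fasterThan]

namespace Greedy

theorem dur_eq_zero (h : Greedy I S A) {j : Fin n} (hj : ¬ 0 < work I S j A) : dur S j A = 0 := by
  have : A ∩ {t | S.job t = some j} = ∅ :=
    eq_empty_of_forall_notMem fun t ht => hj (h.work_pos t ht.1 j ht.2)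
  rw [dur, this, measureReal_empty]

theorem volume_le_sum_dur (h : Greedy I S A) {B : Set ℝ} (X : Finset (Fin n))
    (hB : ∀ t ∈ B, t ∈ A ∧ ∃ j ∈ X, S.job t = some j) : volume.real B ≤ ∑ j ∈ X, dur S j A := by
  rw [h.windows.sum_dur h.measurable]
  refine measureReal_mono (fun t ht => ?_) (h.windows.volume_biUnion_ne_top A X)
  obtain ⟨h1, j, h2, h3⟩ := hB t ht
  exact mem_biUnion h2 ⟨h1, h3⟩

theorem sum_dur_le_volume (h : Greedy I S A) {B : Set ℝ} (X : Finset (Fin n)) (hfin : volume B ≠ ⊤)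
    (hB : ∀ t ∈ A, ∀ j ∈ X, S.job t = some j → t ∈ B) : ∑ j ∈ X, dur S j A ≤ volume.real B := by
  rw [h.windows.sum_dur h.measurable]
  refine measureReal_mono (fun t ht => ?_) hfin
  obtain ⟨j, h1, h2⟩ := mem_iUnion₂.1 ht
  exact hB t h2.1 j h1 h2.2

/-- The Speed Level Relation yields the linear conditions on the workloads. -/
theorem levelCert (h : Greedy I S A) {lev : Fin n → ℕ} (hl : Levels I S A lev) :
    LevelCert I A lev {j | 0 < work I S j A} (fun j => work I S j A) where
  supp _ hj := hj
  le := hl.le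
  cover t ht j hj hw j' hw' := by
    obtain ⟨i, hi, -⟩ := h.max_speed t ht j hw hj
    exact ⟨i, h.work_pos t ht i hi, h.windows t i hi, hl.maximal t ht i j' hi hw'⟩
  upper i X hX := by
    have h1 : ∑ j ∈ X, work I S j A ≤ I.s i * ∑ j ∈ X, dur S j A := by
      rw [Finset.mul_sum]
      refine Finset.sum_le_sum fun j hj => ?_
      by_cases hw : 0 < work I S j A
      · rw [h.windows.work_eq]
        exact mul_le_mul_of_nonneg_right (hl.upper j hw i (hX j hj)) (dur_nonneg j A)
      · rw [work_eq_zero hw]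
        exact mul_nonneg (I.s_nonneg i) (dur_nonneg j A)
    refine h1.trans (mul_le_mul_of_nonneg_left ?_ (I.s_nonneg i))
    refine h.sum_dur_le_volume X (volume_region_sdiff_ne_top _ _ _ _) fun t ht j hj hjt => ?_
    refine ⟨⟨ht, j, hj, h.windows t j hjt⟩, ?_⟩
    rintro ⟨-, j', hj', hw⟩
    have := hl.maximal t ht j j' hjt hw
    have := hX j hj
    omega
  lower i Z := by
    have h1 : I.s i * ∑ j with j ∉ Z ∧ i < lev j, dur S j A ≤
        ∑ j with j ∉ Z ∧ i < lev j, work I S j A := by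
      rw [Finset.mul_sum]
      refine Finset.sum_le_sum fun j hj => ?_
      have hj' := (Finset.mem_filter.1 hj).2.2
      by_cases hw : 0 < work I S j A
      · rw [h.windows.work_eq]
        exact mul_le_mul_of_nonneg_right (hl.lower j hw i hj') (dur_nonneg j A)
      · rw [h.dur_eq_zero hw, mul_zero]
        exact work_nonneg j A
    refine (mul_le_mul_of_nonneg_left ?_ (I.s_nonneg i)).trans h1
    refine h.volume_le_sum_dur _ ?_
    rintro t ⟨⟨ht, j, ⟨hj, hji⟩, hw⟩, hZ⟩
    obtain ⟨i', hi', -⟩ := h.max_speed t ht j hw hj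
    have := hl.maximal t ht i' j hi' hw
    refine ⟨ht, i', Finset.mem_filter.2 ⟨Finset.mem_univ _, fun hz => ?_, by omega⟩, hi'⟩
    exact hZ ⟨ht, i', hz, h.windows t i' hi'⟩

section

variable {lev : Fin n → ℕ} {V : Set (Fin n)}

/-- While a job is run, no faster job is active. -/
theorem not_mem_region (h : Greedy I S A) {t : ℝ} (ht : t ∈ A) {j : Fin n}
    (hj : S.job t = some j) {Z : Finset (Fin n)}
    (hZ : ∀ z ∈ Z, 0 < work I S z A ∧ avgSpeed I S j A < avgSpeed I S z A) :
    t ∉ region I A (· ∈ Z) := by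
  rintro ⟨-, z, hz, hw⟩
  obtain ⟨j', hj', hle⟩ := h.max_speed t ht z hw (hZ z hz).1
  rw [hj] at hj'
  obtain rfl := Option.some_injective _ hj'
  exact absurd (hZ z hz).2 (not_lt.2 hle)

/-- Otherwise the jobs of level at most `i` that are faster than `s i` would have more work than
fits at speed `s i` into the time that higher levels leave them. -/
theorem avgSpeed_le_of_cert (h : Greedy I S A)
    (hc : LevelCert I A lev V fun j => work I S j A) {j : Fin n} (hj : 0 < work I S j A)
    {i : Fin (k + 1)} (hi : lev j ≤ i) : avgSpeed I S j A ≤ I.s i := by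
  classical
  by_contra! hlt
  set X : Finset (Fin n) := {j | 0 < work I S j A ∧ I.s i < avgSpeed I S j A ∧ lev j ≤ i} with hX
  have hmem : ∀ {j}, j ∈ X ↔ 0 < work I S j A ∧ I.s i < avgSpeed I S j A ∧ lev j ≤ i := by
    simp [hX]
  have h1 := hc.upper i X fun j hj => (hmem.1 hj).2.2
  have h2 : volume.real (region I A (· ∈ X) \ region I A fun j => i < lev j) ≤
      ∑ j ∈ X, dur S j A := by
    refine h.volume_le_sum_dur X ?_
    rintro t ⟨⟨ht, j, hj, hw⟩, hn⟩
    obtain ⟨j', hj', hle⟩ := h.max_speed t ht j hw (hmem.1 hj).1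
    refine ⟨ht, j', hmem.2 ⟨h.work_pos t ht j' hj', (hmem.1 hj).2.1.trans_le hle, ?_⟩, hj'⟩
    by_contra! hlev
    exact hn ⟨ht, j', hlev, h.windows t j' hj'⟩
  have h3 : I.s i * ∑ j ∈ X, dur S j A < ∑ j ∈ X, work I S j A := by
    rw [Finset.mul_sum]
    refine Finset.sum_lt_sum_of_nonempty ⟨j, hmem.2 ⟨hj, hlt, hi⟩⟩ fun j hj => ?_
    rw [h.windows.work_eq]
    exact mul_lt_mul_of_pos_right (hmem.1 hj).2.1 (h.windows.dur_pos (hmem.1 hj).1)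
  have h4 := mul_le_mul_of_nonneg_left h2 (I.s_nonneg i)
  linarith

/-- Otherwise the jobs of level above `i` that are slower than `s i` could not do the work that
`LevelCert.lower` requires in the time without faster jobs. -/
theorem le_avgSpeed_of_cert (h : Greedy I S A)
    (hc : LevelCert I A lev V fun j => work I S j A) {j : Fin n} (hj : 0 < work I S j A)
    {i : Fin (k + 1)} (hi : i < lev j) : I.s i ≤ avgSpeed I S j A := by
  classical
  by_contra! hlt
  set Z : Finset (Fin n) := {j | 0 < work I S j A ∧ I.s i ≤ avgSpeed I S j A} with hZ
  set Y : Finset (Fin n) := {j | 0 < work I S j A ∧ avgSpeed I S j A < I.s i ∧ i < lev j} with hY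
  have hmZ : ∀ {j}, j ∈ Z ↔ 0 < work I S j A ∧ I.s i ≤ avgSpeed I S j A := by simp [hZ]
  have hmY : ∀ {j}, j ∈ Y ↔ 0 < work I S j A ∧ avgSpeed I S j A < I.s i ∧ i < lev j := by
    simp [hY]
  have h1 := hc.lower i Z
  have h2 : ∑ j with j ∉ Z ∧ i < lev j, work I S j A = ∑ j ∈ Y, work I S j A := by
    refine (Finset.sum_subset (fun j hj => ?_) fun j hj hjY => ?_).symm
    · obtain ⟨_, h2, h3⟩ := hmY.1 hj
      exact Finset.mem_filter.2 ⟨Finset.mem_univ _, fun hz => absurd h2 (not_lt.2 (hmZ.1 hz).2), h3⟩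
    · obtain ⟨hz, hl⟩ := (Finset.mem_filter.1 hj).2
      refine work_eq_zero fun hw => hjY (hmY.2 ⟨hw, ?_, hl⟩)
      by_contra! hs
      exact hz (hmZ.2 ⟨hw, hs⟩)
  have h3 : ∑ j ∈ Y, dur S j A ≤
      volume.real (region I A (fun j => j ∈ V ∧ i < lev j) \ region I A (· ∈ Z)) := by
    refine h.sum_dur_le_volume Y (volume_region_sdiff_ne_top _ _ _ _) fun t ht j hj hjt => ?_
    obtain ⟨hw, hs, hl⟩ := hmY.1 hj
    refine ⟨⟨ht, j, ⟨hc.supp j hw, hl⟩, h.windows t j hjt⟩, ?_⟩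
    exact h.not_mem_region ht hjt fun z hz => ⟨(hmZ.1 hz).1, hs.trans_le (hmZ.1 hz).2⟩
  have h4 : ∑ j ∈ Y, work I S j A < I.s i * ∑ j ∈ Y, dur S j A := by
    rw [Finset.mul_sum]
    refine Finset.sum_lt_sum_of_nonempty ⟨j, hmY.2 ⟨hj, hlt, hi⟩⟩ fun j hj => ?_
    rw [h.windows.work_eq]
    exact mul_lt_mul_of_pos_right (hmY.1 hj).2.1 (h.windows.dur_pos (hmY.1 hj).1)
  have h5 := mul_le_mul_of_nonneg_left h3 (I.s_nonneg i)
  linarith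

/-- The jobs of level above `i` that are not faster than `s i` run at speed exactly `s i`. -/
theorem sum_work_eq_of_bounds (h : Greedy I S A) {i : Fin (k + 1)}
    (hlo : ∀ j, 0 < work I S j A → i < lev j → I.s i ≤ avgSpeed I S j A) :
    ∑ j with j ∉ fasterThan I S A i ∧ i < lev j, work I S j A =
      I.s i * ∑ j with j ∉ fasterThan I S A i ∧ i < lev j, dur S j A := by
  rw [Finset.mul_sum]
  refine Finset.sum_congr rfl fun j hj => ?_
  obtain ⟨h1, h2⟩ := (Finset.mem_filter.1 hj).2
  by_cases hw : 0 < work I S j A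
  · rw [h.windows.work_eq]
    congr 1
    refine le_antisymm (not_lt.1 fun h3 => h1 (mem_fasterThan.2 ⟨hw, h3⟩)) (hlo j hw h2)
  · rw [work_eq_zero hw, h.dur_eq_zero hw, mul_zero]

theorem sum_dur_le_volume_region (h : Greedy I S A)
    (hsupp : ∀ j, 0 < work I S j A → j ∈ V) (i : Fin (k + 1)) :
    ∑ j with j ∉ fasterThan I S A i ∧ i < lev j, dur S j A ≤
      volume.real (region I A (fun j => j ∈ V ∧ i < lev j) \
        region I A (· ∈ fasterThan I S A i)) := by
  refine h.sum_dur_le_volume _ (volume_region_sdiff_ne_top _ _ _ _) fun t ht j hj hjt => ?_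
  obtain ⟨h1, h2⟩ := (Finset.mem_filter.1 hj).2
  have hw := h.work_pos t ht j hjt
  refine ⟨⟨ht, j, ⟨hsupp j hw, h2⟩, h.windows t j hjt⟩, ?_⟩
  refine h.not_mem_region ht hjt fun z hz => ⟨(mem_fasterThan.1 hz).1, ?_⟩
  exact (not_lt.1 fun h3 => h1 (mem_fasterThan.2 ⟨hw, h3⟩)).trans_lt (mem_fasterThan.1 hz).2

/-- If the jobs of level above `i` with speed `s i` have enough work to fill their time, then no
job of lower level can be run in it; here lies the only difficulty in the fourth clause of the Speed
Level Relation, since speeds alone do not separate consecutive levels. -/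
theorem maximal_of_lower (h : Greedy I S A)
    (hsupp : ∀ j, 0 < work I S j A → j ∈ V)
    (hcover : ∀ t ∈ A, ∀ j ∈ V, t ∈ Ico (I.r j) (I.d j) → ∀ j', t ∈ Ico (I.r j') (I.d j') →
      ∃ i ∈ V, t ∈ Ico (I.r i) (I.d i) ∧ lev j' ≤ lev i)
    (hle : ∀ j ∈ V, lev j ≤ k + 1)
    (hlo : ∀ j, 0 < work I S j A → ∀ i : Fin (k + 1), i < lev j → I.s i ≤ avgSpeed I S j A)
    (hhi : ∀ j, 0 < work I S j A → ∀ i : Fin (k + 1), lev j ≤ i → avgSpeed I S j A ≤ I.s i)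
    (hlow : ∀ i : Fin (k + 1), I.s i * volume.real (region I A (fun j => j ∈ V ∧ i < lev j) \
        region I A (· ∈ fasterThan I S A i)) ≤
      ∑ j with j ∉ fasterThan I S A i ∧ i < lev j, work I S j A)
    {t : ℝ} (ht : t ∈ A) {j j' : Fin n} (hjt : S.job t = some j)
    (hw' : t ∈ Ico (I.r j') (I.d j')) : lev j' ≤ lev j := by
  by_contra! hlt
  have hw := h.work_pos t ht j hjt
  obtain ⟨z, hzV, hz, hzl⟩ := hcover t ht j (hsupp j hw) (h.windows t j hjt) j' hw'
  have hjk : lev j < k + 1 := by have := hle z hzV; omega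
  obtain ⟨i, hi⟩ : ∃ i : Fin (k + 1), (i : ℕ) = lev j := ⟨⟨lev j, hjk⟩, rfl⟩
  have hji := hhi j hw i hi.ge
  have hpos : 0 < I.s i := (h.windows.avgSpeed_pos hw).trans_le hji
  have h1 := hlow i
  rw [h.sum_work_eq_of_bounds fun j hw => hlo j hw i, h.windows.sum_dur h.measurable] at h1
  have h2 := le_of_mul_le_mul_left h1 hpos
  set X : Finset (Fin n) := {j | j ∉ fasterThan I S A i ∧ i < lev j} with hX
  set B := region I A (fun j => j ∈ V ∧ i < lev j) \ region I A (· ∈ fasterThan I S A i) with hB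
  set C := ⋃ j ∈ X, A ∩ {t | S.job t = some j} with hC
  have hBfin : volume B ≠ ⊤ := volume_region_sdiff_ne_top _ _ _ _
  have hCB : C ⊆ B := by
    intro u hu
    obtain ⟨i', h3, h4, h5⟩ := mem_iUnion₂.1 hu
    obtain ⟨h6, h7⟩ := (Finset.mem_filter.1 h3).2
    have hwi := h.work_pos u h4 i' h5
    refine ⟨⟨h4, i', ⟨hsupp i' hwi, h7⟩, h.windows u i' h5⟩, ?_⟩
    refine h.not_mem_region h4 h5 fun z hz => ⟨(mem_fasterThan.1 hz).1, ?_⟩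
    exact (not_lt.1 fun h3 => h6 (mem_fasterThan.2 ⟨hwi, h3⟩)).trans_lt (mem_fasterThan.1 hz).2
  have hmemB : B \ C ∈ 𝓝[>] t := by
    filter_upwards [h.right_const t ht, eventually_window_iff I t] with u hu1 hu2
    have hn : u ∉ region I A (· ∈ fasterThan I S A i) :=
      h.not_mem_region hu1.1 (hu1.2.trans hjt) fun z hz =>
        ⟨(mem_fasterThan.1 hz).1, hji.trans_lt (mem_fasterThan.1 hz).2⟩
    refine ⟨⟨⟨hu1.1, z, ⟨hzV, by omega⟩, (hu2 z).2 hz⟩, hn⟩, fun hu => ?_⟩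
    obtain ⟨i', h3, -, h5⟩ := mem_iUnion₂.1 hu
    have h6 : some j = some i' := (hu1.2.trans hjt).symm.trans h5
    obtain rfl := Option.some_injective _ h6
    have := (Finset.mem_filter.1 h3).2.2
    omega
  have hpos' := measureReal_pos_of_mem_nhdsGT hmemB
    ((measure_mono sdiff_subset).trans_lt hBfin.lt_top).ne
  have hCm : MeasurableSet C := Finset.measurableSet_biUnion _ fun j _ =>
    measurableSet_inter_job h.measurable j
  rw [measureReal_sdiff hCB hCm hBfin] at hpos'
  linarith

/-- The linear conditions on the workloads yield the Speed Level Relation, for every YDS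
schedule. -/
theorem levels_of_cert (h : Greedy I S A) (hc : LevelCert I A lev V fun j => work I S j A) :
    Levels I S A lev where
  lower _ hj _ hi := h.le_avgSpeed_of_cert hc hj hi
  upper _ hj _ hi := h.avgSpeed_le_of_cert hc hj hi
  le j hj := hc.le j (hc.supp j hj)
  maximal _ ht _ _ hj hw := h.maximal_of_lower hc.supp hc.cover hc.le
    (fun _ hj _ hi => h.le_avgSpeed_of_cert hc hj hi)
    (fun _ hj _ hi => h.avgSpeed_le_of_cert hc hj hi) (fun i => hc.lower i _) ht hj hw

/-- With fixed levels, the part of the speed profile above `s i` depends affinely on the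
workloads. -/
theorem sum_hinge_of_cert (h : Greedy I S A) (hc : LevelCert I A lev V fun j => work I S j A)
    (i : Fin (k + 1)) : ∑ j, max (avgSpeed I S j A - I.s i) 0 * dur S j A =
      ∑ j with i < lev j, work I S j A -
        I.s i * volume.real (region I A fun j => j ∈ V ∧ i < lev j) := by
  classical
  have hl := h.levels_of_cert hc
  have h1 : ∑ j, max (avgSpeed I S j A - I.s i) 0 * dur S j A =
      ∑ j with i < lev j, (work I S j A - I.s i * dur S j A) := by
    rw [Finset.sum_filter]
    refine Finset.sum_congr rfl fun j _ => ?_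
    by_cases hw : 0 < work I S j A
    · split_ifs with hi
      · rw [max_eq_left (sub_nonneg.2 (hl.lower j hw i hi)), h.windows.work_eq, sub_mul]
      · rw [max_eq_right (sub_nonpos.2 (hl.upper j hw i (not_lt.1 hi))), zero_mul]
    · rw [work_eq_zero hw, h.dur_eq_zero hw]
      simp
  rw [h1, Finset.sum_sub_distrib, ← Finset.mul_sum]
  congr 1
  refine le_antisymm (mul_le_mul_of_nonneg_left ?_ (I.s_nonneg i)) ?_
  · refine h.sum_dur_le_volume _ (volume_region_lt_top _ _ _).ne fun t ht j hj hjt => ?_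
    exact ⟨ht, j, ⟨hc.supp j (h.work_pos t ht j hjt), (Finset.mem_filter.1 hj).2⟩,
      h.windows t j hjt⟩
  · set Z : Finset (Fin n) := {j | 0 < work I S j A ∧ i < lev j} with hZ
    have hmZ : ∀ {j}, j ∈ Z ↔ 0 < work I S j A ∧ i < lev j := by simp [hZ]
    have h2 := hc.lower i Z
    rw [Finset.sum_eq_zero fun j hj => work_eq_zero fun hw =>
      (Finset.mem_filter.1 hj).2.1 (hmZ.2 ⟨hw, (Finset.mem_filter.1 hj).2.2⟩)] at h2
    have h3 : volume.real (region I A (· ∈ Z)) ≤ ∑ j with i < lev j, dur S j A := by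
      refine h.volume_le_sum_dur _ ?_
      rintro t ⟨ht, j, hj, hw⟩
      obtain ⟨j', hj', -⟩ := h.max_speed t ht j hw (hmZ.1 hj).1
      have h4 := hl.maximal t ht j' j hj' hw
      have h5 := (hmZ.1 hj).2
      exact ⟨ht, j', Finset.mem_filter.2 ⟨Finset.mem_univ _, by omega⟩, hj'⟩
    have h4 : volume.real (region I A fun j => j ∈ V ∧ i < lev j) ≤
        volume.real (region I A (fun j => j ∈ V ∧ i < lev j) \ region I A (· ∈ Z)) +
          volume.real (region I A (· ∈ Z)) := by
      refine (measureReal_mono ?_ ?_).trans (measureReal_union_le _ _)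
      · intro t ht
        by_cases hz : t ∈ region I A (· ∈ Z)
        exacts [Or.inr hz, Or.inl ⟨ht, hz⟩]
      · exact (measure_union_lt_top (volume_region_sdiff_ne_top _ _ _ _).lt_top
          (volume_region_lt_top _ _ _)).ne
    have h5 := mul_le_mul_of_nonneg_left h3 (I.s_nonneg i)
    have h6 := mul_le_mul_of_nonneg_left h4 (I.s_nonneg i)
    rw [mul_add] at h6
    linarith

end

end Greedy

/-! ### Depletion intervals -/

theorem exists_consecutive (E : Finset ℝ) (t : ℝ) (h1 : ∃ x ∈ E, x ≤ t) (h2 : ∃ y ∈ E, t < y) :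
    ∃ x ∈ E, ∃ y ∈ E, x ≤ t ∧ t < y ∧ ∀ z ∈ E, z ≤ x ∨ y ≤ z := by
  obtain ⟨x, hx, hxm⟩ := (E.filter (· ≤ t)).exists_max_image id
    (by obtain ⟨x, hx, h⟩ := h1; exact ⟨x, Finset.mem_filter.2 ⟨hx, h⟩⟩)
  obtain ⟨y, hy, hym⟩ := (E.filter (t < ·)).exists_min_image id
    (by obtain ⟨x, hx, h⟩ := h2; exact ⟨x, Finset.mem_filter.2 ⟨hx, h⟩⟩)
  rw [Finset.mem_filter] at hx hy
  refine ⟨x, hx.1, y, hy.1, hx.2, hy.2, fun z hz => ?_⟩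
  rcases le_or_gt z t with h | h
  · exact Or.inl (hxm z (Finset.mem_filter.2 ⟨hz, h⟩))
  · exact Or.inr (hym z (Finset.mem_filter.2 ⟨hz, h⟩))

/-- A transitive relation that holds between consecutive members of a finite set holds between any
two of its members. -/
theorem rel_of_consecutive (E : Finset ℝ) (Q : ℝ → ℝ → Prop) (hrefl : ∀ x ∈ E, Q x x)
    (htrans : ∀ x ∈ E, ∀ y ∈ E, ∀ z ∈ E, x ≤ y → y ≤ z → Q x y → Q y z → Q x z)
    (hstep : ∀ x ∈ E, ∀ y ∈ E, x < y → (∀ z ∈ E, z ≤ x ∨ y ≤ z) → Q x y) :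
    ∀ x ∈ E, ∀ y ∈ E, x ≤ y → Q x y := by
  intro x hx y hy hxy
  induction hm : (E.filter fun z => x ≤ z ∧ z < y).card using Nat.strong_induction_on
    generalizing x with
  | _ m ih =>
    rcases hxy.eq_or_lt with rfl | hlt
    · exact hrefl x hx
    obtain ⟨x', hx', z, hz, h1, h2, h3⟩ := exists_consecutive E x ⟨x, hx, le_rfl⟩ ⟨y, hy, hlt⟩
    obtain rfl : x' = x := le_antisymm h1 ((h3 x hx).resolve_right (not_le.2 h2))
    have hzy : z ≤ y := (h3 y hy).resolve_left (not_le.2 hlt)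
    refine htrans x' hx' z hz y hy h2.le hzy (hstep x' hx' z hz h2 h3) (ih _ ?_ z hz hzy rfl)
    rw [← hm]
    refine Finset.card_lt_card ((Finset.ssubset_iff_of_subset fun w hw => ?_).2 ⟨x', ?_, ?_⟩)
    · simp only [Finset.mem_filter] at hw ⊢
      exact ⟨hw.1, h2.le.trans hw.2.1, hw.2.2⟩
    · exact Finset.mem_filter.2 ⟨hx', le_rfl, hlt⟩
    · simp [h2]

theorem nonneg_of_mem_starts (hD : ∀ e ∈ D, 0 < e) {a : ℝ} (ha : a ∈ starts D) : 0 ≤ a := by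
  rcases Finset.mem_insert.1 ha with rfl | h
  exacts [le_rfl, (hD a h).le]

theorem zero_mem_starts (D : Finset ℝ) : (0 : ℝ) ∈ starts D := Finset.mem_insert_self _ _

theorem mem_starts_of_mem {e : ℝ} (he : e ∈ D) : e ∈ starts D := Finset.mem_insert_of_mem he

theorem mem_of_mem_starts {a : ℝ} (ha : a ∈ starts D) (h : 0 < a) : a ∈ D :=
  (Finset.mem_insert.1 ha).resolve_left h.ne'

theorem self_mem_interval (D : Finset ℝ) (a : ℝ) : a ∈ interval D a := ⟨le_rfl, fun _ _ h => h⟩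

theorem exists_mem_interval {t : ℝ} (ht : 0 ≤ t) :
    ∃ a ∈ starts D, t ∈ interval D a := by
  obtain ⟨a, ha, ham⟩ := ((starts D).filter (· ≤ t)).exists_max_image id
    ⟨0, Finset.mem_filter.2 ⟨zero_mem_starts D, ht⟩⟩
  rw [Finset.mem_filter] at ha
  refine ⟨a, ha.1, ha.2, fun e he hae => ?_⟩
  by_contra! h
  exact absurd (ham e (Finset.mem_filter.2 ⟨mem_starts_of_mem he, h⟩)) (not_le.2 hae)

theorem eq_of_mem_interval (hD : ∀ e ∈ D, 0 < e) {a b t : ℝ} (ha : a ∈ starts D)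
    (hb : b ∈ starts D) (h1 : t ∈ interval D a) (h2 : t ∈ interval D b) : a = b := by
  have key : ∀ {a b : ℝ}, a ∈ starts D → b ∈ starts D → t ∈ interval D a → t ∈ interval D b →
      ¬ a < b := fun {a b} ha hb h1 h2 hab =>
    absurd (h1.2 b (mem_of_mem_starts hb ((nonneg_of_mem_starts hD ha).trans_lt hab)) hab)
      (not_lt.2 h2.1)
  exact le_antisymm (not_lt.1 (key hb ha h2 h1)) (not_lt.1 (key ha hb h1 h2))

theorem measurableSet_interval (D : Finset ℝ) (a : ℝ) : MeasurableSet (interval D a) := by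
  have : interval D a = Ici a ∩ ⋂ e ∈ D, ⋂ _ : a < e, Iio e := by
    ext t
    simp only [interval, mem_inter_iff, mem_iInter, mem_Ici, mem_Iio]
    rfl
  rw [this]
  exact measurableSet_Ici.inter (Finset.measurableSet_biInter _ fun e _ =>
    MeasurableSet.iInter fun _ => measurableSet_Iio)

theorem mem_interval_of_le {a t u v : ℝ} (hu : u ∈ interval D a) (hv : v ∈ interval D a)
    (h1 : u ≤ t) (h2 : t ≤ v) : t ∈ interval D a :=
  ⟨hu.1.trans h1, fun e he hae => h2.trans_lt (hv.2 e he hae)⟩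

theorem Ico_subset_interval {a u v : ℝ} (hu : u ∈ interval D a)
    (h : ∀ e ∈ D, e ≤ u ∨ v ≤ e) : Ico u v ⊆ interval D a := fun _ ht =>
  ⟨hu.1.trans ht.1, fun e he hae => ht.2.trans_le ((h e he).resolve_left
    (not_le.2 (hu.2 e he hae)))⟩

theorem eventually_mem_interval {a t : ℝ} (ht : t ∈ interval D a) :
    ∀ᶠ u in 𝓝[>] t, u ∈ interval D a := by
  have h1 : ∀ᶠ u in 𝓝[>] t, t < u := self_mem_nhdsWithin
  have h2 : ∀ᶠ u in 𝓝[>] t, ∀ e ∈ D, a < e → u < e := by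
    refine (Finset.eventually_all D).2 fun e he => ?_
    by_cases h : a < e
    · filter_upwards [mem_nhdsWithin_of_mem_nhds (Iio_mem_nhds (ht.2 e he h))] with u hu _
      exact hu
    · exact Eventually.of_forall fun u h' => absurd h' h
  filter_upwards [h1, h2] with u h3 h4
  exact ⟨ht.1.trans h3.le, h4⟩

theorem interval_anti (hDD : D ⊆ D') {a b : ℝ} (hb : b ∈ interval D a) :
    interval D' b ⊆ interval D a := fun _ ht =>
  ⟨hb.1.trans ht.1, fun e he hae => ht.2 e (hDD he) (hb.2 e he hae)⟩

/-! ### The pieces of a YDS schedule -/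

/-- `F` cuts the time axis into pieces on each of which `S` idles or runs one job at its average
speed in the depletion interval. -/
def IsCut (I : Instance n k) (S : Schedule n k) (D F : Finset ℝ) : Prop :=
  starts D ⊆ F ∧ (∀ j, I.r j ∈ F ∧ I.d j ∈ F) ∧
    ∀ x ∈ F, ∀ y ∈ F, x < y → (∀ z ∈ F, z ≤ x ∨ y ≤ z) →
      ∀ a ∈ starts D, x ∈ interval D a →
        (∀ t ∈ Ico x y, S.job t = none) ∨
        ∃ j, RunsAt I S j (avgSpeed I S j (interval D a)) x y

theorem ObeysYDS.exists_cut (h : ObeysYDS I S D) : ∃ F, IsCut I S D F := h.2.2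

/-- The power at speed `v` if every speed between two discrete speeds is realized by alternating
between them; `δ` are hinge weights of the power function. -/
def hinge (I : Instance n k) (δ : Fin (k + 1) → ℝ) (v : ℝ) : ℝ := ∑ i, δ i * max (v - I.s i) 0

theorem hinge_mono {δ : Fin (k + 1) → ℝ} (hδ : ∀ i, 0 ≤ δ i) : Monotone (hinge I δ) :=
  fun _ _ h => Finset.sum_le_sum fun i _ =>
    mul_le_mul_of_nonneg_left (max_le_max_right 0 (sub_le_sub_right h _)) (hδ i)

theorem hinge_zero (δ : Fin (k + 1) → ℝ) : hinge I δ 0 = 0 :=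
  Finset.sum_eq_zero fun i _ => by
    rw [max_eq_right (by linarith [I.s_nonneg i]), mul_zero]

theorem hinge_nonneg {δ : Fin (k + 1) → ℝ} (hδ : ∀ i, 0 ≤ δ i) (v : ℝ) : 0 ≤ hinge I δ v :=
  Finset.sum_nonneg fun i _ => mul_nonneg (hδ i) (le_max_right _ _)

theorem continuous_hinge (δ : Fin (k + 1) → ℝ) : Continuous (hinge I δ) := by
  unfold hinge; fun_prop

/-- The function of time that takes the value `c a j` while job `j` is run in the depletion interval
that starts at `a`. -/
noncomputable def profile (S : Schedule n k) (D : Finset ℝ) (c : ℝ → Fin n → ℝ) (t : ℝ) : ℝ :=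
  ∑ a ∈ starts D, (interval D a).indicator (jobFun S (c a)) t

theorem profile_eq (hD : ∀ e ∈ D, 0 < e) {a t : ℝ} (ha : a ∈ starts D) (ht : t ∈ interval D a)
    (c : ℝ → Fin n → ℝ) : profile S D c t = jobFun S (c a) t := by
  rw [profile, Finset.sum_eq_single a, indicator_of_mem ht]
  · intro b hb hba
    exact indicator_of_notMem (fun h => hba (eq_of_mem_interval hD hb ha h ht)) _
  · exact fun h => absurd ha h

theorem RespectsWindows.integrable_profile (h : RespectsWindows I S) (D : Finset ℝ)
    (c : ℝ → Fin n → ℝ) : Integrable (profile S D c) :=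
  integrable_finsetSum _ fun _ _ => (h.integrable_jobFun _).indicator (measurableSet_interval _ _)

/-- The power of `S` when averaged over the pieces. -/
noncomputable def fluidPower (I : Instance n k) (S : Schedule n k) (D : Finset ℝ)
    (δ : Fin (k + 1) → ℝ) : ℝ → ℝ :=
  profile S D fun a j => hinge I δ (avgSpeed I S j (interval D a))

theorem setIntegral_Ico_add {f : ℝ → ℝ} (hf : Integrable f) {x y z : ℝ} (h1 : x ≤ y)
    (h2 : y ≤ z) : ∫ t in Ico x z, f t = (∫ t in Ico x y, f t) + ∫ t in Ico y z, f t := by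
  rw [← Ico_union_Ico_eq_Ico h1 h2, setIntegral_union (Ico_disjoint_Ico_same) measurableSet_Ico
    hf.integrableOn hf.integrableOn]

theorem setIntegral_Ico_const {f : ℝ → ℝ} {x y c : ℝ} (h : x ≤ y) (hf : ∀ t ∈ Ico x y, f t = c) :
    ∫ t in Ico x y, f t = c * (y - x) := by
  rw [setIntegral_congr_fun measurableSet_Ico hf, setIntegral_const, smul_eq_mul,
    Real.volume_real_Ico_of_le h, mul_comm]

theorem RunsAt.setIntegral (hW : RespectsWindows I S) {j : Fin n} {v x y : ℝ}
    (h : RunsAt I S j v x y) : ∃ i : Fin k, ∃ z ∈ Icc x y,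
      I.s i.castSucc * (z - x) + I.s i.succ * (y - z) = v * (y - x) ∧
      ∀ f : Fin (k + 1) → ℝ, f 0 = 0 →
        ∫ t in Ico x y, f (S.speed t) = f i.castSucc * (z - x) + f i.succ * (y - z) := by
  obtain ⟨i, z, hz, -, h1, h2, h3⟩ := h
  refine ⟨i, z, hz, h3, fun f hf => ?_⟩
  rw [setIntegral_Ico_add (hW.integrable_speed f hf) hz.1 hz.2,
    setIntegral_Ico_const hz.1 fun t ht => by rw [h1 t ht],
    setIntegral_Ico_const hz.2 fun t ht => by rw [h2 t ht]]

/-- Alternating between consecutive discrete speeds costs the power `hinge I δ v` on average,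
because the power is affine between them. -/
theorem RunsAt.energy_eq (hW : RespectsWindows I S) {δ : Fin (k + 1) → ℝ}
    (hP : ∀ m, I.P m = hinge I δ (I.s m)) {j : Fin n} {v x y : ℝ} (hxy : x < y)
    (h : RunsAt I S j v x y) : energy I S (Ico x y) = hinge I δ v * (y - x) := by
  obtain ⟨i, z, hz, h1, h2⟩ := h.setIntegral hW
  rw [energy, h2 I.P I.P_zero, hP, hP, hinge, hinge, hinge, Finset.sum_mul, Finset.sum_mul,
    Finset.sum_mul, ← Finset.sum_add_distrib]
  refine Finset.sum_congr rfl fun m _ => ?_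
  rw [mul_assoc, mul_assoc, mul_assoc, ← mul_add]
  congr 1
  have hss : I.s i.castSucc < I.s i.succ := I.s_mono Fin.castSucc_lt_succ
  rcases le_or_gt m i.castSucc with hm | hm
  · have h3 : I.s m ≤ I.s i.castSucc := I.s_mono.monotone hm
    have h4 : I.s m ≤ v := by nlinarith [hz.1, hz.2]
    rw [max_eq_left (by linarith), max_eq_left (by linarith), max_eq_left (by linarith)]
    linarith
  · have h3 : I.s i.succ ≤ I.s m :=
      I.s_mono.monotone (by rw [Fin.le_def]; rw [Fin.lt_def] at hm; simp at hm ⊢; omega)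
    have h4 : v ≤ I.s m := by nlinarith [hz.1, hz.2]
    rw [max_eq_right (by linarith), max_eq_right (by linarith), max_eq_right (by linarith)]
    ring

namespace IsCut

theorem zero_mem (h : IsCut I S D F) : (0 : ℝ) ∈ F := h.1 (zero_mem_starts D)

theorem idle (h : IsCut I S D F) (hW : RespectsWindows I S) {t : ℝ} (ht : ∀ y ∈ F, y ≤ t) :
    S.job t = none := by
  rcases hj : S.job t with _ | j
  · rfl
  · exact absurd (hW t j hj).2 (not_lt.2 (ht _ (h.2.1 j).2))

/-- The piece that contains a given time. -/
theorem exists_piece (h : IsCut I S D F) {t : ℝ} (ht : 0 ≤ t)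
    (hF : ∃ y ∈ F, t < y) : ∃ x ∈ F, ∃ y ∈ F, 0 ≤ x ∧ x ≤ t ∧ t < y ∧ ∃ a ∈ starts D,
      Ico x y ⊆ interval D a ∧ ((∀ t ∈ Ico x y, S.job t = none) ∨
        ∃ j, RunsAt I S j (avgSpeed I S j (interval D a)) x y) := by
  obtain ⟨x, hx, y, hy, h1, h2, h3⟩ := exists_consecutive F t ⟨0, h.zero_mem, ht⟩ hF
  have hx0 : 0 ≤ x := (h3 0 h.zero_mem).resolve_right (not_le.2 (ht.trans_lt h2))
  obtain ⟨a, ha, hxa⟩ := exists_mem_interval hx0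
  exact ⟨x, hx, y, hy, hx0, h1, h2, a, ha,
    Ico_subset_interval hxa fun e he => h3 e (h.1 (mem_starts_of_mem he)),
    h.2.2 x hx y hy (h1.trans_lt h2) h3 a ha hxa⟩

theorem right_const (h : IsCut I S D F) (hW : RespectsWindows I S) {t : ℝ}
    (ht : 0 ≤ t) : ∀ᶠ u in 𝓝[>] t, S.job u = S.job t := by
  have hgt : ∀ᶠ u in 𝓝[>] t, t < u := self_mem_nhdsWithin
  by_cases hF : ∃ y ∈ F, t < y
  · obtain ⟨x, -, y, -, -, hxt, hty, a, -, -, hp⟩ := h.exists_piece ht hF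
    filter_upwards [hgt, mem_nhdsWithin_of_mem_nhds (Iio_mem_nhds hty)] with u h1 h2
    have hu : u ∈ Ico x y := ⟨hxt.trans h1.le, h2⟩
    rcases hp with hp | ⟨j, i, z, hz, hj, -⟩
    · rw [hp u hu, hp t ⟨hxt, hty⟩]
    · rw [hj u hu, hj t ⟨hxt, hty⟩]
  · push Not at hF
    filter_upwards [hgt] with u h1
    rw [h.idle hW hF, h.idle hW fun y hy => (hF y hy).trans h1.le]

/-- The energy between two cut points is the integral of the fluid power. -/
theorem energy_Ico (h : IsCut I S D F) (hD : ∀ e ∈ D, 0 < e) (hW : RespectsWindows I S)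
    {δ : Fin (k + 1) → ℝ} (hP : ∀ m, I.P m = hinge I δ (I.s m)) {u v : ℝ} (hu : u ∈ F)
    (hv : v ∈ F) (hu0 : 0 ≤ u) (huv : u ≤ v) :
    energy I S (Ico u v) = ∫ t in Ico u v, fluidPower I S D δ t := by
  refine rel_of_consecutive F (fun u v => 0 ≤ u → energy I S (Ico u v) =
    ∫ t in Ico u v, fluidPower I S D δ t) ?_ ?_ ?_ u hu v hv huv hu0
  · intro x _ _
    simp [energy]
  · intro x _ y _ z _ hxy hyz h1 h2 hx0
    rw [energy, setIntegral_Ico_add (hW.integrable_speed I.P I.P_zero) hxy hyz, fluidPower,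
      setIntegral_Ico_add (hW.integrable_profile D _) hxy hyz]
    exact congrArg₂ (· + ·) (h1 hx0) (h2 (hx0.trans hxy))
  · intro x hx y hy hxy hcons hx0
    obtain ⟨a, ha, hxa⟩ := exists_mem_interval hx0
    have hsub : Ico x y ⊆ interval D a :=
      Ico_subset_interval hxa fun e he => hcons e (h.1 (mem_starts_of_mem he))
    rcases h.2.2 x hx y hy hxy hcons a ha hxa with hp | ⟨j, hj⟩
    · rw [energy, setIntegral_Ico_const hxy.le fun t ht => by
          rw [S.idle t (hp t ht), I.P_zero],
        setIntegral_Ico_const hxy.le fun t ht => by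
          rw [fluidPower, profile_eq hD ha (hsub ht), jobFun_none (hp t ht)]]
    · rw [hj.energy_eq hW hP hxy, setIntegral_Ico_const hxy.le fun t ht => ?_]
      obtain ⟨i, z, hz, hj, -⟩ := hj
      rw [fluidPower, profile_eq hD ha (hsub ht), jobFun_some (hj t ht)]

theorem work_Ico_add (hW : RespectsWindows I S) (j : Fin n) {x y z : ℝ} (hxy : x ≤ y)
    (hyz : y ≤ z) : work I S j (Ico x z) = work I S j (Ico x y) + work I S j (Ico y z) := by
  rw [work, work, work, ← Ico_union_Ico_eq_Ico hxy hyz, union_inter_distrib_right,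
    setIntegral_union ((Ico_disjoint_Ico_same).mono inter_subset_left inter_subset_left)
      (measurableSet_Ico.inter (S.measurable_job j))]
  all_goals exact (hW.integrable_speed I.s I.s_zero).integrableOn

theorem dur_Ico_add (hW : RespectsWindows I S) (j : Fin n) {x y z : ℝ} (hxy : x ≤ y)
    (hyz : y ≤ z) : dur S j (Ico x z) = dur S j (Ico x y) + dur S j (Ico y z) := by
  rw [dur, dur, dur, ← Ico_union_Ico_eq_Ico hxy hyz, union_inter_distrib_right,
    measureReal_union ((Ico_disjoint_Ico_same).mono inter_subset_left inter_subset_left)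
      (measurableSet_Ico.inter (S.measurable_job j)) (hW.volume_inter_ne_top j _)
      (hW.volume_inter_ne_top j _)]

/-- Between two cut points of one depletion interval, every job runs at its average speed in
the whole depletion interval. -/
theorem work_Ico (h : IsCut I S D F) (hW : RespectsWindows I S) {a : ℝ}
    (ha : a ∈ starts D) {u v : ℝ} (hu : u ∈ F) (hv : v ∈ F) (huv : u ≤ v)
    (hsub : Ico u v ⊆ interval D a) (j : Fin n) :
    work I S j (Ico u v) = avgSpeed I S j (interval D a) * dur S j (Ico u v) := by
  refine rel_of_consecutive F (fun u v => Ico u v ⊆ interval D a → work I S j (Ico u v) =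
    avgSpeed I S j (interval D a) * dur S j (Ico u v)) ?_ ?_ ?_ u hu v hv huv hsub
  · intro x _ _
    simp [work, dur]
  · intro x _ y _ z _ hxy hyz h1 h2 hs
    rw [work_Ico_add hW j hxy hyz, dur_Ico_add hW j hxy hyz, h1, h2, mul_add]
    exacts [(Ico_subset_Ico_left hxy).trans hs, (Ico_subset_Ico_right hyz).trans hs]
  · intro x hx y hy hxy hcons hs
    have hxa := hs (left_mem_Ico.2 hxy)
    have hempty : ∀ B : Set ℝ, (∀ t ∈ B, S.job t ≠ some j) →
        work I S j B = avgSpeed I S j (interval D a) * dur S j B := by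
      intro B hB
      have : B ∩ {t | S.job t = some j} = ∅ :=
        eq_empty_of_forall_notMem fun t ht => hB t ht.1 ht.2
      rw [work, dur, this]; simp
    rcases h.2.2 x hx y hy hxy hcons a ha hxa with hp | ⟨j', hj'⟩
    · exact hempty _ fun t ht => by rw [hp t ht]; simp
    · obtain ⟨i, z, hz, h1, h2⟩ := hj'.setIntegral hW
      obtain ⟨-, -, -, hjt, -⟩ := hj'
      by_cases hjj : j' = j
      · subst hjj
        have : Ico x y ∩ {t | S.job t = some j'} = Ico x y :=
          inter_eq_left.2 fun t ht => hjt t ht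
        rw [work, dur, this, h2 I.s I.s_zero, h1, Real.volume_real_Ico_of_le hxy.le]
      · exact hempty _ fun t ht => by
          rw [hjt t ht]; exact fun h => hjj (Option.some_injective _ h)

/-- The time during which `S` works in a depletion interval ends at a cut point. -/
theorem exists_end (h : IsCut I S D F) (hW : RespectsWindows I S) (hD' : ∀ e ∈ D', 0 < e)
    (hF : starts D' ⊆ F) {b : ℝ}
    (hb : b ∈ starts D') : ∃ v ∈ F, b ≤ v ∧ Ico b v ⊆ interval D' b ∧
      ∀ t ∈ interval D' b, t ∉ Ico b v → S.job t = none := by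
  by_cases hnext : ∃ e ∈ D', b < e
  · obtain ⟨x, -, v, hv, h1, h2, h3⟩ := exists_consecutive (starts D') b ⟨b, hb, le_rfl⟩
      (by obtain ⟨e, he, h⟩ := hnext; exact ⟨e, mem_starts_of_mem he, h⟩)
    obtain rfl : x = b := le_antisymm h1 ((h3 b hb).resolve_right (not_le.2 h2))
    refine ⟨v, hF hv, h2.le, Ico_subset_interval (self_mem_interval D' x)
      fun e he => h3 e (mem_starts_of_mem he), fun t ht htv => ?_⟩
    refine absurd ⟨ht.1, ?_⟩ htv
    exact ht.2 v (mem_of_mem_starts hv ((nonneg_of_mem_starts hD' hb).trans_lt h2)) h2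
  · push Not at hnext
    refine ⟨F.max' ⟨0, h.zero_mem⟩, Finset.max'_mem _ _, Finset.le_max' _ _ (hF hb),
      Ico_subset_interval (self_mem_interval D' b) fun e he => Or.inl (hnext e he), ?_⟩
    intro t ht htv
    refine h.idle hW fun y hy => (Finset.le_max' F y hy).trans (not_lt.1 fun h1 => ?_)
    exact htv ⟨ht.1, h1⟩

end IsCut

/-! ### YDS schedules are greedy and energy-optimal -/

theorem ObeysYDS.greedy (h : ObeysYDS I S D) (hD : ∀ e ∈ D, 0 < e) {a : ℝ} (ha : a ∈ starts D) :
    Greedy I S (interval D a) where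
  measurable := measurableSet_interval D a
  windows := h.1
  work_pos t ht j hj := by
    have := ((h.2.1 a ha).max_speed Subset.rfl (by simp) t ht).1 j hj
    simpa using this
  max_speed t ht j hw hj :=
    ((h.2.1 a ha).max_speed Subset.rfl (by simp) t ht).2 j (by simpa using hj) hw
  right_const t ht := by
    obtain ⟨F, hF⟩ := h.exists_cut
    exact (eventually_mem_interval ht).and
      (hF.right_const h.1 ((nonneg_of_mem_starts hD ha).trans ht.1))

theorem setIntegral_eq_of_idle {f : ℝ → ℝ} {B C : Set ℝ} (hC : MeasurableSet C) (hBC : B ⊆ C)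
    (h : ∀ t ∈ C, t ∉ B → f t = 0) : ∫ t in C, f t = ∫ t in B, f t :=
  (setIntegral_eq_of_subset_of_forall_sdiff_eq_zero hC hBC fun t ht => h t ht.1 ht.2)

theorem inter_job_eq {B C : Set ℝ} (hBC : B ⊆ C) (h : ∀ t ∈ C, t ∉ B → S.job t = none)
    (j : Fin n) : C ∩ {t | S.job t = some j} = B ∩ {t | S.job t = some j} := by
  ext t
  refine ⟨fun ⟨h1, h2⟩ => ⟨?_, h2⟩, fun ⟨h1, h2⟩ => ⟨hBC h1, h2⟩⟩
  by_contra h3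
  have h4 : S.job t = some j := h2
  rw [h t h1 h3] at h4
  cases h4

/-- The energy of a YDS schedule in a depletion interval, in terms of the average speeds. -/
theorem ObeysYDS.energy_interval (h : ObeysYDS I S D) (hD : ∀ e ∈ D, 0 < e)
    {δ : Fin (k + 1) → ℝ} (hP : ∀ m, I.P m = hinge I δ (I.s m)) {a : ℝ} (ha : a ∈ starts D) :
    energy I S (interval D a) =
      ∑ i, δ i * ∑ j, max (avgSpeed I S j (interval D a) - I.s i) 0 * dur S j (interval D a) := by
  obtain ⟨F, hF⟩ := h.exists_cut
  obtain ⟨v, hv, hav, hsub, hidle⟩ := hF.exists_end h.1 hD hF.1 ha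
  have hA := measurableSet_interval D a
  have h1 : energy I S (interval D a) = energy I S (Ico a v) :=
    setIntegral_eq_of_idle hA hsub fun t ht htv => by rw [S.idle t (hidle t ht htv), I.P_zero]
  have h2 : ∫ t in Ico a v, fluidPower I S D δ t = ∑ j, hinge I δ (avgSpeed I S j (interval D a)) *
      dur S j (interval D a) := by
    have h3 : EqOn (fluidPower I S D δ) (jobFun S fun j => hinge I δ (avgSpeed I S j (interval D a)))
        (Ico a v) := fun t ht => profile_eq hD ha (hsub ht) _
    rw [← h.1.setIntegral_jobFun, setIntegral_congr_fun measurableSet_Ico h3]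
    exact (setIntegral_eq_of_idle hA hsub fun t ht htv => jobFun_none (hidle t ht htv)).symm
  rw [h1, hF.energy_Ico hD h.1 hP (hF.1 ha) hv (nonneg_of_mem_starts hD ha) hav, h2]
  simp only [hinge, Finset.sum_mul, Finset.mul_sum]
  rw [Finset.sum_comm]
  exact Finset.sum_congr rfl fun i _ => Finset.sum_congr rfl fun j _ => by ring

/-- Convex duality: every schedule of the same workloads exceeds the speed `s i` by at least as much
in total, because the jobs faster than `s i` fill the whole time at which they are active. -/
theorem Greedy.sum_hinge_le (h : Greedy I S A) (hS' : RespectsWindows I S')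
    (hw : ∀ j, work I S' j A = work I S j A) (i : Fin (k + 1)) :
    ∑ j, max (avgSpeed I S j A - I.s i) 0 * dur S j A ≤
      ∫ t in A, max (I.s (S'.speed t) - I.s i) 0 := by
  classical
  set Z := fasterThan I S A i with hZ
  set M := region I A (· ∈ Z) with hM
  have hMm : MeasurableSet M := measurableSet_region h.measurable _
  have hMfin : volume M ≠ ⊤ := (volume_region_lt_top _ _ _).ne
  have hint : Integrable fun t => max (I.s (S'.speed t) - I.s i) 0 :=
    hS'.integrable_speed (fun m => max (I.s m - I.s i) 0)
      (by rw [I.s_zero, max_eq_right (by linarith [I.s_nonneg i])])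
  have hints := hS'.integrable_speed I.s I.s_zero
  have h1 : ∑ j, max (avgSpeed I S j A - I.s i) 0 * dur S j A =
      ∑ j ∈ Z, (work I S j A - I.s i * dur S j A) := by
    rw [← Finset.sum_subset (Finset.subset_univ Z)]
    · refine Finset.sum_congr rfl fun j hj => ?_
      rw [max_eq_left (sub_nonneg.2 (mem_fasterThan.1 hj).2.le), h.windows.work_eq, sub_mul]
    · intro j _ hj
      by_cases hwj : 0 < work I S j A
      · rw [max_eq_right, zero_mul]
        exact sub_nonpos.2 (not_lt.1 fun h => hj (mem_fasterThan.2 ⟨hwj, h⟩))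
      · rw [h.dur_eq_zero hwj, mul_zero]
  have h2 : volume.real M ≤ ∑ j ∈ Z, dur S j A := by
    refine h.volume_le_sum_dur Z ?_
    rintro t ⟨ht, z, hz, hwz⟩
    obtain ⟨j, hj, hle⟩ := h.max_speed t ht z hwz (mem_fasterThan.1 hz).1
    exact ⟨ht, j, mem_fasterThan.2 ⟨h.work_pos t ht j hj, (mem_fasterThan.1 hz).2.trans_le hle⟩, hj⟩
  have h3 : ∑ j ∈ Z, work I S j A ≤ ∫ t in M, I.s (S'.speed t) := by
    rw [Finset.sum_congr rfl fun j _ => (hw j).symm]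
    simp only [work]
    rw [← integral_biUnion_finset Z
      (fun j _ => measurableSet_inter_job h.measurable j)
      (fun j _ j' _ hjj => disjoint_jobs A univ (mem_univ j) (mem_univ j') hjj)
      (fun j _ => hints.integrableOn)]
    refine setIntegral_mono_set hints.integrableOn (ae_of_all _ fun t => I.s_nonneg _)
      (LE.le.eventuallyLE ?_)
    intro t ht
    obtain ⟨j, hj, ht1, ht2⟩ := mem_iUnion₂.1 ht
    exact ⟨ht1, j, hj, hS' t j ht2⟩
  have h4 : ∫ t in M, (I.s (S'.speed t) - I.s i) ≤ ∫ t in M, max (I.s (S'.speed t) - I.s i) 0 :=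
    integral_mono (hints.integrableOn.sub (integrableOn_const hMfin)) hint.integrableOn
      fun t => le_max_left _ _
  have h5 : ∫ t in M, max (I.s (S'.speed t) - I.s i) 0 ≤
      ∫ t in A, max (I.s (S'.speed t) - I.s i) 0 :=
    setIntegral_mono_set hint.integrableOn (ae_of_all _ fun t => le_max_right _ _)
      (LE.le.eventuallyLE fun t ht => ht.1)
  rw [integral_sub hints.integrableOn (integrableOn_const hMfin), setIntegral_const,
    smul_eq_mul] at h4
  rw [h1, Finset.sum_sub_distrib, ← Finset.mul_sum]
  have h6 := mul_le_mul_of_nonneg_left h2 (I.s_nonneg i)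
  linarith

theorem ObeysYDS.energyOptimalOn (h : ObeysYDS I S D) (hD : ∀ e ∈ D, 0 < e) {a : ℝ}
    (ha : a ∈ starts D) : EnergyOptimalOn I S (interval D a) := by
  intro S' hS' hw
  obtain ⟨δ, hδ, hP⟩ := I.exists_hinge_weights
  rw [h.energy_interval hD hP ha, energy]
  simp only [hP]
  rw [integral_finsetSum]
  · refine Finset.sum_le_sum fun i _ => ?_
    rw [integral_const_mul]
    exact mul_le_mul_of_nonneg_left ((h.greedy hD ha).sum_hinge_le hS' hw i) (hδ i)
  · intro i _
    refine ((hS'.integrable_speed (fun m => max (I.s m - I.s i) 0) ?_).const_mul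
      (δ i)).integrableOn
    rw [I.s_zero, max_eq_right (by linarith [I.s_nonneg i])]

/-- Labelling further deadlines: restricted to a smaller depletion interval, a YDS schedule is
still greedy, and every job that is run there keeps its average speed. -/
theorem ObeysYDS.greedy_refine (h : ObeysYDS I S D) (hD : ∀ e ∈ D, 0 < e)
    (hD' : ∀ e ∈ D', 0 < e) (hDD : D ⊆ D') (hnew : ∀ e ∈ D', e ∈ D ∨ ∃ j, e = I.d j)
    {a b : ℝ} (ha : a ∈ starts D) (hb : b ∈ starts D') (hba : b ∈ interval D a) :
    Greedy I S (interval D' b) ∧ ∀ j, 0 < work I S j (interval D' b) →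
      0 < work I S j (interval D a) ∧
      avgSpeed I S j (interval D' b) = avgSpeed I S j (interval D a) := by
  have hg := h.greedy hD ha
  obtain ⟨F, hF⟩ := h.exists_cut
  have hF' : starts D' ⊆ F := by
    intro e he
    rcases Finset.mem_insert.1 he with rfl | he
    · exact hF.zero_mem
    · rcases hnew e he with he | ⟨j, rfl⟩
      exacts [hF.1 (mem_starts_of_mem he), (hF.2.1 j).2]
  have hsub := interval_anti hDD hba
  obtain ⟨v, hv, hbv, hsubv, hidle⟩ := hF.exists_end h.1 hD' hF' hb
  have hwork : ∀ j, work I S j (interval D' b) =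
      avgSpeed I S j (interval D a) * dur S j (interval D' b) := by
    intro j
    rw [dur, inter_job_eq hsubv hidle j, ← dur,
      ← hF.work_Ico h.1 ha (hF' hb) hv hbv (hsubv.trans hsub) j, work, work,
      inter_job_eq hsubv hidle j]
  have hkey : ∀ j, 0 < work I S j (interval D' b) → 0 < work I S j (interval D a) ∧
      avgSpeed I S j (interval D' b) = avgSpeed I S j (interval D a) := by
    intro j hj
    have hd := h.1.dur_pos hj
    refine ⟨?_, ?_⟩
    · by_contra h0
      rw [hwork, avgSpeed_eq_zero h0, zero_mul] at hj
      exact hj.false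
    · exact mul_right_cancel₀ hd.ne' ((h.1.work_eq j _).symm.trans (hwork j))
  have hrc : ∀ t ∈ interval D' b, ∀ᶠ u in 𝓝[>] t, u ∈ interval D' b ∧ S.job u = S.job t :=
    fun t ht => (eventually_mem_interval ht).and
      (hF.right_const h.1 ((nonneg_of_mem_starts hD' hb).trans ht.1))
  have hpos : ∀ t ∈ interval D' b, ∀ j, S.job t = some j → 0 < work I S j (interval D' b) := by
    intro t ht j hj
    rw [hwork]
    refine mul_pos (h.1.avgSpeed_pos (hg.work_pos t (hsub ht) j hj)) ?_
    refine measureReal_pos_of_mem_nhdsGT (t := t) ?_ (h.1.volume_inter_ne_top j _)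
    filter_upwards [hrc t ht] with u hu using ⟨hu.1, hu.2.trans hj⟩
  refine ⟨⟨measurableSet_interval _ _, h.1, hpos, fun t ht j hw hj => ?_, hrc⟩, hkey⟩
  obtain ⟨j', hj', hle⟩ := hg.max_speed t (hsub ht) j hw (hkey j hj).1
  refine ⟨j', hj', ?_⟩
  rwa [(hkey j hj).2, (hkey j' (hpos t ht j' hj')).2]

/-! ### The battery is emptiest at deadlines and depletion points -/

theorem setIntegral_Ico_le_of_monotoneOn {f : ℝ → ℝ} (hf : Integrable f) {u t v : ℝ}
    (hut : u ≤ t) (htv : t < v) (hmono : MonotoneOn f (Ico u v)) {B R : ℝ} (h1 : 0 ≤ B)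
    (h2 : 0 ≤ B + R * (v - u) - ∫ z in Ico u v, f z) :
    0 ≤ B + R * (t - u) - ∫ z in Ico u t, f z := by
  have htm : t ∈ Ico u v := ⟨hut, htv⟩
  rcases le_or_gt (f t) R with h | h
  · have h3 : ∫ z in Ico u t, f z ≤ ∫ _ in Ico u t, f t :=
      setIntegral_mono_on hf.integrableOn (integrableOn_const measure_Ico_lt_top.ne)
        measurableSet_Ico fun z hz => hmono ⟨hz.1, hz.2.trans htv⟩ htm hz.2.le
    rw [setIntegral_Ico_const hut fun _ _ => rfl] at h3
    nlinarith
  · have h3 : ∫ _ in Ico t v, f t ≤ ∫ z in Ico t v, f z :=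
      setIntegral_mono_on (integrableOn_const measure_Ico_lt_top.ne) hf.integrableOn
        measurableSet_Ico fun z hz => hmono htm ⟨hut.trans hz.1, hz.2⟩ hz.1
    rw [setIntegral_Ico_const htv.le fun _ _ => rfl] at h3
    rw [setIntegral_Ico_add hf hut htv.le] at h2
    nlinarith

/-- Between deadlines and depletion points jobs can only become active, so that the speed of a
YDS schedule does not decrease. -/
theorem ObeysYDS.monotoneOn_fluidPower (h : ObeysYDS I S D) (hD : ∀ e ∈ D, 0 < e)
    {δ : Fin (k + 1) → ℝ} (hδ : ∀ i, 0 ≤ δ i) {u v : ℝ} (hu : 0 ≤ u)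
    (hcD : ∀ e ∈ D, e ≤ u ∨ v ≤ e) (hcd : ∀ j, I.d j ≤ u ∨ v ≤ I.d j) :
    MonotoneOn (fluidPower I S D δ) (Ico u v) := by
  obtain ⟨a, ha, hua⟩ := exists_mem_interval (D := D) hu
  have hsub := Ico_subset_interval hua hcD
  have hg := h.greedy hD ha
  intro t ht t' ht' htt
  rw [fluidPower, profile_eq hD ha (hsub ht), profile_eq hD ha (hsub ht')]
  rcases hj : S.job t with _ | j
  · rw [jobFun_none hj]
    exact jobFun_nonneg (fun j => hinge_nonneg hδ _) t'
  · have hw := h.1 t j hj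
    have hd : t' < I.d j := ht'.2.trans_le ((hcd j).resolve_left (not_le.2 (ht.1.trans_lt hw.2)))
    obtain ⟨j', hj', hle⟩ := hg.max_speed t' (hsub ht') j ⟨hw.1.trans htt, hd⟩
      (hg.work_pos t (hsub ht) j hj)
    rw [jobFun_some hj, jobFun_some hj']
    exact hinge_mono hδ hle

theorem ObeysYDS.battery_nonneg (h : ObeysYDS I S D) (hD : ∀ e ∈ D, 0 < e) {R : ℝ} (hR : 0 ≤ R)
    (hbD : ∀ e ∈ D, 0 ≤ battery I S R e) (hbd : ∀ j, 0 ≤ battery I S R (I.d j)) {t : ℝ}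
    (ht : 0 ≤ t) : 0 ≤ battery I S R t := by
  classical
  obtain ⟨F, hF⟩ := h.exists_cut
  obtain ⟨δ, hδ, hP⟩ := I.exists_hinge_weights
  have hint := h.1.integrable_profile D fun a j => hinge I δ (avgSpeed I S j (interval D a))
  set f := fluidPower I S D δ with hf
  have hfint : Integrable f := hint
  have hbF : ∀ v ∈ F, 0 ≤ v → battery I S R v = R * v - ∫ z in Ico 0 v, f z := fun v hv hv0 => by
    rw [battery, hF.energy_Ico hD h.1 hP hF.zero_mem hv le_rfl hv0]
  set E : Finset ℝ := starts D ∪ Finset.univ.image I.d with hE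
  have hEF : ∀ e ∈ E, e ∈ F ∧ 0 ≤ e ∧ 0 ≤ battery I S R e := by
    intro e he
    rcases Finset.mem_union.1 he with he | he
    · refine ⟨hF.1 he, nonneg_of_mem_starts hD he, ?_⟩
      rcases Finset.mem_insert.1 he with rfl | he
      · simp [battery, energy]
      · exact hbD e he
    · obtain ⟨j, -, rfl⟩ := Finset.mem_image.1 he
      exact ⟨(hF.2.1 j).2, ((I.r_nonneg j).trans_lt (I.r_lt_d j)).le, hbd j⟩
  have h0E : (0 : ℝ) ∈ E := Finset.mem_union_left _ (zero_mem_starts D)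
  have hDE : ∀ e ∈ D, e ∈ E := fun e he => Finset.mem_union_left _ (mem_starts_of_mem he)
  have hdE : ∀ j, I.d j ∈ E := fun j =>
    Finset.mem_union_right _ (Finset.mem_image_of_mem _ (Finset.mem_univ j))
  -- The fluid battery level, which agrees with the battery level at the cut points.
  have hfluid : ∀ t, 0 ≤ t → 0 ≤ R * t - ∫ z in Ico 0 t, f z := by
    intro t ht
    by_cases hnext : ∃ y ∈ E, t < y
    · obtain ⟨u, hu, v, hv, h1, h2, h3⟩ := exists_consecutive E t ⟨0, h0E, ht⟩ hnext
      obtain ⟨huF, hu0, hub⟩ := hEF u hu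
      obtain ⟨hvF, hv0, hvb⟩ := hEF v hv
      rw [hbF u huF hu0] at hub
      rw [hbF v hvF hv0, setIntegral_Ico_add hfint hu0 (h1.trans h2.le)] at hvb
      have := setIntegral_Ico_le_of_monotoneOn hfint h1 h2
        (h.monotoneOn_fluidPower hD hδ hu0 (fun e he => h3 e (hDE e he)) fun j => h3 _ (hdE j))
        (B := R * u - ∫ z in Ico 0 u, f z) (R := R) hub (by linarith)
      rw [setIntegral_Ico_add hfint hu0 h1]
      linarith
    · push Not at hnext
      obtain ⟨u, hu, hum⟩ := E.exists_max_image id ⟨0, h0E⟩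
      obtain ⟨huF, hu0, hub⟩ := hEF u hu
      rw [hbF u huF hu0] at hub
      have hut := hnext u hu
      obtain ⟨a, ha, hua⟩ := exists_mem_interval (D := D) hu0
      have h1 : ∫ z in Ico u t, f z = 0 := by
        rw [setIntegral_Ico_const hut (c := 0) fun z hz => ?_, zero_mul]
        rw [hf, fluidPower, profile_eq hD ha
          (Ico_subset_interval hua (fun e he => Or.inl (hum e (hDE e he))) hz)]
        rcases hj : S.job z with _ | j
        · exact jobFun_none hj
        · exact absurd (h.1 z j hj).2 (not_lt.2 ((hum _ (hdE j)).trans hz.1))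
      rw [setIntegral_Ico_add hfint hu0 hut, h1]
      have := mul_le_mul_of_nonneg_left hut hR
      linarith
  have hbF' : ∀ v ∈ F, 0 ≤ v → 0 ≤ battery I S R v := fun v hv hv0 => by
    rw [hbF v hv hv0]; exact hfluid v hv0
  -- Within a piece the power does not decrease, either.
  have hPint := h.1.integrable_speed I.P I.P_zero
  have hidle : ∀ u, 0 ≤ u → u ≤ t → 0 ≤ battery I S R u → (∀ z ∈ Ico u t, S.job z = none) →
      0 ≤ battery I S R t := by
    intro u hu hut hub hz
    rw [battery, energy] at hub ⊢
    rw [setIntegral_Ico_add hPint hu hut, setIntegral_Ico_const hut (c := 0) fun z hz' => by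
      rw [S.idle z (hz z hz'), I.P_zero]]
    have := mul_le_mul_of_nonneg_left hut hR
    linarith
  by_cases hnext : ∃ y ∈ F, t < y
  · obtain ⟨x, hx, y, hy, hx0, hxt, hty, a, -, -, hp⟩ := hF.exists_piece ht hnext
    have hbx := hbF' x hx hx0
    have hby := hbF' y hy (hx0.trans (hxt.trans hty.le))
    rcases hp with hp | ⟨j, i, w, hw, -, h1, h2, -⟩
    · exact hidle x hx0 hxt hbx fun z hz => hp z ⟨hz.1, hz.2.trans hty⟩
    · rw [battery, energy] at hbx hby ⊢
      rw [setIntegral_Ico_add hPint hx0 (hxt.trans hty.le)] at hby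
      have hmono : MonotoneOn (fun z => I.P (S.speed z)) (Ico x y) := by
        intro z hz z' hz' hzz
        refine I.P_mono.monotone ?_
        rcases lt_or_ge z' w with h3 | h3
        · rw [h1 z' ⟨hz'.1, h3⟩, h1 z ⟨hz.1, hzz.trans_lt h3⟩]
        · rw [h2 z' ⟨h3, hz'.2⟩]
          rcases lt_or_ge z w with h4 | h4
          · rw [h1 z ⟨hz.1, h4⟩]; exact Fin.castSucc_lt_succ.le
          · rw [h2 z ⟨h4, hz.2⟩]
      have := setIntegral_Ico_le_of_monotoneOn hPint hxt hty hmono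
        (B := R * x - ∫ z in Ico 0 x, I.P (S.speed z)) (R := R) hbx (by linarith)
      rw [setIntegral_Ico_add hPint hx0 hxt]
      linarith
  · push Not at hnext
    obtain ⟨u, hu, hum⟩ := F.exists_max_image id ⟨0, hF.zero_mem⟩
    have hu0 : 0 ≤ u := hum 0 hF.zero_mem
    exact hidle u hu0 (hnext u hu) (hbF' u hu hu0) fun z hz =>
      hF.idle h.1 fun y hy => (hum y hy).trans hz.1

/-! ### The speeds depend continuously on the workloads -/

theorem exists_gap (E : Finset ℝ) : ∃ ℓ > 0, ∀ x ∈ E, ∀ y ∈ E, x < y → ℓ ≤ y - x := by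
  classical
  set G : Finset ℝ := insert 1 (((E ×ˢ E).image fun p => p.2 - p.1).filter (0 < ·)) with hG
  have hGne : G.Nonempty := ⟨1, Finset.mem_insert_self _ _⟩
  refine ⟨G.min' hGne, ?_, fun x hx y hy hxy => G.min'_le _ ?_⟩
  · rcases Finset.mem_insert.1 (G.min'_mem hGne) with h | h
    · rw [h]; exact one_pos
    · exact (Finset.mem_filter.1 h).2
  · refine Finset.mem_insert_of_mem (Finset.mem_filter.2 ⟨Finset.mem_image.2 ⟨(x, y), ?_, rfl⟩, ?_⟩)
    · exact Finset.mem_product.2 ⟨hx, hy⟩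
    · exact sub_pos.2 hxy

/-- The depletion intervals consist of cells of length at least `ℓ` in which the set of active jobs
does not change. -/
theorem exists_cells (I : Instance n k) (D : Finset ℝ) :
    ∃ ℓ > 0, ∀ a ∈ starts D, ∀ t ∈ interval D a, ∃ x y, t ∈ Ico x y ∧ ℓ ≤ y - x ∧
      Ico x y ⊆ interval D a ∧
      ∀ u ∈ Ico x y, ∀ j, u ∈ Ico (I.r j) (I.d j) ↔ t ∈ Ico (I.r j) (I.d j) := by
  classical
  set E : Finset ℝ := starts D ∪ (Finset.univ.image I.r ∪ Finset.univ.image I.d) with hE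
  have hDE : ∀ a ∈ starts D, a ∈ E := fun a ha => Finset.mem_union_left _ ha
  have hrE : ∀ j, I.r j ∈ E := fun j => Finset.mem_union_right _
    (Finset.mem_union_left _ (Finset.mem_image_of_mem _ (Finset.mem_univ j)))
  have hdE : ∀ j, I.d j ∈ E := fun j => Finset.mem_union_right _
    (Finset.mem_union_right _ (Finset.mem_image_of_mem _ (Finset.mem_univ j)))
  obtain ⟨ℓ, hℓ, hgap⟩ := exists_gap E
  refine ⟨ℓ, hℓ, fun a ha t ht => ?_⟩
  by_cases hnext : ∃ y ∈ E, t < y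
  · obtain ⟨x, hx, y, hy, h1, h2, h3⟩ := exists_consecutive E t ⟨a, hDE a ha, ht.1⟩ hnext
    have hax : a ≤ x := (h3 a (hDE a ha)).resolve_right (not_le.2 (ht.1.trans_lt h2))
    have hxa : x ∈ interval D a := mem_interval_of_le (self_mem_interval D a) ht hax h1
    refine ⟨x, y, ⟨h1, h2⟩, hgap x hx y hy (h1.trans_lt h2),
      Ico_subset_interval hxa fun e he => h3 e (hDE e (mem_starts_of_mem he)), fun u hu j => ?_⟩
    have h4 := h3 _ (hrE j)
    have h5 := h3 _ (hdE j)
    have h6 := hu.1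
    have h7 := hu.2
    simp only [mem_Ico]
    rcases h4 with h4 | h4 <;> rcases h5 with h5 | h5 <;>
      constructor <;> rintro ⟨h8, h9⟩ <;> constructor <;> linarith
  · push Not at hnext
    refine ⟨t, t + ℓ, ⟨le_rfl, by linarith⟩, by linarith,
      Ico_subset_interval ht fun e he => Or.inl (hnext e (hDE e (mem_starts_of_mem he))),
      fun u hu j => ?_⟩
    have h1 := hnext _ (hdE j)
    have h2 := hu.1
    simp only [mem_Ico]
    constructor <;> rintro ⟨h8, h9⟩ <;> constructor <;> linarith

namespace Greedy

theorem avgSpeed_le_jobFun (h : Greedy I S A) {t : ℝ} (ht : t ∈ A) {j : Fin n}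
    (hw : t ∈ Ico (I.r j) (I.d j)) :
    avgSpeed I S j A ≤ jobFun S (fun j => avgSpeed I S j A) t := by
  by_cases hj : 0 < work I S j A
  · obtain ⟨j', hj', hle⟩ := h.max_speed t ht j hw hj
    rwa [jobFun_some hj']
  · rw [avgSpeed_eq_zero hj]
    exact jobFun_nonneg (fun j => avgSpeed_nonneg j A) t

theorem jobFun_le_of_active (h : Greedy I S A) {t u : ℝ} (hu : u ∈ A)
    (hw : ∀ j, t ∈ Ico (I.r j) (I.d j) → u ∈ Ico (I.r j) (I.d j)) :
    jobFun S (fun j => avgSpeed I S j A) t ≤ jobFun S (fun j => avgSpeed I S j A) u := by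
  rcases hj : S.job t with _ | j
  · rw [jobFun_none hj]
    exact jobFun_nonneg (fun j => avgSpeed_nonneg j A) u
  · rw [jobFun_some hj]
    exact h.avgSpeed_le_jobFun hu (hw j (h.windows t j hj))

/-- The speed profiles of two YDS schedules are close if their workloads are: where one schedule
runs a job, the other is at least as fast as it runs this job, so that the mixed terms of the
integral of `(g - g') ^ 2` are bounded by workloads. -/
theorem sq_sub_mul_le (h : Greedy I S A) (h' : Greedy I S' A) {t x y : ℝ} (ht : t ∈ Ico x y)
    (hsub : Ico x y ⊆ A)
    (hw : ∀ u ∈ Ico x y, ∀ j, u ∈ Ico (I.r j) (I.d j) ↔ t ∈ Ico (I.r j) (I.d j)) :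
    (jobFun S (fun j => avgSpeed I S j A) t - jobFun S' (fun j => avgSpeed I S' j A) t) ^ 2 *
        (y - x) ≤ ∑ j, (avgSpeed I S j A - avgSpeed I S' j A) * (work I S j A - work I S' j A) := by
  set g := fun j => avgSpeed I S j A with hg
  set g' := fun j => avgSpeed I S' j A with hg'
  set κ := (jobFun S g t - jobFun S' g' t) ^ 2 with hκ
  have hconst : ∀ u ∈ Ico x y, (jobFun S g u - jobFun S' g' u) ^ 2 = κ := by
    intro u hu
    rw [hκ, le_antisymm (h.jobFun_le_of_active (hsub ht) fun j => (hw u hu j).1)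
        (h.jobFun_le_of_active (hsub hu) fun j => (hw u hu j).2),
      le_antisymm (h'.jobFun_le_of_active (hsub ht) fun j => (hw u hu j).1)
        (h'.jobFun_le_of_active (hsub hu) fun j => (hw u hu j).2)]
  -- `jobFun S g ^ 2` and the like, written as functions of the job in execution
  set q : ℝ → ℝ := fun u => jobFun S (fun j => g j * g j) u + jobFun S' (fun j => g' j * g' j) u -
    jobFun S' (fun j => g j * g' j) u - jobFun S (fun j => g' j * g j) u with hq
  have hpt : ∀ u ∈ A, (jobFun S g u - jobFun S' g' u) ^ 2 ≤ q u := by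
    intro u hu
    have hS : jobFun S (fun j => g j * g j) u = jobFun S g u * jobFun S g u := by
      rcases hj : S.job u with _ | j
      · simp [jobFun_none hj]
      · simp [jobFun_some hj]
    have hS' : jobFun S' (fun j => g' j * g' j) u = jobFun S' g' u * jobFun S' g' u := by
      rcases hj : S'.job u with _ | j
      · simp [jobFun_none hj]
      · simp [jobFun_some hj]
    have h1 : jobFun S' (fun j => g j * g' j) u ≤ jobFun S g u * jobFun S' g' u := by
      rcases hj : S'.job u with _ | j
      · simp [jobFun_none hj]
      · rw [jobFun_some hj, jobFun_some hj]
        exact mul_le_mul_of_nonneg_right (h.avgSpeed_le_jobFun hu (h'.windows u j hj))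
          (avgSpeed_nonneg j A)
    have h2 : jobFun S (fun j => g' j * g j) u ≤ jobFun S' g' u * jobFun S g u := by
      rcases hj : S.job u with _ | j
      · simp [jobFun_none hj]
      · rw [jobFun_some hj, jobFun_some hj]
        exact mul_le_mul_of_nonneg_right (h'.avgSpeed_le_jobFun hu (h.windows u j hj))
          (avgSpeed_nonneg j A)
    simp only [hq]
    rw [hS, hS']
    nlinarith
  have hqint : Integrable q := (((h.windows.integrable_jobFun _).add
    (h'.windows.integrable_jobFun _)).sub (h'.windows.integrable_jobFun _)).sub
    (h.windows.integrable_jobFun _)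
  have h1 : κ * (y - x) ≤ ∫ u in Ico x y, q u := by
    rw [← setIntegral_Ico_const (ht.1.trans ht.2.le) fun _ _ => rfl]
    exact setIntegral_mono_on (integrableOn_const measure_Ico_lt_top.ne) hqint.integrableOn
      measurableSet_Ico fun u hu => (hconst u hu).symm.trans_le (hpt u (hsub hu))
  have h2 : ∫ u in Ico x y, q u ≤ ∫ u in A, q u :=
    setIntegral_mono_set hqint.integrableOn
      ((ae_restrict_iff' h.measurable).2 (ae_of_all _ fun u hu => (sq_nonneg _).trans (hpt u hu)))
      (LE.le.eventuallyLE hsub)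
  refine (h1.trans h2).trans (le_of_eq ?_)
  rw [hq, integral_sub, integral_sub, integral_add, h.windows.setIntegral_jobFun,
    h.windows.setIntegral_jobFun, h'.windows.setIntegral_jobFun, h'.windows.setIntegral_jobFun,
    ← Finset.sum_add_distrib, ← Finset.sum_sub_distrib, ← Finset.sum_sub_distrib]
  · refine Finset.sum_congr rfl fun j _ => ?_
    rw [h.windows.work_eq, h'.windows.work_eq]
    ring
  all_goals
    first
    | exact (h.windows.integrable_jobFun _).integrableOn
    | exact (h'.windows.integrable_jobFun _).integrableOn
    | skip
  · exact ((h.windows.integrable_jobFun _).add (h'.windows.integrable_jobFun _)).integrableOn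
  · exact (((h.windows.integrable_jobFun _).add (h'.windows.integrable_jobFun _)).sub
      (h'.windows.integrable_jobFun _)).integrableOn

end Greedy

/-! ### The Speed Level Relation and the states -/

theorem exists_speed_bracket (I : Instance n k) {v : ℝ} (h0 : 0 ≤ v) (hv : v ≤ I.s (Fin.last k)) :
    (∃ i : Fin k, v ∈ Ioo (I.s i.castSucc) (I.s i.succ)) ∨ ∃ i, v = I.s i := by
  classical
  obtain ⟨i, hi, him⟩ := (Finset.univ.filter fun i => I.s i ≤ v).exists_max_image id
    ⟨0, Finset.mem_filter.2 ⟨Finset.mem_univ _, by rwa [I.s_zero]⟩⟩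
  have hi' := (Finset.mem_filter.1 hi).2
  rcases hi'.eq_or_lt with h | h
  · exact Or.inr ⟨i, h.symm⟩
  · refine Or.inl ?_
    have hne : i ≠ Fin.last k := fun h1 => absurd h (not_lt.2 (h1 ▸ hv))
    obtain ⟨m, rfl⟩ := Fin.exists_castSucc_eq.2 hne
    refine ⟨m, h, ?_⟩
    by_contra! h2
    exact absurd (him m.succ (Finset.mem_filter.2 ⟨Finset.mem_univ _, h2⟩))
      (not_le.2 Fin.castSucc_lt_succ)

theorem SLR.levels {lev : Fin n → ℝ → ℕ} (h : SLR I D S lev) (hW : RespectsWindows I S) {a : ℝ}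
    (ha : a ∈ starts D) : Levels I S (interval D a) fun j => lev j a := by
  have hb : ∀ j, _ := fun j => exists_speed_bracket I (avgSpeed_nonneg (I := I) (S := S) j
    (interval D a)) (hW.avgSpeed_le j _)
  refine ⟨fun j hj i hi => ?_, fun j hj i hi => ?_, fun j hj => ?_, h.maximal a ha⟩
  · rcases hb j with ⟨m, hm⟩ | ⟨m, hm⟩
    · have h1 := h.between a ha j hj m hm
      refine (I.s_mono.monotone (Fin.le_def.2 ?_)).trans hm.1.le
      simp only [Fin.val_castSucc]; omega
    · rw [hm]
      refine I.s_mono.monotone (Fin.le_def.2 ?_)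
      rcases h.discrete a ha j hj m hm with h1 | h1 <;> omega
  · rcases hb j with ⟨m, hm⟩ | ⟨m, hm⟩
    · have h1 := h.between a ha j hj m hm
      refine hm.2.le.trans (I.s_mono.monotone (Fin.le_def.2 ?_))
      simp only [Fin.val_succ]; omega
    · rw [hm]
      refine I.s_mono.monotone (Fin.le_def.2 ?_)
      rcases h.discrete a ha j hj m hm with h1 | h1 <;> omega
  · rcases hb j with ⟨m, hm⟩ | ⟨m, hm⟩
    · have h1 := h.between a ha j hj m hm
      omega
    · rcases h.discrete a ha j hj m hm with h1 | h1 <;> omega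

theorem SLR.of_levels {lev : Fin n → ℝ → ℕ}
    (h : ∀ a ∈ starts D, Levels I S (interval D a) fun j => lev j a)
    (hjump : ∀ a ∈ starts D, ∀ b ∈ starts D, a < b → ∀ j j',
      ActiveIn I j (interval D a) → ActiveIn I j (interval D b) →
      ActiveIn I j' (interval D a) → ActiveIn I j' (interval D b) →
      lev j a ≤ lev j b ∧ (lev j b : ℤ) - lev j a = (lev j' b : ℤ) - lev j' a) :
    SLR I D S lev where
  between a ha j hj i hi := by
    by_contra hne
    rcases lt_or_gt_of_ne hne with h1 | h1
    · have := (h a ha).upper j hj i.castSucc (by simp only [Fin.val_castSucc]; omega)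
      exact absurd hi.1 (not_lt.2 this)
    · have := (h a ha).lower j hj i.succ (by simp only [Fin.val_succ]; omega)
      exact absurd hi.2 (not_lt.2 this)
  discrete a ha j hj i hi := by
    by_contra! hne
    have hle := (h a ha).le j hj
    rcases lt_or_ge (lev j a) i with h1 | h1
    · have := (h a ha).upper j hj ⟨lev j a, by omega⟩ le_rfl
      rw [hi] at this
      exact absurd (I.s_mono (Fin.lt_def.2 h1)) (not_lt.2 this)
    · have := (h a ha).lower j hj ⟨i + 1, by omega⟩ (by simp only; omega)
      rw [hi] at this
      exact absurd (I.s_mono (Fin.lt_def.2 (by simp))) (not_lt.2 this)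
  jump := hjump
  maximal a ha := (h a ha).maximal

theorem RespectsWindows.work_univ (hW : RespectsWindows I S) (hD : ∀ e ∈ D, 0 < e) (j : Fin n) :
    work I S j univ = ∑ a ∈ starts D, work I S j (interval D a) := by
  simp only [work]
  rw [← integral_biUnion_finset (starts D)
    (fun a _ => (measurableSet_interval D a).inter (S.measurable_job j))
    (fun a ha b hb hab => disjoint_left.2 fun t h1 h2 => hab
      (eq_of_mem_interval hD ha hb h1.1 h2.1))
    fun a _ => (hW.integrable_speed I.s I.s_zero).integrableOn]
  congr 2
  ext t
  simp only [mem_inter_iff, mem_univ, true_and, mem_iUnion, exists_prop]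
  constructor
  · intro ht
    obtain ⟨a, ha, hta⟩ := exists_mem_interval (D := D) ((I.r_nonneg j).trans (hW t j ht).1)
    exact ⟨a, ha, hta, ht⟩
  · rintro ⟨a, -, -, ht⟩
    exact ht

/-- What has to be checked for a state: everything else follows from the YDS property. -/
theorem isState_and_optimalityABC {σ : State n k} (hD : ∀ e ∈ σ.depl, 0 < e)
    (h : ObeysYDS I σ.sched σ.depl) (hR : 0 ≤ σ.rate)
    (hbD : ∀ e ∈ σ.depl, battery I σ.sched σ.rate e = 0)
    (hbd : ∀ j, 0 ≤ battery I σ.sched σ.rate (I.d j)) (hp : ∀ j, I.p j ≤ work I σ.sched j univ)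
    (hl : SLR I σ.depl σ.sched σ.lev) : IsState I σ ∧ OptimalityABC I σ :=
  ⟨⟨fun e he => ⟨hD e he, hbD e he⟩, h⟩,
    ⟨h.1, hp, hR, fun _ => h.battery_nonneg hD hR (fun e he => (hbD e he).ge) hbd⟩,
    fun _ => h.energyOptimalOn hD, hl⟩

/-! ### The initial state -/

theorem IsInitial.isState_and_optimalityABC {σ : State n k} (h : IsInitial I σ) :
    IsState I σ ∧ OptimalityABC I σ := by
  obtain ⟨hdepl, hY, hwork, hR, hb, hlev⟩ := h
  have hD : ∀ e ∈ (∅ : Finset ℝ), 0 < e := by simp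
  have hstarts : ∀ a ∈ starts ∅, a = 0 := by simp [starts]
  refine SolarCell.isState_and_optimalityABC (by simp [hdepl]) (by rwa [hdepl]) hR
    (by simp [hdepl]) (fun j => hb _ ((I.r_nonneg j).trans (I.r_lt_d j).le))
    (fun j => (hwork j).ge) ?_
  rw [hdepl]
  have hg := hY.greedy hD (zero_mem_starts ∅)
  refine SLR.of_levels (fun a ha => ?_) fun a ha b hb hab => ?_
  · rw [hstarts a ha]
    refine ⟨fun j _ m hm => ?_, fun j _ m hm => ?_, fun j _ => ?_, fun t ht j j' hj hw' => ?_⟩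
    · obtain ⟨i, hi, hl⟩ := hlev j
      refine (I.s_mono.monotone (Fin.le_def.2 ?_)).trans hi.1.le
      simp only [Fin.val_castSucc]; omega
    · obtain ⟨i, hi, hl⟩ := hlev j
      refine hi.2.trans (I.s_mono.monotone (Fin.le_def.2 ?_))
      simp only [Fin.val_succ]; omega
    · obtain ⟨i, hi, hl⟩ := hlev j
      omega
    · have hpos : 0 < work I σ.sched j' (interval ∅ 0) := by
        have h1 := hY.1.work_univ hD j'
        have h2 : starts ∅ = {0} := rfl
        rw [hwork, h2, Finset.sum_singleton] at h1
        rw [← h1]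
        exact I.p_pos j'
      obtain ⟨j₁, hj₁, hle⟩ := hg.max_speed t ht j' hw' hpos
      rw [hj] at hj₁
      obtain rfl := Option.some_injective _ hj₁
      obtain ⟨i, hi, hl⟩ := hlev j
      obtain ⟨i', hi', hl'⟩ := hlev j'
      have h1 := I.s_mono.lt_iff_lt.1 ((hi'.1.trans_le hle).trans_le hi.2)
      rw [Fin.lt_def] at h1
      simp only [Fin.val_castSucc, Fin.val_succ] at h1
      omega
  · rw [hstarts a ha, hstarts b hb] at hab
    exact absurd hab (lt_irrefl _)

/-! ### Handling an event -/

theorem jobFun_comp {f : ℝ → ℝ} (hf : f 0 = 0) (c : Fin n → ℝ) (t : ℝ) :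
    jobFun S (fun j => f (c j)) t = f (jobFun S c t) := by
  rcases hj : S.job t with _ | j
  · rw [jobFun_none hj, jobFun_none hj, hf]
  · rw [jobFun_some hj, jobFun_some hj]

theorem Greedy.jobFun_eq (h : Greedy I S A) (h' : Greedy I S' A)
    (hw : ∀ j, work I S j A = work I S' j A) {t x y : ℝ} (ht : t ∈ Ico x y)
    (hsub : Ico x y ⊆ A)
    (hact : ∀ u ∈ Ico x y, ∀ j, u ∈ Ico (I.r j) (I.d j) ↔ t ∈ Ico (I.r j) (I.d j)) :
    jobFun S (fun j => avgSpeed I S j A) t = jobFun S' (fun j => avgSpeed I S' j A) t := by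
  have h1 := h.sq_sub_mul_le h' ht hsub hact
  rw [Finset.sum_eq_zero fun j _ => by rw [hw j, sub_self, mul_zero]] at h1
  have h2 : 0 < y - x := sub_pos.2 (ht.1.trans_lt ht.2)
  have h3 := nonpos_of_mul_nonpos_left h1 h2
  exact sub_eq_zero.1 (pow_eq_zero_iff two_ne_zero |>.1 (le_antisymm h3 (sq_nonneg _)))

/-- Recomputing a YDS schedule with the same workloads, possibly with further deadlines labelled,
changes neither the speeds nor the battery level at cut points. -/
theorem optimality_of_updated {σ σ' : State n k} (hσ : IsState I σ) (hopt : OptimalityABC I σ)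
    (h : Updated I σ σ') (hDD : σ.depl ⊆ σ'.depl)
    (hnew : ∀ e ∈ σ'.depl, e ∈ σ.depl ∨ ∃ j, e = I.d j)
    (hbat : ∀ e ∈ σ'.depl, battery I σ.sched σ.rate e = 0) :
    IsState I σ' ∧ OptimalityABC I σ' := by
  obtain ⟨hDb, hY⟩ := hσ
  obtain ⟨⟨hW, hp, hR, hb⟩, -, hslr⟩ := hopt
  obtain ⟨hrate, hY', hwork, hlev⟩ := h
  have hD : ∀ e ∈ σ.depl, 0 < e := fun e he => (hDb e he).1
  have hdpos : ∀ j, 0 < I.d j := fun j => (I.r_nonneg j).trans_lt (I.r_lt_d j)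
  have hD' : ∀ e ∈ σ'.depl, 0 < e := by
    intro e he
    rcases hnew e he with he | ⟨j, rfl⟩
    exacts [hD e he, hdpos j]
  have hparent : ∀ b ∈ starts σ'.depl, ∃ a ∈ starts σ.depl, b ∈ interval σ.depl a := fun b hb =>
    exists_mem_interval (nonneg_of_mem_starts hD' hb)
  obtain ⟨δ, hδ, hP⟩ := I.exists_hinge_weights
  obtain ⟨ℓ, hℓ, hcell⟩ := exists_cells I σ'.depl
  have hpow : ∀ t, 0 ≤ t →
      fluidPower I σ.sched σ.depl δ t = fluidPower I σ'.sched σ'.depl δ t := by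
    intro t ht
    obtain ⟨b, hb, htb⟩ := exists_mem_interval (D := σ'.depl) ht
    obtain ⟨a, ha, hba⟩ := hparent b hb
    obtain ⟨hg, hspeed⟩ := hY.greedy_refine hD hD' hDD hnew ha hb hba
    obtain ⟨x, y, hxy, -, hsub, hact⟩ := hcell b hb t htb
    rw [fluidPower, fluidPower, profile_eq hD ha (interval_anti hDD hba htb),
      profile_eq hD' hb htb, jobFun_comp (hinge_zero δ), jobFun_comp (hinge_zero δ),
      ← hg.jobFun_eq (hY'.greedy hD' hb) (fun j => (hwork j b hb).symm) hxy hsub hact]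
    congr 1
    rcases hj : σ.sched.job t with _ | j
    · rw [jobFun_none hj, jobFun_none hj]
    · rw [jobFun_some hj, jobFun_some hj, (hspeed j (hg.work_pos t htb j hj)).2]
  obtain ⟨F, hF⟩ := hY.exists_cut
  obtain ⟨F', hF'⟩ := hY'.exists_cut
  have hbeq : ∀ e ∈ F, e ∈ F' → 0 ≤ e →
      battery I σ'.sched σ'.rate e = battery I σ.sched σ.rate e := by
    intro e he he' he0
    rw [battery, battery, hrate, hF.energy_Ico hD hY.1 hP hF.zero_mem he le_rfl he0,
      hF'.energy_Ico hD' hY'.1 hP hF'.zero_mem he' le_rfl he0]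
    congr 1
    exact setIntegral_congr_fun measurableSet_Ico fun t ht => (hpow t ht.1).symm
  have hDF : ∀ e ∈ σ'.depl, e ∈ F := by
    intro e he
    rcases hnew e he with he | ⟨j, rfl⟩
    exacts [hF.1 (mem_starts_of_mem he), (hF.2.1 j).2]
  refine isState_and_optimalityABC hD' hY' (hrate ▸ hR) (fun e he => ?_) (fun j => ?_)
    (fun j => ?_) (SLR.of_levels (fun b hb => ?_) fun b hb b' hb' hbb j j' h1 h2 h3 h4 => ?_)
  · rw [hbeq e (hDF e he) (hF'.1 (mem_starts_of_mem he)) (hD' e he).le, hbat e he]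
  · rw [hbeq _ (hF.2.1 j).2 (hF'.2.1 j).2 (hdpos j).le]
    exact hb _ (hdpos j).le
  · rw [hY'.1.work_univ hD' j, Finset.sum_congr rfl fun b hb => hwork j b hb,
      ← hY.1.work_univ hD' j]
    exact hp j
  · obtain ⟨a, ha, hba⟩ := hparent b hb
    obtain ⟨hg, hspeed⟩ := hY.greedy_refine hD hD' hDD hnew ha hb hba
    have hlevels : Levels I σ.sched (interval σ'.depl b) fun j => σ'.lev j b := by
      have h0 := hslr.levels hY.1 ha
      refine ⟨fun j hj i hi => ?_, fun j hj i hi => ?_, fun j hj => ?_, fun t ht j j' hj hw => ?_⟩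
      · rw [(hspeed j hj).2]
        exact h0.lower j (hspeed j hj).1 i (by rwa [← hlev a ha b hb hba])
      · rw [(hspeed j hj).2]
        exact h0.upper j (hspeed j hj).1 i (by rwa [← hlev a ha b hb hba])
      · rw [hlev a ha b hb hba]
        exact h0.le j (hspeed j hj).1
      · rw [hlev a ha b hb hba, hlev a ha b hb hba]
        exact h0.maximal t (interval_anti hDD hba ht) j j' hj hw
    have hc := hg.levelCert hlevels
    simp only [← hwork _ b hb] at hc
    exact (hY'.greedy hD' hb).levels_of_cert hc
  · obtain ⟨a, ha, hba⟩ := hparent b hb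
    obtain ⟨a', ha', hba'⟩ := hparent b' hb'
    rw [hlev a ha b hb hba, hlev a' ha' b' hb' hba', hlev a ha b hb hba, hlev a' ha' b' hb' hba']
    have hsup : ∀ {j a b}, b ∈ interval σ.depl a → ActiveIn I j (interval σ'.depl b) →
        ActiveIn I j (interval σ.depl a) := fun hba hact =>
      hact.mono (inter_subset_inter_left _ (interval_anti hDD hba))
    rcases lt_trichotomy a a' with hlt | rfl | hgt
    · exact hslr.jump a ha a' ha' hlt j j' (hsup hba h1) (hsup hba' h2) (hsup hba h3) (hsup hba' h4)
    · exact ⟨le_rfl, by rw [sub_self, sub_self]⟩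
    · -- The later depletion interval cannot lie in an earlier one of the old intervals.
      have h5 : b < a := hbb.trans (hba'.2 a (mem_of_mem_starts ha
        ((nonneg_of_mem_starts hD ha').trans_lt hgt)) hgt)
      exact absurd hba.1 (not_le.2 h5)

theorem HandlesNonCutEvent.isState_and_optimalityABC {σ σ' : State n k} (hσ : IsState I σ)
    (hopt : OptimalityABC I σ) (h : HandlesNonCutEvent I σ σ') :
    IsState I σ' ∧ OptimalityABC I σ' := by
  cases h with
  | edge hD h =>
    exact optimality_of_updated hσ hopt h hD.ge (fun e he => Or.inl (hD ▸ he))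
      fun e he => (hσ.1 e (hD ▸ he)).2
  | depletionPoint j hj hE hD h =>
    refine optimality_of_updated hσ hopt h (hD ▸ Finset.subset_insert _ _) (fun e he => ?_)
      fun e he => ?_
    · rw [hD] at he
      rcases Finset.mem_insert.1 he with rfl | he
      exacts [Or.inr ⟨j, rfl⟩, Or.inl he]
    · rw [hD] at he
      rcases Finset.mem_insert.1 he with rfl | he
      exacts [hE, (hσ.1 e he).2]

/-! ### Moving work: small amounts -/

/-- A lower bound that is preserved when moving along each direction `u a` separately is
preserved when moving along a small non-negative combination of them. -/
theorem le_add_of_forall_direction {P : Finset ℝ} {K c ε x : ℝ} {u amount : ℝ → ℝ}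
    (hamount : ∀ a, 0 ≤ amount a) (hc : K ≤ c) (hu : ∀ a ∈ P, ∀ y ∈ Ioc 0 ε, K ≤ c + y * u a)
    (hx : 0 ≤ x) (hxε : ∀ a ∈ P, P.card * x * amount a ≤ ε) :
    K ≤ c + x * ∑ a ∈ P, amount a * u a := by
  rcases P.eq_empty_or_nonempty with rfl | hP
  · simpa using hc
  have hcard : (0 : ℝ) < P.card := Nat.cast_pos.2 hP.card_pos
  have h1 : ∑ a ∈ P, K ≤ ∑ a ∈ P, (c + P.card * x * amount a * u a) := by
    refine Finset.sum_le_sum fun a ha => ?_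
    have h0 : 0 ≤ P.card * x * amount a := mul_nonneg (mul_nonneg hcard.le hx) (hamount a)
    rcases h0.eq_or_lt with h | h
    · rwa [← h, zero_mul, add_zero]
    · exact hu a ha _ ⟨h, hxε a ha⟩
  rw [Finset.sum_const, Finset.sum_add_distrib, Finset.sum_const, nsmul_eq_mul, nsmul_eq_mul] at h1
  have h2 : ∑ a ∈ P, P.card * x * amount a * u a = P.card * (x * ∑ a ∈ P, amount a * u a) := by
    rw [Finset.mul_sum, Finset.mul_sum]
    exact Finset.sum_congr rfl fun a _ => by ring
  rw [h2, ← mul_add] at h1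
  exact le_of_mul_le_mul_left h1 hcard

theorem nonpos_of_forall_le_mul {K C ε : ℝ} (hε : 0 < ε) (h : ∀ y ∈ Ioc 0 ε, K ≤ y * C) :
    K ≤ 0 := by
  have h1 : Tendsto (fun y => y * C) (𝓝[>] 0) (𝓝 (0 * C)) :=
    (tendsto_id.mul_const C).mono_left nhdsWithin_le_nhds
  rw [zero_mul] at h1
  exact ge_of_tendsto h1 (by filter_upwards [Ioc_mem_nhdsGT hε] with y hy using h y hy)

/-- If moving a little work along each single direction `v a` respects the levels, then so does
moving along any non-negative combination of the directions, for some time. Since the conditions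
of `LevelCert` are linear in the workloads, they can be averaged. The set of jobs that are processed
may grow, but the time above level `i` that is new because of this is null unless `s i = 0`: the
little work moved must fill it at speed at least `s i`. -/
theorem levelCert_of_directions {lev : Fin n → ℕ} {w : Fin n → ℝ} {P : Finset ℝ}
    {v : ℝ → Fin n → ℝ} {amount : ℝ → ℝ} (hamount : ∀ a, 0 ≤ amount a) (hw : ∀ j, 0 ≤ w j)
    (hc : LevelCert I A lev {j | 0 < w j} w)
    (hv : ∀ a ∈ P, ∀ᶠ ε in 𝓝[>] (0 : ℝ), (∀ j, 0 ≤ w j + ε * v a j) ∧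
      LevelCert I A lev {j | 0 < w j + ε * v a j} fun j => w j + ε * v a j) :
    ∃ x₀ > 0, ∀ x ∈ Icc 0 x₀,
      LevelCert I A lev {j | 0 < w j ∨ 0 < ∑ a ∈ P, amount a * v a j}
        fun j => w j + x * ∑ a ∈ P, amount a * v a j := by
  classical
  obtain ⟨ε₀, hε₀, hsub⟩ := mem_nhdsGT_iff_exists_Ioc_subset.1 ((Finset.eventually_all P).2 hv)
  have hε₀' : (0 : ℝ) < ε₀ := hε₀
  set ε₁ := ε₀ / 2 with hε₁
  have hε₁pos : 0 < ε₁ := half_pos hε₀'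
  have hnn : ∀ a ∈ P, ∀ ε ∈ Ioc 0 ε₁, ∀ j, 0 ≤ w j + ε * v a j := fun a ha ε hε =>
    (hsub ⟨hε.1, hε.2.trans (half_le_self hε₀'.le)⟩ a ha).1
  have hcert : ∀ a ∈ P, ∀ ε ∈ Ioc 0 ε₁, LevelCert I A lev {j | 0 < w j + ε * v a j}
      fun j => w j + ε * v a j := fun a ha ε hε =>
    (hsub ⟨hε.1, hε.2.trans (half_le_self hε₀'.le)⟩ a ha).2
  have hpos : ∀ a ∈ P, ∀ ε ∈ Ioc 0 ε₁, ∀ j, 0 < w j → 0 < w j + ε * v a j := by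
    intro a ha ε hε j hj
    have h1 := (hsub ⟨hε₀', le_rfl⟩ a ha).1 j
    have h2 := hε.2
    have h3 := hε.1
    rcases le_or_gt 0 (v a j) with h | h
    · exact add_pos_of_pos_of_nonneg hj (mul_nonneg h3.le h)
    · nlinarith
  have hvnn : ∀ a ∈ P, ∀ j, ¬ 0 < w j → 0 ≤ v a j := by
    intro a ha j hj
    have h1 := hnn a ha ε₁ ⟨hε₁pos, le_rfl⟩ j
    rw [le_antisymm (not_lt.1 hj) (hw j), zero_add] at h1
    exact nonneg_of_mul_nonneg_right h1 hε₁pos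
  set V : Set (Fin n) := {j | 0 < w j ∨ 0 < ∑ a ∈ P, amount a * v a j} with hV
  -- a job without work at the beginning receives work along some direction
  have hVdir : ∀ j ∈ V, 0 < w j ∨ ∃ a ∈ P, 0 < amount a ∧ 0 < v a j := by
    rintro j (hj | hj)
    · exact Or.inl hj
    · by_cases hj0 : 0 < w j
      · exact Or.inl hj0
      obtain ⟨a, ha, hpa⟩ := Finset.exists_lt_of_sum_lt (f := fun _ => (0 : ℝ))
        (by simpa using hj)
      have h1 := hvnn a ha j hj0
      have h2 : 0 < v a j := h1.lt_of_ne fun h => by simp [← h] at hpa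
      exact Or.inr ⟨a, ha, pos_of_mul_pos_left hpa h1, h2⟩
  have hdirV : ∀ j, ∀ a ∈ P, 0 < amount a → 0 < v a j → j ∈ V := by
    intro j a ha h1 h2
    by_cases hj0 : 0 < w j
    · exact Or.inl hj0
    · exact Or.inr (Finset.sum_pos' (fun a' ha' => mul_nonneg (hamount a') (hvnn a' ha' j hj0))
        ⟨a, ha, mul_pos h1 h2⟩)
  -- time that is only used by jobs without work at the beginning
  have hnull : ∀ i : Fin (k + 1), ∀ a ∈ P,
      I.s i * volume.real (region I A (fun j => 0 < v a j ∧ i < lev j) \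
        region I A (· ∈ Finset.univ.filter fun j => 0 < w j ∧ i < lev j)) ≤ 0 := by
    intro i a ha
    set Z : Finset (Fin n) := {j | 0 < w j ∧ i < lev j} with hZ
    refine nonpos_of_forall_le_mul (C := ∑ j with j ∉ Z ∧ i < lev j, v a j) hε₁pos
      fun ε hε => ?_
    have h1 := (hcert a ha ε hε).lower i Z
    have h2 : ∑ j with j ∉ Z ∧ i < lev j, (w j + ε * v a j) =
        ε * ∑ j with j ∉ Z ∧ i < lev j, v a j := by
      rw [Finset.mul_sum]
      refine Finset.sum_congr rfl fun j hj => ?_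
      obtain ⟨h3, h4⟩ := (Finset.mem_filter.1 hj).2
      have h5 : ¬ 0 < w j := fun h => h3 (Finset.mem_filter.2 ⟨Finset.mem_univ _, h, h4⟩)
      rw [le_antisymm (not_lt.1 h5) (hw j), zero_add]
    refine (mul_le_mul_of_nonneg_left (measureReal_mono (sdiff_subset_sdiff_left
      (region_mono fun j hj => ⟨?_, hj.2⟩)) (volume_region_sdiff_ne_top _ _ _ _))
      (I.s_nonneg i)).trans (h1.trans h2.le)
    exact add_pos_of_nonneg_of_pos (hw j) (mul_pos hε.1 hj.1)
  have hK : ∀ i : Fin (k + 1), ∀ Z : Finset (Fin n),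
      I.s i * volume.real (region I A (fun j => j ∈ V ∧ i < lev j) \ region I A (· ∈ Z)) ≤
      I.s i * volume.real (region I A (fun j => 0 < w j ∧ i < lev j) \ region I A (· ∈ Z)) := by
    intro i Z
    set N : ℝ → Set ℝ := fun a => region I A (fun j => 0 < v a j ∧ i < lev j) \
        region I A (· ∈ Finset.univ.filter fun j => 0 < w j ∧ i < lev j) with hN
    set B := region I A (fun j => 0 < w j ∧ i < lev j) \ region I A (· ∈ Z) with hB
    have h1 : volume.real (region I A (fun j => j ∈ V ∧ i < lev j) \ region I A (· ∈ Z)) ≤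
        volume.real B + ∑ a ∈ P, volume.real (N a) := by
      refine (measureReal_mono (s₂ := B ∪ ⋃ a ∈ P, N a) ?_ ?_).trans
        ((measureReal_union_le _ _).trans
          (add_le_add_right (measureReal_biUnion_finset_le _ _) _))
      · rintro t ⟨⟨ht, j, ⟨hj, hl⟩, hwin⟩, hZ⟩
        by_cases h0 : t ∈ region I A (fun j => 0 < w j ∧ i < lev j)
        · exact Or.inl ⟨h0, hZ⟩
        · rcases hVdir j hj with h2 | ⟨a, ha, -, h2⟩
          · exact absurd ⟨ht, j, ⟨h2, hl⟩, hwin⟩ h0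
          · refine Or.inr (mem_biUnion ha ⟨⟨ht, j, ⟨h2, hl⟩, hwin⟩, ?_⟩)
            simpa using h0
      · refine (measure_union_lt_top (volume_region_sdiff_ne_top _ _ _ _).lt_top
          ((measure_biUnion_finset_le _ _).trans_lt (ENNReal.sum_lt_top.2 fun a _ => ?_))).ne
        exact (volume_region_sdiff_ne_top _ _ _ _).lt_top
    have h2 := mul_le_mul_of_nonneg_left h1 (I.s_nonneg i)
    rw [mul_add, Finset.mul_sum] at h2
    have h3 : ∑ a ∈ P, I.s i * volume.real (N a) ≤ 0 :=
      Finset.sum_nonpos fun a ha => hnull i a ha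
    linarith
  set q : ℝ := (P.card + 1) * (1 + ∑ a ∈ P, amount a) with hq
  have hsum : 0 ≤ ∑ a ∈ P, amount a := Finset.sum_nonneg fun a _ => hamount a
  have hqpos : 0 < q := by positivity
  have hswap : ∀ (X : Finset (Fin n)) (x : ℝ), ∑ j ∈ X, (w j + x * ∑ a ∈ P, amount a * v a j) =
      ∑ j ∈ X, w j + x * ∑ a ∈ P, amount a * ∑ j ∈ X, v a j := by
    intro X x
    rw [Finset.sum_add_distrib, ← Finset.mul_sum, Finset.sum_comm]
    simp only [Finset.mul_sum]
  refine ⟨ε₁ / q, div_pos hε₁pos hqpos, fun x hx => ?_⟩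
  have hxε : ∀ a ∈ P, P.card * x * amount a ≤ ε₁ := by
    intro a ha
    have h1 : x * q ≤ ε₁ := (le_div_iff₀ hqpos).1 hx.2
    have h2 : amount a ≤ 1 + ∑ a ∈ P, amount a := by
      linarith [Finset.single_le_sum (fun a _ => hamount a) ha]
    have h3 : (P.card : ℝ) * amount a ≤ q :=
      mul_le_mul (by linarith) h2 (hamount a) (by positivity)
    calc P.card * x * amount a = x * (P.card * amount a) := by ring
      _ ≤ x * q := mul_le_mul_of_nonneg_left h3 hx.1
      _ ≤ ε₁ := h1
  refine ⟨fun j hj => ?_, fun t ht j hj hwin j' hwin' => ?_, fun j hj => ?_, fun i X hX => ?_,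
    fun i Z => ?_⟩
  · by_contra hjV
    rw [hV, mem_ofPred_eq, not_or, not_lt, not_lt] at hjV
    have := mul_nonpos_of_nonneg_of_nonpos hx.1 hjV.2
    linarith [hjV.1]
  · rcases hVdir j hj with h1 | ⟨a, ha, ham, h1⟩
    · obtain ⟨z, hz, hzw, hzl⟩ := hc.cover t ht j h1 hwin j' hwin'
      exact ⟨z, Or.inl hz, hzw, hzl⟩
    · have hε : ε₁ ∈ Ioc 0 ε₁ := ⟨hε₁pos, le_rfl⟩
      obtain ⟨z, hz, hzw, hzl⟩ := (hcert a ha ε₁ hε).cover t ht j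
        (add_pos_of_nonneg_of_pos (hw j) (mul_pos hε₁pos h1)) hwin j' hwin'
      refine ⟨z, ?_, hzw, hzl⟩
      by_cases hz0 : 0 < w z
      · exact Or.inl hz0
      · have h2 : 0 < w z + ε₁ * v a z := hz
        rw [le_antisymm (not_lt.1 hz0) (hw z), zero_add] at h2
        exact hdirV z a ha ham (pos_of_mul_pos_right h2 hε₁pos.le)
  · rcases hVdir j hj with h1 | ⟨a, ha, -, h1⟩
    · exact hc.le j h1
    · exact (hcert a ha ε₁ ⟨hε₁pos, le_rfl⟩).le j
        (add_pos_of_nonneg_of_pos (hw j) (mul_pos hε₁pos h1))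
  · rw [hswap]
    have h1 := le_add_of_forall_direction (P := P)
      (K := -(I.s i * volume.real (region I A (· ∈ X) \ region I A fun j => i < lev j)))
      (c := -∑ j ∈ X, w j) (ε := ε₁) (u := fun a => -∑ j ∈ X, v a j) hamount
      (neg_le_neg (hc.upper i X hX)) (fun a ha y hy => ?_) hx.1 hxε
    · simp only [mul_neg, Finset.sum_neg_distrib] at h1
      linarith
    · have h2 := (hcert a ha y hy).upper i X hX
      rw [Finset.sum_add_distrib, ← Finset.mul_sum] at h2
      linarith
  · rw [hswap]
    refine (hK i Z).trans (le_add_of_forall_direction hamount (hc.lower i Z)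
      (fun a ha y hy => ?_) hx.1 hxε)
    have h2 := (hcert a ha y hy).lower i Z
    rw [Finset.sum_add_distrib, ← Finset.mul_sum] at h2
    refine (mul_le_mul_of_nonneg_left (measureReal_mono (sdiff_subset_sdiff_left
      (region_mono fun j hj => ⟨?_, hj.2⟩)) (volume_region_sdiff_ne_top _ _ _ _))
      (I.s_nonneg i)).trans h2
    exact hpos a ha y hy j hj.1

/-! ### Moving work: the speed levels persist until an event -/

/-- The positions `x` of the line `w + x • u` at which the linear conditions of `LevelCert` hold. -/
def linearCert (I : Instance n k) (A : Set ℝ) (lev : Fin n → ℕ) (V : Set (Fin n))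
    (w u : Fin n → ℝ) : Set ℝ :=
  {x | (∀ i : Fin (k + 1), ∀ X : Finset (Fin n), (∀ j ∈ X, lev j ≤ i) →
    ∑ j ∈ X, (w j + x * u j) ≤
      I.s i * volume.real (region I A (· ∈ X) \ region I A fun j => i < lev j)) ∧
  (∀ i : Fin (k + 1), ∀ Z : Finset (Fin n),
    I.s i * volume.real (region I A (fun j => j ∈ V ∧ i < lev j) \ region I A (· ∈ Z)) ≤
      ∑ j with j ∉ Z ∧ i < lev j, (w j + x * u j))}

section

variable {lev : Fin n → ℕ} {V : Set (Fin n)} {w u : Fin n → ℝ}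

theorem isClosed_linearCert : IsClosed (linearCert I A lev V w u) := by
  simp only [linearCert, ofPred_and, ofPred_forall]
  refine IsClosed.inter ?_ ?_
  · exact isClosed_iInter fun i => isClosed_iInter fun X => isClosed_iInter fun _ =>
      isClosed_le (by fun_prop) continuous_const
  · exact isClosed_iInter fun i => isClosed_iInter fun Z =>
      isClosed_le continuous_const (by fun_prop)

theorem mem_linearCert_of_mem_Icc {x y : ℝ} (h0 : (0 : ℝ) ∈ linearCert I A lev V w u)
    (hx : x ∈ linearCert I A lev V w u) (hy : y ∈ Icc 0 x) : y ∈ linearCert I A lev V w u := by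
  rcases hy.1.eq_or_lt with rfl | hy0
  · exact h0
  have hx0 : 0 < x := hy0.trans_le hy.2
  have key : ∀ X : Finset (Fin n), ∑ j ∈ X, (w j + y * u j) =
      (1 - y / x) * ∑ j ∈ X, (w j + 0 * u j) + y / x * ∑ j ∈ X, (w j + x * u j) := by
    intro X
    rw [Finset.mul_sum, Finset.mul_sum, ← Finset.sum_add_distrib]
    refine Finset.sum_congr rfl fun j _ => ?_
    field_simp
    ring
  have hα : 0 ≤ y / x := div_nonneg hy.1 hx0.le
  have hβ : 0 ≤ 1 - y / x := sub_nonneg.2 (div_le_one_of_le₀ hy.2 hx0.le)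
  refine ⟨fun i X hX => ?_, fun i Z => ?_⟩
  · rw [key]
    have h1 := mul_le_mul_of_nonneg_left (h0.1 i X hX) hβ
    have h2 := mul_le_mul_of_nonneg_left (hx.1 i X hX) hα
    linarith
  · rw [key]
    have h1 := mul_le_mul_of_nonneg_left (h0.2 i Z) hβ
    have h2 := mul_le_mul_of_nonneg_left (hx.2 i Z) hα
    linarith

theorem eq_of_affine_eq {X : Finset (Fin n)} {x y z K : ℝ} (hxy : x ≠ y)
    (hx : ∑ j ∈ X, (w j + x * u j) = K) (hy : ∑ j ∈ X, (w j + y * u j) = K) :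
    ∑ j ∈ X, (w j + z * u j) = K := by
  simp only [Finset.sum_add_distrib, ← Finset.mul_sum] at hx hy ⊢
  have h1 : (x - y) * ∑ j ∈ X, u j = 0 := by linarith
  have h2 : ∑ j ∈ X, u j = 0 := (mul_eq_zero.1 h1).resolve_left (sub_ne_zero.2 hxy)
  rw [h2] at hx ⊢
  linarith

theorem Levels.congr_speed (hl : Levels I S A lev)
    (hwork : ∀ j, 0 < work I S j A ↔ 0 < work I S' j A)
    (hlt : ∀ j, 0 < work I S j A → ∀ i, avgSpeed I S' j A < I.s i ↔ avgSpeed I S j A < I.s i)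
    (hgt : ∀ j, 0 < work I S j A → ∀ i, I.s i < avgSpeed I S' j A ↔ I.s i < avgSpeed I S j A) :
    (∀ j, 0 < work I S' j A → ∀ i : Fin (k + 1), i < lev j → I.s i ≤ avgSpeed I S' j A) ∧
    (∀ j, 0 < work I S' j A → ∀ i : Fin (k + 1), lev j ≤ i → avgSpeed I S' j A ≤ I.s i) := by
  refine ⟨fun j hj i hi => ?_, fun j hj i hi => ?_⟩
  · have h1 := (hwork j).2 hj
    exact not_lt.1 fun h2 => absurd ((hlt j h1 i).1 h2) (not_lt.2 (hl.lower j h1 i hi))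
  · have h1 := (hwork j).2 hj
    exact not_lt.1 fun h2 => absurd ((hgt j h1 i).1 h2) (not_lt.2 (hl.upper j h1 i hi))

/-- If the speeds stay on the same side of every discrete speed, then the levels can be kept beyond
`x`: jobs of speed `s i` and level above `i` fill their time at two positions, hence their work is
constant, hence they also fill it later. -/
theorem levelCert_of_same_bracket {S : ℝ → Schedule n k} {y₁ x y : ℝ} (hy₁ : y₁ ≠ x)
    (hg : ∀ z, z = y₁ ∨ z = x ∨ z = y → Greedy I (S z) A ∧
      ∀ j, work I (S z) j A = w j + z * u j)
    (hV : ∀ z, z = y₁ ∨ z = x ∨ z = y → ∀ j, 0 < work I (S z) j A ↔ j ∈ V)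
    (hc : ∀ z, z = y₁ ∨ z = x → LevelCert I A lev V fun j => work I (S z) j A)
    (hlt : ∀ z, z = y₁ ∨ z = y → ∀ j ∈ V, ∀ i,
      avgSpeed I (S z) j A < I.s i ↔ avgSpeed I (S x) j A < I.s i)
    (hgt : ∀ z, z = y₁ ∨ z = y → ∀ j ∈ V, ∀ i,
      I.s i < avgSpeed I (S z) j A ↔ I.s i < avgSpeed I (S x) j A) :
    LevelCert I A lev V fun j => work I (S y) j A := by
  have hcx := hc x (Or.inr rfl)
  have hgx := (hg x (Or.inr (Or.inl rfl))).1
  have hgy := (hg y (Or.inr (Or.inr rfl))).1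
  have hVx := hV x (Or.inr (Or.inl rfl))
  have hVy := hV y (Or.inr (Or.inr rfl))
  have hfast : ∀ z, z = y₁ ∨ z = y → ∀ i, fasterThan I (S z) A i = fasterThan I (S x) A i := by
    intro z hz i
    ext j
    rw [mem_fasterThan, mem_fasterThan, hVx, hV z (by tauto)]
    exact and_congr_right fun hj => hgt z hz j hj i
  have htight : ∀ z, z = y₁ ∨ z = x → ∀ i : Fin (k + 1),
      ∑ j with j ∉ fasterThan I (S x) A i ∧ i < lev j, (w j + z * u j) =
      I.s i * volume.real (region I A (fun j => j ∈ V ∧ i < lev j) \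
        region I A (· ∈ fasterThan I (S x) A i)) := by
    intro z hz i
    have hgz := hg z (by tauto)
    have hfz : fasterThan I (S z) A i = fasterThan I (S x) A i := by
      rcases hz with rfl | rfl
      exacts [hfast z (Or.inl rfl) i, rfl]
    have hlz := hgz.1.levels_of_cert (hc z hz)
    have h1 := hgz.1.sum_work_eq_of_bounds (i := i) fun j hj => hlz.lower j hj i
    have h2 := hgz.1.sum_dur_le_volume_region (lev := lev) (hc z hz).supp i
    have h3 := (hc z hz).lower i (fasterThan I (S x) A i)
    rw [hfz] at h1 h2
    simp only [← hgz.2]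
    exact le_antisymm (h1.trans_le (mul_le_mul_of_nonneg_left h2 (I.s_nonneg i))) h3
  have hlx := hgx.levels_of_cert hcx
  obtain ⟨hlo, hhi⟩ := hlx.congr_speed (S' := S y) (fun j => (hVx j).trans (hVy j).symm)
    (fun j hj => hlt y (Or.inr rfl) j ((hVx j).1 hj))
    (fun j hj => hgt y (Or.inr rfl) j ((hVx j).1 hj))
  have hlevels : Levels I (S y) A lev := by
    refine ⟨hlo, hhi, fun j hj => hcx.le j ((hVy j).1 hj), fun t ht j j' hj hw => ?_⟩
    refine hgy.maximal_of_lower (V := V) (fun j => (hVy j).1) hcx.cover hcx.le hlo hhi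
      (fun i => ?_) ht hj hw
    rw [hfast y (Or.inr rfl) i]
    simp only [(hg y (Or.inr (Or.inr rfl))).2]
    exact (eq_of_affine_eq hy₁ (htight y₁ (Or.inl rfl) i) (htight x (Or.inr rfl) i)).ge
  have hVeq : {j | 0 < work I (S y) j A} = V := Set.ext hVy
  rw [← hVeq]
  exact hgy.levelCert hlevels

end

/-! ### Moving work: continuity -/

theorem continuousWithinAt_of_sq_le {f : ℝ → ℝ} {s : Set ℝ} {x ℓ C : ℝ} (hℓ : 0 < ℓ)
    (h : ∀ y ∈ s, (f y - f x) ^ 2 * ℓ ≤ C * |y - x|) : ContinuousWithinAt f s x := by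
  have h1 : Tendsto (fun y => √(C * |y - x| / ℓ)) (𝓝[s] x) (𝓝 0) := by
    have h2 : Continuous fun y => √(C * |y - x| / ℓ) := by fun_prop
    have h3 := (h2.tendsto x).mono_left (nhdsWithin_le_nhds (s := s))
    simpa using h3
  have h4 : Tendsto (fun y => f y - f x) (𝓝[s] x) (𝓝 0) := by
    refine squeeze_zero_norm' ?_ h1
    filter_upwards [self_mem_nhdsWithin] with y hy
    exact Real.le_sqrt_of_sq_le (by
      rw [Real.norm_eq_abs, sq_abs, le_div_iff₀ hℓ]; exact h y hy)
  have h5 := h4.add_const (f x)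
  simpa [ContinuousWithinAt] using h5

namespace Greedy

theorem avgSpeed_sq_sub_mul_le (h : Greedy I S A) (h' : Greedy I S' A) {ℓ : ℝ}
    (hcell : ∀ t ∈ A, ∃ x y, t ∈ Ico x y ∧ ℓ ≤ y - x ∧ Ico x y ⊆ A ∧
      ∀ u ∈ Ico x y, ∀ j, u ∈ Ico (I.r j) (I.d j) ↔ t ∈ Ico (I.r j) (I.d j))
    {j : Fin n} (hj : 0 < work I S j A) (hj' : 0 < work I S' j A) :
    (avgSpeed I S j A - avgSpeed I S' j A) ^ 2 * ℓ ≤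
      ∑ i, (avgSpeed I S i A - avgSpeed I S' i A) * (work I S i A - work I S' i A) := by
  have key : ∀ {S S' : Schedule n k}, Greedy I S A → Greedy I S' A → 0 < work I S j A →
      avgSpeed I S j A ≤ avgSpeed I S' j A → (avgSpeed I S j A - avgSpeed I S' j A) ^ 2 * ℓ ≤
      ∑ i, (avgSpeed I S i A - avgSpeed I S' i A) * (work I S i A - work I S' i A) := by
    intro S S' h h' hj hle
    -- While `S` runs `j`, its speed is that of `j`, and `S'` is at least as fast as `j`.
    obtain ⟨t, htA, htj⟩ : (A ∩ {t | S.job t = some j}).Nonempty := by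
      by_contra hne
      have h1 := h.windows.dur_pos hj
      rw [dur, not_nonempty_iff_eq_empty.1 hne, measureReal_empty] at h1
      exact h1.false
    obtain ⟨x, y, hxy, hℓ, hsub, hact⟩ := hcell t htA
    refine le_trans ?_ (h.sq_sub_mul_le h' hxy hsub hact)
    have h1 := h'.avgSpeed_le_jobFun htA (h.windows t j htj)
    rw [jobFun_some htj]
    have h2 : (avgSpeed I S j A - avgSpeed I S' j A) ^ 2 ≤
        (avgSpeed I S j A - jobFun S' (fun j => avgSpeed I S' j A) t) ^ 2 := by nlinarith
    exact (mul_le_mul_of_nonneg_left hℓ (sq_nonneg _)).trans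
      (mul_le_mul_of_nonneg_right h2 (sub_pos.2 (hxy.1.trans_lt hxy.2)).le)
  rcases le_total (avgSpeed I S j A) (avgSpeed I S' j A) with hle | hle
  · exact key h h' hj hle
  · have h1 := key h' h hj' hle
    rw [← neg_sub, neg_sq] at h1
    refine h1.trans (le_of_eq (Finset.sum_congr rfl fun i _ => by ring))

theorem sum_sub_mul_sub_le (h : Greedy I S A) (h' : Greedy I S' A) {w u : Fin n → ℝ} {x y : ℝ}
    (hx : ∀ j, work I S j A = w j + x * u j) (hy : ∀ j, work I S' j A = w j + y * u j) :
    ∑ j, (avgSpeed I S j A - avgSpeed I S' j A) * (work I S j A - work I S' j A) ≤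
      (∑ j, I.s (Fin.last k) * |u j|) * |x - y| := by
  rw [Finset.sum_mul]
  refine Finset.sum_le_sum fun j _ => ?_
  rw [hx, hy]
  refine (le_abs_self _).trans ?_
  rw [abs_mul, show w j + x * u j - (w j + y * u j) = u j * (x - y) by ring, abs_mul, ← mul_assoc]
  refine mul_le_mul_of_nonneg_right (mul_le_mul_of_nonneg_right ?_ (abs_nonneg _)) (abs_nonneg _)
  have h1 := avgSpeed_nonneg (I := I) (S := S) j A
  have h2 := avgSpeed_nonneg (I := I) (S := S') j A
  have h3 := h.windows.avgSpeed_le j A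
  have h4 := h'.windows.avgSpeed_le j A
  rw [abs_le]
  constructor <;> linarith

end Greedy

/-! ### A round of moving work -/

theorem energy_Ico_eq_sum (hW : RespectsWindows I S) (hD : ∀ e ∈ D, 0 < e) {e : ℝ}
    (he : e ∈ D) :
    energy I S (Ico 0 e) = ∑ b ∈ (starts D).filter (· < e), energy I S (interval D b) := by
  simp only [energy]
  rw [← integral_biUnion_finset _ (fun a _ => measurableSet_interval D a)
    (fun a ha b hb hab => disjoint_left.2 fun t h1 h2 => hab
      (eq_of_mem_interval hD (Finset.mem_filter.1 ha).1 (Finset.mem_filter.1 hb).1 h1 h2))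
    fun a _ => (hW.integrable_speed I.P I.P_zero).integrableOn]
  congr 2
  ext t
  simp only [mem_iUnion, exists_prop, Finset.mem_filter]
  constructor
  · intro ht
    obtain ⟨b, hb, htb⟩ := exists_mem_interval (D := D) ht.1
    exact ⟨b, ⟨hb, htb.1.trans_lt ht.2⟩, htb⟩
  · rintro ⟨b, ⟨hb, hbe⟩, htb⟩
    exact ⟨(nonneg_of_mem_starts hD hb).trans htb.1, htb.2 e he hbe⟩

theorem Transfer.sum_change (T : Transfer n) {E : Finset ℝ}
    (hE : ∀ a ≤ T.len, T.loc a ∈ E) (j : Fin n) : ∑ b ∈ E, T.change j b = 0 := by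
  simp only [Transfer.change]
  rw [Finset.sum_comm]
  refine Finset.sum_eq_zero fun a ha => ?_
  have ha' : a < T.len := Finset.mem_range.1 ha
  rw [Finset.sum_sub_distrib]
  by_cases hj : T.job a = j
  · simp only [hj, true_and]
    rw [Finset.sum_ite_eq, Finset.sum_ite_eq, if_pos (hE _ ha'), if_pos (hE _ ha'.le), sub_self]
  · simp [hj]

namespace Move

variable {σ : State n k}

/-- The rate at which the work of job `j` in the depletion interval `b` changes. -/
noncomputable def slope (m : Move I σ) (b : ℝ) (j : Fin n) : ℝ :=
  ∑ a ∈ (starts σ.depl).erase (lastStart σ.depl), m.amount a * (m.path a).change j b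

/-- The jobs that are processed in the depletion interval `b` while work is moved. -/
def moving (m : Move I σ) (b : ℝ) : Set (Fin n) :=
  {j | 0 < work I σ.sched j (interval σ.depl b) ∨ 0 < m.slope b j}

theorem work_affine (m : Move I σ) {x b : ℝ} (hx : x ∈ Icc 0 m.decrease) (hb : b ∈ starts σ.depl)
    (j : Fin n) : work I (m.S x) j (interval σ.depl b) =
      work I σ.sched j (interval σ.depl b) + x * m.slope b j :=
  m.work_eq x hx j b hb

theorem work_pos_iff (m : Move I σ) {x b : ℝ} (hx : x ∈ Ioo 0 m.decrease)
    (hb : b ∈ starts σ.depl) (j : Fin n) :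
    0 < work I (m.S x) j (interval σ.depl b) ↔ j ∈ m.moving b := by
  have h0 := work_nonneg (I := I) (S := σ.sched) j (interval σ.depl b)
  have h1 := work_nonneg (I := I) (S := m.S m.decrease) j (interval σ.depl b)
  have hdec : 0 < m.decrease := hx.1.trans hx.2
  rw [m.work_affine ⟨hdec.le, le_rfl⟩ hb] at h1
  rw [m.work_affine ⟨hx.1.le, hx.2.le⟩ hb]
  have hx1 := hx.1
  have hx2 := hx.2
  constructor
  · intro h
    by_contra hV
    rw [moving, mem_ofPred_eq, not_or, not_lt, not_lt] at hV
    have := mul_nonpos_of_nonneg_of_nonpos hx1.le hV.2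
    linarith [hV.1]
  · rintro (h | h)
    · rcases le_or_gt 0 (m.slope b j) with h2 | h2
      · exact add_pos_of_pos_of_nonneg h (mul_nonneg hx1.le h2)
      · nlinarith
    · exact add_pos_of_nonneg_of_pos h0 (mul_pos hx1 h)

theorem supp_moving (m : Move I σ) {x b : ℝ} (hx : x ∈ Icc 0 m.decrease)
    (hb : b ∈ starts σ.depl) (j : Fin n) (hj : 0 < work I (m.S x) j (interval σ.depl b)) :
    j ∈ m.moving b := by
  by_contra hV
  rw [moving, mem_ofPred_eq, not_or, not_lt, not_lt] at hV
  rw [m.work_affine hx hb] at hj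
  have := mul_nonpos_of_nonneg_of_nonpos hx.1 hV.2
  linarith [hV.1]

/-- Within the round no speed passes a discrete speed: the speeds are continuous, and a job at a
discrete speed would leave it only at an event. -/
theorem eventually_same_bracket (m : Move I σ) (hσ : IsState I σ) {x b : ℝ}
    (hx : x ∈ Ioo 0 m.decrease) (hb : b ∈ starts σ.depl) :
    ∀ᶠ y in 𝓝 x, ∀ j ∈ m.moving b, ∀ i,
      (avgSpeed I (m.S y) j (interval σ.depl b) < I.s i ↔
        avgSpeed I (m.S x) j (interval σ.depl b) < I.s i) ∧
      (I.s i < avgSpeed I (m.S y) j (interval σ.depl b) ↔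
        I.s i < avgSpeed I (m.S x) j (interval σ.depl b)) := by
  have hD : ∀ e ∈ σ.depl, 0 < e := fun e he => (hσ.1 e he).1
  obtain ⟨ℓ, hℓ, hcell⟩ := exists_cells I σ.depl
  have hIoo : ∀ y ∈ Ioo 0 m.decrease, y ∈ Icc 0 m.decrease := fun y hy => Ioo_subset_Icc_self hy
  have hg : ∀ y ∈ Icc 0 m.decrease, Greedy I (m.S y) (interval σ.depl b) := fun y hy =>
    (m.yds y hy).greedy hD hb
  refine eventually_all.2 fun j => ?_
  by_cases hj : j ∈ m.moving b
  swap
  · exact Eventually.of_forall fun y h => absurd h hj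
  have hcont : ContinuousWithinAt (fun y => avgSpeed I (m.S y) j (interval σ.depl b))
      (Ioo 0 m.decrease) x := by
    refine continuousWithinAt_of_sq_le hℓ (C := ∑ j, I.s (Fin.last k) * |m.slope b j|)
      fun y hy => ?_
    exact ((hg y (hIoo y hy)).avgSpeed_sq_sub_mul_le (hg x (hIoo x hx)) (hcell b hb)
      ((m.work_pos_iff hy hb j).2 hj) ((m.work_pos_iff hx hb j).2 hj)).trans
      ((hg y (hIoo y hy)).sum_sub_mul_sub_le (hg x (hIoo x hx))
        (m.work_affine (hIoo y hy) hb) (m.work_affine (hIoo x hx) hb))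
  have hcont' := (hcont.continuousAt (Ioo_mem_nhds hx.1 hx.2)).tendsto
  have : ∀ i, ∀ᶠ y in 𝓝 x, (avgSpeed I (m.S y) j (interval σ.depl b) < I.s i ↔
        avgSpeed I (m.S x) j (interval σ.depl b) < I.s i) ∧
      (I.s i < avgSpeed I (m.S y) j (interval σ.depl b) ↔
        I.s i < avgSpeed I (m.S x) j (interval σ.depl b)) := by
    intro i
    rcases lt_trichotomy (avgSpeed I (m.S x) j (interval σ.depl b)) (I.s i) with h | h | h
    · filter_upwards [hcont'.eventually_lt_const h] with y hy
      exact ⟨iff_of_true hy h, iff_of_false hy.not_gt h.not_gt⟩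
    · have hev : ∀ᶠ y in 𝓝 x, avgSpeed I (m.S y) j (interval σ.depl b) = I.s i := by
        by_contra hne
        exact m.no_inactive x hx ⟨j, b, hb, (m.work_pos_iff hx hb j).2 hj, i, h, hne⟩
      filter_upwards [hev] with y hy
      rw [hy, h]
      exact ⟨Iff.rfl, Iff.rfl⟩
    · filter_upwards [hcont'.eventually_const_lt h] with y hy
      exact ⟨iff_of_false hy.not_gt h.not_gt, iff_of_true hy h⟩
  filter_upwards [eventually_all.2 this] with y hy _ using hy

/-- The current levels stay valid for a short time. -/
theorem exists_levelCert_start (m : Move I σ) (hσ : IsState I σ) (hopt : OptimalityABC I σ)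
    {b : ℝ} (hb : b ∈ starts σ.depl) : ∃ x₀ > 0, ∀ x ∈ Icc 0 x₀,
      LevelCert I (interval σ.depl b) (fun j => σ.lev j b) (m.moving b)
        fun j => work I σ.sched j (interval σ.depl b) + x * m.slope b j := by
  have hD : ∀ e ∈ σ.depl, 0 < e := fun e he => (hσ.1 e he).1
  refine levelCert_of_directions m.amount_nonneg (fun j => work_nonneg j _)
    ((hσ.2.greedy hD hb).levelCert (hopt.2.2.levels hσ.2.1 hb)) fun a ha => ?_
  obtain ⟨hne, hmem⟩ := Finset.mem_erase.1 ha
  obtain ⟨⟨-, -, ε₀, hε₀, hact⟩, -⟩ := m.active a hmem hne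
  filter_upwards [Ioc_mem_nhdsGT hε₀] with ε hε
  obtain ⟨S', hY', hwork, -, hslr⟩ := hact ε hε
  have hc := (hY'.greedy hD hb).levelCert (hslr.levels hY'.1 hb)
  simp only [hwork _ b hb] at hc
  exact ⟨fun j => by rw [← hwork j b hb]; exact work_nonneg j _, hc⟩

/-- The current levels stay valid until the end of the round. -/
theorem levelCert (m : Move I σ) (hσ : IsState I σ) (hopt : OptimalityABC I σ)
    {b : ℝ} (hb : b ∈ starts σ.depl) {x : ℝ} (hx : x ∈ Icc 0 m.decrease) :
    LevelCert I (interval σ.depl b) (fun j => σ.lev j b) (m.moving b)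
      fun j => work I (m.S x) j (interval σ.depl b) := by
  have hD : ∀ e ∈ σ.depl, 0 < e := fun e he => (hσ.1 e he).1
  obtain ⟨x₀, hx₀, hstart⟩ := m.exists_levelCert_start hσ hopt hb
  have h0 := hstart 0 ⟨le_rfl, hx₀.le⟩
  set L := linearCert I (interval σ.depl b) (fun j => σ.lev j b) (m.moving b)
    (fun j => work I σ.sched j (interval σ.depl b)) (m.slope b) with hL
  have hmemL : ∀ {y}, LevelCert I (interval σ.depl b) (fun j => σ.lev j b) (m.moving b)
      (fun j => work I σ.sched j (interval σ.depl b) + y * m.slope b j) → y ∈ L := fun h =>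
    ⟨h.upper, h.lower⟩
  have hcert : ∀ y ∈ Icc 0 m.decrease, y ∈ L →
      LevelCert I (interval σ.depl b) (fun j => σ.lev j b) (m.moving b)
        fun j => work I (m.S y) j (interval σ.depl b) := by
    intro y hy hyL
    refine ⟨m.supp_moving hy hb, h0.cover, h0.le, fun i X hX => ?_, fun i Z => ?_⟩
    · simp only [m.work_affine hy hb]
      exact hyL.1 i X hX
    · simp only [m.work_affine hy hb]
      exact hyL.2 i Z
  have h0L : (0 : ℝ) ∈ L := hmemL h0
  refine hcert x hx (IsClosed.Icc_subset_of_forall_mem_nhdsWithin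
    (isClosed_linearCert.inter isClosed_Icc) h0L (fun z hz => ?_) hx)
  obtain ⟨hzL, hz0, hzd⟩ := hz
  rcases hz0.eq_or_lt with rfl | hz0
  · filter_upwards [Ioc_mem_nhdsGT hx₀] with y hy using hmemL (hstart y ⟨hy.1.le, hy.2⟩)
  · have hzI : z ∈ Ioo 0 m.decrease := ⟨hz0, hzd⟩
    have hsame := m.eventually_same_bracket hσ hzI hb
    obtain ⟨y₁, hy₁, hy₁s⟩ := ((hsame.filter_mono nhdsWithin_le_nhds).and
      (Ioo_mem_nhdsLT hz0)).exists
    have hy₁I : y₁ ∈ Ioo 0 m.decrease := ⟨hy₁s.1, hy₁s.2.trans hzd⟩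
    filter_upwards [mem_nhdsWithin_of_mem_nhds hsame, Ioo_mem_nhdsGT hzd] with y hy hys
    have hyI : y ∈ Ioo 0 m.decrease := ⟨hz0.trans hys.1, hys.2⟩
    have hall : ∀ w, w = y₁ ∨ w = z ∨ w = y → w ∈ Ioo 0 m.decrease := by
      rintro w (rfl | rfl | rfl) <;> assumption
    have := levelCert_of_same_bracket (S := m.S) (y := y) hy₁s.2.ne
      (fun w hw => ⟨(m.yds w (Ioo_subset_Icc_self (hall w hw))).greedy hD hb,
        m.work_affine (Ioo_subset_Icc_self (hall w hw)) hb⟩)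
      (fun w hw => m.work_pos_iff (hall w hw) hb)
      (fun w hw => hcert w (Ioo_subset_Icc_self (hall w (by tauto))) ?_)
      (fun w hw j hj i => ?_) (fun w hw j hj i => ?_)
    · simp only [m.work_affine (Ioo_subset_Icc_self hyI) hb] at this
      exact hmemL this
    · rcases hw with rfl | rfl
      exacts [mem_linearCert_of_mem_Icc h0L hzL ⟨hy₁s.1.le, hy₁s.2.le⟩, hzL]
    · rcases hw with rfl | rfl
      exacts [(hy₁ j hj i).1, (hy j hj i).1]
    · rcases hw with rfl | rfl
      exacts [(hy₁ j hj i).2, (hy j hj i).2]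

/-- With fixed levels, the energy in a depletion interval is an affine function of the progress. -/
theorem exists_energy_affine (m : Move I σ) (hσ : IsState I σ) (hopt : OptimalityABC I σ)
    {b : ℝ} (hb : b ∈ starts σ.depl) : ∃ α β : ℝ, ∀ x ∈ Icc 0 m.decrease,
      energy I (m.S x) (interval σ.depl b) = α + β * x := by
  have hD : ∀ e ∈ σ.depl, 0 < e := fun e he => (hσ.1 e he).1
  obtain ⟨δ, hδ, hP⟩ := I.exists_hinge_weights
  refine ⟨∑ i, δ i * (∑ j with i < σ.lev j b, work I σ.sched j (interval σ.depl b) - I.s i *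
      volume.real (region I (interval σ.depl b) fun j => j ∈ m.moving b ∧ i < σ.lev j b)),
    ∑ i : Fin (k + 1), δ i * ∑ j with i < σ.lev j b, m.slope b j, fun x hx => ?_⟩
  rw [(m.yds x hx).energy_interval hD hP hb, Finset.sum_mul, ← Finset.sum_add_distrib]
  refine Finset.sum_congr rfl fun i _ => ?_
  rw [((m.yds x hx).greedy hD hb).sum_hinge_of_cert (m.levelCert hσ hopt hb hx) i]
  simp only [m.work_affine hx hb, Finset.sum_add_distrib, ← Finset.mul_sum]
  ring

/-- The battery level at a labelled depletion point is affine in the progress, and it does not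
change initially; so it stays zero. -/
theorem battery_depl (m : Move I σ) (hσ : IsState I σ) (hopt : OptimalityABC I σ)
    (hdec : 0 < m.decrease) {e : ℝ} (he : e ∈ σ.depl) {x : ℝ} (hx : x ∈ Icc 0 m.decrease) :
    battery I (m.S x) (σ.rate - x) e = 0 := by
  have hD : ∀ e ∈ σ.depl, 0 < e := fun e he => (hσ.1 e he).1
  choose! α β hαβ using fun b (hb : b ∈ starts σ.depl) => m.exists_energy_affine hσ hopt hb
  set T := (starts σ.depl).filter (· < e) with hT
  have haff : ∀ x ∈ Icc 0 m.decrease, battery I (m.S x) (σ.rate - x) e =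
      (σ.rate * e - ∑ b ∈ T, α b) + (-e - ∑ b ∈ T, β b) * x := by
    intro x hx
    rw [battery, energy_Ico_eq_sum (m.yds x hx).1 hD he,
      Finset.sum_congr rfl fun b hb => hαβ b (Finset.mem_filter.1 hb).1 x hx,
      Finset.sum_add_distrib, ← Finset.sum_mul]
    ring
  have h0mem : (0 : ℝ) ∈ Icc 0 m.decrease := ⟨le_rfl, hdec.le⟩
  have h0 : σ.rate * e - ∑ b ∈ T, α b = 0 := by
    have h1 := haff 0 h0mem
    rw [m.S_zero, sub_zero, (hσ.1 e he).2, mul_zero, add_zero] at h1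
    exact h1.symm
  have hder : HasDerivWithinAt (fun x => battery I (m.S x) (σ.rate - x) e)
      (-e - ∑ b ∈ T, β b) (Icc 0 m.decrease) 0 := by
    have h1 : HasDerivWithinAt
        (fun x => (σ.rate * e - ∑ b ∈ T, α b) + (-e - ∑ b ∈ T, β b) * x)
        ((-e - ∑ b ∈ T, β b) * 1) (Icc 0 m.decrease) 0 :=
      ((hasDerivWithinAt_id 0 _).const_mul _).const_add _
    rw [mul_one] at h1
    exact h1.congr haff (haff 0 h0mem)
  have hβ := (uniqueDiffOn_Icc hdec 0 h0mem).eq_deriv _ hder (m.energy_rate e he)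
  rw [haff x hx, h0, hβ, zero_mul, add_zero]

theorem continuousOn_battery (m : Move I σ) (hσ : IsState I σ) (j : Fin n) :
    ContinuousOn (fun x => battery I (m.S x) (σ.rate - x) (I.d j)) (Icc 0 m.decrease) := by
  have hD : ∀ e ∈ σ.depl, 0 < e := fun e he => (hσ.1 e he).1
  obtain ⟨δ, hδ, hP⟩ := I.exists_hinge_weights
  obtain ⟨ℓ, hℓ, hcell⟩ := exists_cells I σ.depl
  have hd : 0 ≤ I.d j := (I.r_nonneg j).trans (I.r_lt_d j).le
  have hbat : ∀ x ∈ Icc 0 m.decrease, battery I (m.S x) (σ.rate - x) (I.d j) =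
      (σ.rate - x) * I.d j - ∫ t in Ico 0 (I.d j), fluidPower I (m.S x) σ.depl δ t := by
    intro x hx
    obtain ⟨F, hF⟩ := (m.yds x hx).exists_cut
    rw [battery, hF.energy_Ico hD (m.yds x hx).1 hP hF.zero_mem (hF.2.1 j).2 le_rfl hd]
  refine ContinuousOn.congr ?_ hbat
  refine ContinuousOn.sub (by fun_prop) fun x hx => ?_
  refine continuousWithinAt_of_dominated (bound := fun _ => hinge I δ (I.s (Fin.last k))) ?_ ?_
    (integrableOn_const measure_Ico_lt_top.ne) ?_
  · filter_upwards [self_mem_nhdsWithin] with y hy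
    exact ((m.yds y hy).1.integrable_profile _ _).aestronglyMeasurable.restrict
  · filter_upwards [self_mem_nhdsWithin] with y hy
    refine (ae_restrict_iff' measurableSet_Ico).2 (ae_of_all _ fun t ht => ?_)
    obtain ⟨b, hb, htb⟩ := exists_mem_interval (D := σ.depl) ht.1
    rw [fluidPower, profile_eq hD hb htb, Real.norm_eq_abs,
      abs_of_nonneg (jobFun_nonneg (fun j => hinge_nonneg hδ _) t)]
    rcases hj : (m.S y).job t with _ | j
    · rw [jobFun_none hj]; exact hinge_nonneg hδ _
    · rw [jobFun_some hj]; exact hinge_mono hδ ((m.yds y hy).1.avgSpeed_le _ _)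
  · refine (ae_restrict_iff' measurableSet_Ico).2 (ae_of_all _ fun t ht => ?_)
    obtain ⟨b, hb, htb⟩ := exists_mem_interval (D := σ.depl) ht.1
    obtain ⟨u, v, huv, hℓuv, hsub, hact⟩ := hcell b hb t htb
    have hg : ∀ y ∈ Icc 0 m.decrease, Greedy I (m.S y) (interval σ.depl b) := fun y hy =>
      (m.yds y hy).greedy hD hb
    simp only [fluidPower, profile_eq hD hb htb, jobFun_comp (hinge_zero δ)]
    refine (continuous_hinge δ).continuousAt.comp_continuousWithinAt
      (continuousWithinAt_of_sq_le hℓ (C := ∑ j, I.s (Fin.last k) * |m.slope b j|)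
        fun y hy => ?_)
    exact (mul_le_mul_of_nonneg_left hℓuv (sq_nonneg _)).trans
      (((hg y hy).sq_sub_mul_le (hg x hx) huv hsub hact).trans
        ((hg y hy).sum_sub_mul_sub_le (hg x hx) (m.work_affine hy hb) (m.work_affine hx hb)))

theorem battery_deadline_nonneg (m : Move I σ) (hσ : IsState I σ) (hopt : OptimalityABC I σ)
    {j : Fin n} (hj : I.d j ∉ σ.depl) {x : ℝ} (hx : x ∈ Icc 0 m.decrease) :
    0 ≤ battery I (m.S x) (σ.rate - x) (I.d j) := by
  have hcont := m.continuousOn_battery hσ j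
  set f := fun x => battery I (m.S x) (σ.rate - x) (I.d j) with hf
  change x ∈ {x | 0 ≤ f x}
  refine IsClosed.Icc_subset_of_forall_mem_nhdsWithin (a := 0) (b := m.decrease) ?_ ?_ ?_ hx
  · have := hcont.preimage_isClosed_of_isClosed isClosed_Icc (isClosed_Ici (a := (0 : ℝ)))
    rwa [inter_comm] at this
  · change 0 ≤ f 0
    simp only [hf, m.S_zero, sub_zero]
    exact hopt.1.2.2.2 _ ((I.r_nonneg j).trans (I.r_lt_d j).le)
  · rintro z ⟨hz, hz0, hzd⟩
    have hz' : 0 ≤ f z := hz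
    rcases hz'.eq_or_lt with h | h
    · by_contra hne
      refine m.no_depletionPoint z ⟨hz0, hzd⟩ ⟨j, hj, h.symm, fun h1 => hne ?_⟩
      filter_upwards [h1] with y hy using not_lt.1 hy
    · have h1 := ((hcont z ⟨hz0, hzd.le⟩).mono_left (nhdsWithin_le_iff.2
        (mem_of_superset (Ioo_mem_nhdsGT hzd) fun y hy => ⟨hz0.trans hy.1.le, hy.2.le⟩)) :
          Tendsto f (𝓝[>] z) (𝓝 (f z))).eventually_const_lt h
      filter_upwards [h1] with y hy using hy.le

theorem work_univ (m : Move I σ) (hσ : IsState I σ) {x : ℝ} (hx : x ∈ Icc 0 m.decrease)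
    (j : Fin n) : work I (m.S x) j univ = work I σ.sched j univ := by
  have hD : ∀ e ∈ σ.depl, 0 < e := fun e he => (hσ.1 e he).1
  rw [(m.yds x hx).1.work_univ hD, hσ.2.1.work_univ hD,
    Finset.sum_congr rfl fun b hb => m.work_affine hx hb j, Finset.sum_add_distrib,
    ← Finset.mul_sum]
  have : ∑ b ∈ starts σ.depl, m.slope b j = 0 := by
    simp only [slope]
    rw [Finset.sum_comm]
    refine Finset.sum_eq_zero fun a ha => ?_
    obtain ⟨hne, hmem⟩ := Finset.mem_erase.1 ha
    rw [← Finset.mul_sum, Transfer.sum_change _ (m.active a hmem hne).1.2.1, mul_zero]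
  rw [this, mul_zero, add_zero]

theorem isState_and_optimalityABC (m : Move I σ) (hσ : IsState I σ) (hopt : OptimalityABC I σ)
    {x : ℝ} (hx : x ∈ Icc 0 m.decrease) : IsState I (m.state x) ∧ OptimalityABC I (m.state x) := by
  rcases m.decrease_nonneg.eq_or_lt with hdec | hdec
  · -- no progress: the state has not changed
    have hx0 : x = 0 := le_antisymm (hx.2.trans hdec.ge) hx.1
    have : m.state x = σ := by
      rw [hx0, Move.state, m.S_zero, sub_zero]
    rw [this]
    exact ⟨hσ, hopt⟩
  have hD : ∀ e ∈ σ.depl, 0 < e := fun e he => (hσ.1 e he).1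
  refine SolarCell.isState_and_optimalityABC (σ := m.state x) hD (m.yds x hx)
    (sub_nonneg.2 (hx.2.trans m.decrease_le))
    (fun e he => m.battery_depl hσ hopt hdec he hx) (fun j => ?_)
    (fun j => (hopt.1.2.1 j).trans (m.work_univ hσ hx j).ge)
    (SLR.of_levels (fun b hb => ?_) hopt.2.2.jump)
  · by_cases hj : I.d j ∈ σ.depl
    · exact (m.battery_depl hσ hopt hdec hj hx).ge
    · exact m.battery_deadline_nonneg hσ hopt hj hx
  · exact ((m.yds x hx).greedy hD hb).levels_of_cert (m.levelCert hσ hopt hb hx)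

end Move

end SolarCell

theorem mainTheorem3 {n k : ℕ} (I : SolarCell.Instance n k) :
    (∀ σ : SolarCell.State n k, SolarCell.IsInitial I σ →
      SolarCell.IsState I σ ∧ SolarCell.OptimalityABC I σ) ∧
    (∀ σ : SolarCell.State n k, SolarCell.IsState I σ → SolarCell.OptimalityABC I σ →
      ∀ m : SolarCell.Move I σ, ∀ x ∈ Set.Icc 0 m.decrease,
        SolarCell.IsState I (m.state x) ∧ SolarCell.OptimalityABC I (m.state x)) ∧
    (∀ σ σ' : SolarCell.State n k, SolarCell.IsState I σ → SolarCell.OptimalityABC I σ →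
      SolarCell.HandlesNonCutEvent I σ σ' →
        SolarCell.IsState I σ' ∧ SolarCell.OptimalityABC I σ') :=
  ⟨fun _ h => h.isState_and_optimalityABC,
    fun _ hσ hopt m _ hx => m.isState_and_optimalityABC hσ hopt hx,
    fun _ _ hσ hopt h => h.isState_and_optimalityABC hσ hopt⟩
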